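/- Graphs are finite undirected multigraphs, and for edge weights $w:E(G)\to\mathbb C$ put $\mathrm{PerfMatch}(G,w)=\sum_{M}\prod_{e\in M}w(e)$, the sum running over all perfect matchings $M\subseteq E(G)$ of $G$ (loops are never matching edges). For $k\ge 0$ let the surface $S$ be the connected sum of the orientable surface of genus $k$ with the plane (equivalently, for embedding finite graphs, the sphere), the projective plane or the Klein bottle, and let $c=0$, $1$ or $2$ respectively. A plane model on $S$ uses a polygon $P$ (a closed disc whose boundary circle is divided into sides) with sides, in counterclockwise order, $$a_1a_2a_1^{-1}a_2^{-1}\cdots a_{2k-1}a_{2k}a_{2k-1}^{-1}a_{2k}^{-1}\,b_1b_1\cdots b_cb_c ,$$ where two sides labelled by the same symbol are glued, with reversal of the counterclockwise direction for $a_i,a_i^{-1}$ and preserving it for $b_i,b_i$. A plane model of $G$ is an embedding of $G$ in the glued polygon in which all vertices lie in the interior of $P$ and every edge meets the boundary of $P$ in finitely many points, which are not corners and at which it leaves $P$ and re-enters it at the glued boundary point; thus the pieces of edges inside $P$ do not cross. If $k=c=0$, there are no sides and $G$ is drawn in the open disc. The size of the plane model is the number of vertices plus the number of edges of $G$ plus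 the total number of passages of edges through the boundary of $P$. **Theorem.** There are a finite set $\Sigma\subset\mathbb C$ and a constant $C\in\mathbb N$ such that the following holds for every such surface $S$. Let $N=2^{2k+c}$, that is, $N=2^{2k}$, $2^{2k+1}$ or $2^{2k+2}$ if $S$ is the connected sum of the orientable surface of genus $k$ with the plane, the projective plane or the Klein bottle, respectively. There are coefficients $c_1,\dots,c_N\in\mathbb C$, depending only on $S$, such that for every graph $G$ given with a plane model on $S$, of size $s$, there are planar graphs $H_1,\dots,H_N$, each with at most $C(s+1)^C$ vertices and edges in total, whose edges $f$ carry labels of the form $u_f$ or $u_f\cdot w(e)$ with $u_f\in\Sigma$ and $e\in E(G)$, each $e\in E(G)$ occurring in exactly one label of each $H_\theta$, such that for all edge weights $w:E(G)\to\mathbb C$ $$\mathrm{PerfMatch}(G,w)=\sum_{\theta=1}^{N}c_\theta\cdot\mathrm{PerfMatch}(H_\theta,w_\theta),$$ where $w_\theta$ is the edge weighting of $H_\theta$ obtained by evaluating the labels at $w$. The graphs $H_\theta$ and their labels depend only on $G$ and its plane model, not on $w$. -/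

import Mathlib

noncomputable section

/-! ### Perfect matchings of weighted multigraphs -/

/-- `M` is a perfect matching of the multigraph `G`: a set of edges, none of them a loop, such that
every vertex is incident with exactly one of them. -/
def IsPerfMatching {α β : Type*} (G : Graph α β) (M : Set β) : Prop :=
  M ⊆ G.edgeSet ∧ (∀ e ∈ M, ∀ v, ¬ G.IsLoopAt e v) ∧
    ∀ v ∈ G.vertexSet, ∃! e, e ∈ M ∧ G.Inc e v

/-- The weighted number of perfect matchings of the finite multigraph `G` with edge weights `w`. -/
def PerfMatch {α β : Type*} (G : Graph α β) (w : β → ℂ) : ℂ :=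
  ∑ᶠ M ∈ {M : Set β | IsPerfMatching G M}, ∏ᶠ e ∈ M, w e

/-! ### Planar multigraphs -/

/-- A drawing of the multigraph `G` in the plane without crossings. Vertices are distinct points and
every edge is a curve `[0, 1] → ℂ` between its ends; the relative interiors of the curves are
simple, contain no vertex and are pairwise disjoint. -/
structure PlaneDrawing {α β : Type*} (G : Graph α β) where
  pos : α → ℂ
  curve : β → ℝ → ℂ
  pos_injOn : Set.InjOn pos G.vertexSet
  curve_continuousOn : ∀ e ∈ G.edgeSet, ContinuousOn (curve e) (Set.Icc 0 1)
  curve_ends : ∀ e x y, G.IsLink e x y →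
    (curve e 0 = pos x ∧ curve e 1 = pos y) ∨ (curve e 0 = pos y ∧ curve e 1 = pos x)
  curve_ne_pos : ∀ e ∈ G.edgeSet, ∀ v ∈ G.vertexSet, ∀ t ∈ Set.Ioo (0 : ℝ) 1,
    curve e t ≠ pos v
  curve_inj : ∀ e ∈ G.edgeSet, ∀ e' ∈ G.edgeSet,
    ∀ t ∈ Set.Ioo (0 : ℝ) 1, ∀ t' ∈ Set.Ioo (0 : ℝ) 1,
      curve e t = curve e' t' → e = e' ∧ t = t'

/-- A multigraph is planar if it can be drawn in the plane without crossings. -/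
def IsPlanarGraph {α β : Type*} (G : Graph α β) : Prop := Nonempty (PlaneDrawing G)

/-! ### Polygonal plane models of surfaces -/

/-- The word that labels the sides of a polygon in counterclockwise order; the letter `(a, false)`
stands for the symbol `a` and `(a, true)` for its inverse. -/
abbrev SideWord := List (ℕ × Bool)

/-- The word `a₁ a₂ a₁⁻¹ a₂⁻¹ ⋯ a₂ₖ₋₁ a₂ₖ a₂ₖ₋₁⁻¹ a₂ₖ⁻¹ b₁ b₁ ⋯ b_c b_c` with `k` handles followed by `c`
cross caps; the symbol `aⱼ` is encoded as `j - 1` and the symbol `bⱼ` as `2 * k + j - 1`. -/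
def sideWord (k c : ℕ) : SideWord :=
  (List.range k).flatMap
      (fun i => [(2 * i, false), (2 * i + 1, false), (2 * i, true), (2 * i + 1, true)]) ++
    (List.range c).flatMap (fun i => [(2 * k + i, false), (2 * k + i, false)])

/-- The polygon is the closed unit disc, its boundary circle being cut into `n` sides of equal
length. This is the point with parameter `t` of the side number `j`; the parameter increases
counterclockwise, and the relative interior of the side is given by `0 < t < 1`. -/
def sidePoint (n j : ℕ) (t : ℝ) : ℂ :=
  Complex.exp (2 * Real.pi * Complex.I * ((j + t) / n))

/-- The boundary points `p` and `q`, neither of them a corner, are distinct points of the polygon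
that become the same point of the surface: they lie on two different sides labelled by the same
symbol. Sides labelled `a` and `a⁻¹` are glued with reversal of the counterclockwise direction (as in
a handle), and sides labelled `a` and `a` are glued preserving it (as in a cross cap). -/
def Glued (W : SideWord) (p q : ℂ) : Prop :=
  ∃ j j' : Fin W.length, j ≠ j' ∧ (W.get j).1 = (W.get j').1 ∧
    ∃ t ∈ Set.Ioo (0 : ℝ) 1, p = sidePoint W.length j t ∧
      q = sidePoint W.length j' (if (W.get j).2 = (W.get j').2 then t else 1 - t)

/-- A plane model of the multigraph `G` on the surface that arises from the polygon with side word
`W` by gluing its sides, i.e. an embedding of `G` in this surface such that all vertices lie in the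
interior of the polygon and every edge meets the boundary in finitely many points, none of them a
corner. The edge `e` passes through the boundary `crossings e` times and so is cut into the pieces
`arc e 0`, …, `arc e (crossings e)`, which are curves `[0, 1] → ℂ` that run inside the polygon; the
piece `arc e i` leaves the polygon at the boundary point `arc e i 1`, and the edge enters it again at
the point `arc e (i + 1) 0` that is glued to it. -/
structure PlaneModel (W : SideWord) {α β : Type*} (G : Graph α β) where
  pos : α → ℂ
  crossings : β → ℕ
  arc : β → ℕ → ℝ → ℂ
  pos_mem : ∀ v ∈ G.vertexSet, pos v ∈ Metric.ball (0 : ℂ) 1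
  pos_injOn : Set.InjOn pos G.vertexSet
  arc_continuousOn : ∀ e ∈ G.edgeSet, ∀ i ≤ crossings e, ContinuousOn (arc e i) (Set.Icc 0 1)
  arc_mem : ∀ e ∈ G.edgeSet, ∀ i ≤ crossings e, ∀ t ∈ Set.Ioo (0 : ℝ) 1,
    arc e i t ∈ Metric.ball (0 : ℂ) 1
  arc_ends : ∀ e x y, G.IsLink e x y →
    (arc e 0 0 = pos x ∧ arc e (crossings e) 1 = pos y) ∨
      (arc e 0 0 = pos y ∧ arc e (crossings e) 1 = pos x)
  arc_glued : ∀ e ∈ G.edgeSet, ∀ i < crossings e, Glued W (arc e i 1) (arc e (i + 1) 0)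
  arc_ne_pos : ∀ e ∈ G.edgeSet, ∀ i ≤ crossings e, ∀ v ∈ G.vertexSet, ∀ t ∈ Set.Ioo (0 : ℝ) 1,
    arc e i t ≠ pos v
  /-- There are no crossings inside the polygon. -/
  arc_inj : ∀ e ∈ G.edgeSet, ∀ i ≤ crossings e, ∀ e' ∈ G.edgeSet, ∀ i' ≤ crossings e',
    ∀ t ∈ Set.Ioo (0 : ℝ) 1, ∀ t' ∈ Set.Ioo (0 : ℝ) 1,
      arc e i t = arc e' i' t' → e = e' ∧ i = i' ∧ t = t'
  /-- The points in which the edges pass through the boundary are distinct points of the surface: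
  all exits are distinct, and no exit is an entrance. -/
  exit_inj : ∀ e ∈ G.edgeSet, ∀ i < crossings e, ∀ e' ∈ G.edgeSet, ∀ i' < crossings e',
    arc e i 1 = arc e' i' 1 → e = e' ∧ i = i'
  exit_ne_entrance : ∀ e ∈ G.edgeSet, ∀ i < crossings e, ∀ e' ∈ G.edgeSet, ∀ i' < crossings e',
    arc e i 1 ≠ arc e' (i' + 1) 0

/-- The size of a plane model: the number of vertices and edges of the graph, plus the total number
of times that edges pass through the boundary of the polygon. -/
def PlaneModel.size {W : SideWord} {α β : Type*} {G : Graph α β} (D : PlaneModel W G) : ℕ :=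
  G.vertexSet.ncard + G.edgeSet.ncard + ∑ᶠ e ∈ G.edgeSet, D.crossings e

/-- The surface with which the orientable surface of genus `k` is connected: the plane, the
projective plane or the Klein bottle. -/
inductive BaseSurface
  | plane
  | projectivePlane
  | kleinBottle

/-- The number of cross caps of the surface. -/
def BaseSurface.crossCaps : BaseSurface → ℕ
  | plane => 0
  | projectivePlane => 1
  | kleinBottle => 2

end

/-! Cut every edge at its passages through the boundary of the polygon. At each passage insert two
vertices, the exit and the entrance, joined by a connection of weight 1. An edge then becomes a path
of odd length, so the weighted count of perfect matchings is unchanged. Let `Z` be the set of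
connections that a matching does not use. Then the count is the sum over all `Z` of the matchings of
the pieces inside the polygon that cover the vertices of `G` and both ends of every connection in
`Z`. The pieces are drawn without crossings in the open disc; only the connections obstruct
planarity.

Now replace the connections by a planar graph outside the disc. The two ends of each connection are
ports on the circle that carry the same label, and a strand is led from one port to the other. Where
two strands cross, a planar gadget (`ladder`) is inserted. It transmits the state of both strands
and contributes -1 if both labels lie in `Z`. Where the two ends of a strand meet, a path of three
edges with a middle edge of weight `u` contributes `u` if the label lies in `Z`. Hence the outer
graph acts on everything attached to its ports as a formal sum over `Z` with explicit coefficients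
`g Z`. This is the `signature` of a `Tangle`, and it multiplies when layers are added
(`Tangle.extend`).

For a handle with `m` and `n` strands in `Z` on its two symbols, each strand of one kind crosses
each of the other, which gives `(-1)^(m n) u^m v^n`. For a cross cap with `n` strands in `Z` any two
strands cross, which gives `(-1)^(n choose 2) u^n`. Both signs can be cancelled by averaging over a
few weights: `(-1)^(m n)` is half of `1 + (-1)^m + (-1)^n - (-1)^(m+n)`, and `(-1)^(n choose 2)` is
`((1 - i) i^n + (1 + i) (-i)^n) / 2`. So four choices for each handle and two for each cross cap
combine to the constant coefficient 1 for every `Z` (`sum_signCoeff`), and the combination of the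
planar counts is the count for `G`.

The algebra is carried by `pm_connections`, `pm_paths` and `solvable_sideWord`. The geometry rests
on straight-line drawings in the strip `0 < x < 1`, which polar coordinates wrap around the disc
(`Tangle.isDrawing`). -/

/-- The weighted number of matchings in a list of weighted edges that cover exactly `S`. -/
noncomputable def pm {X : Type*} [DecidableEq X] : List (X × X × ℂ) → Finset X → ℂ
  | [], S => if S = ∅ then 1 else 0
  | e :: L, S => pm L S +
      if e.1 ≠ e.2.1 ∧ e.1 ∈ S ∧ e.2.1 ∈ S then e.2.2 * pm L (S \ {e.1, e.2.1}) else 0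

/-! ### Matchings of weighted edge lists, subdivision and the crossing gadget -/

section pm
variable {X : Type*} [DecidableEq X]

/-- The vertex `v` is not an end of an edge in `L`. -/
def Fresh (v : X) (L : List (X × X × ℂ)) : Prop := ∀ e ∈ L, e.1 ≠ v ∧ e.2.1 ≠ v

lemma pm_fresh {v : X} {L : List (X × X × ℂ)} (h : Fresh v L) {S : Finset X} (hv : v ∈ S) :
    pm L S = 0 := by
  induction L generalizing S with
  | nil => simp [pm, Finset.ne_empty_of_mem hv]
  | cons e L ih =>
    have h' : Fresh v L := fun f hf => h f (List.mem_cons_of_mem _ hf)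
    have he := h e List.mem_cons_self
    rw [pm, ih h' hv, ih h' (S := S \ {e.1, e.2.1})]
    · simp
    · simp [hv, he.1.symm, he.2.symm]

lemma pm_swap (e f : X × X × ℂ) (L : List (X × X × ℂ)) (S : Finset X) :
    pm (e :: f :: L) S = pm (f :: e :: L) S := by
  have h : (S \ {e.1, e.2.1}) \ {f.1, f.2.1} = (S \ {f.1, f.2.1}) \ {e.1, e.2.1} := by
    rw [sdiff_sdiff_comm]
  simp only [pm, h, Finset.mem_sdiff, Finset.mem_insert, Finset.mem_singleton]
  split_ifs <;> first | ring1 | (exfalso; grind)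

lemma pm_perm {L L' : List (X × X × ℂ)} (h : L.Perm L') (S : Finset X) : pm L S = pm L' S := by
  induction h generalizing S with
  | nil => rfl
  | cons e _ ih => simp [pm, ih]
  | swap e f L => exact pm_swap _ _ _ _
  | trans _ _ h1 h2 => rw [h1, h2]

/-- Subdividing an edge by two vertices. -/
lemma pm_subdiv {x y p q : X} (w : ℂ) {L : List (X × X × ℂ)} {S : Finset X}
    (hpq : p ≠ q) (hpS : p ∉ S) (hqS : q ∉ S) (hpx : p ≠ x) (hpy : p ≠ y) (hqx : q ≠ x)
    (hqy : q ≠ y) (hp : Fresh p L) (hq : Fresh q L) :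
    pm ((x, p, w) :: (p, q, 1) :: (q, y, 1) :: L) (insert p (insert q S)) =
      pm ((x, y, w) :: L) S := by
  have h0 : ∀ {T : Finset X}, p ∈ T → pm L T = 0 := fun h => pm_fresh hp h
  have h1 : ∀ {T : Finset X}, q ∈ T → pm L T = 0 := fun h => pm_fresh hq h
  have e1 : insert p (insert q S) \ {p, q} = S := by
    ext z; simp only [Finset.mem_sdiff, Finset.mem_insert, Finset.mem_singleton]; grind
  have e2 : (insert p (insert q S) \ {x, p}) \ {q, y} = S \ {x, y} := by
    ext z; simp only [Finset.mem_sdiff, Finset.mem_insert, Finset.mem_singleton]; grind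
  -- A loop counts for nothing on the right; on the left the two outer pieces would both cover `x`,
  -- so only the middle edge can be used.
  by_cases hxy : x = y
  · subst hxy
    by_cases hx : x ∈ S <;>
      simp [pm, h0, h1, e1, hpq, hpq.symm, hpx, hpx.symm, hqx, hqx.symm, hpS, hqS, hx]
  · by_cases hx : x ∈ S <;> by_cases hy : y ∈ S <;>
      simp [pm, h0, h1, e1, e2, hpq, hpq.symm, hpx, hpx.symm, hpy, hpy.symm, hqx, hqx.symm, hqy,
        hqy.symm, hpS, hqS, hx, hy, hxy, Ne.symm hxy, add_comm]

/-- The gadget for a crossing of two strands: a grid with the rows `A, c, B` and `t, d, s`, of which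
`A` and `B` are joined to the ends `p` and `q` of the strands. -/
def ladder (p q A B c d s t : X) : List (X × X × ℂ) :=
  [(A, p, 1), (A, c, 1), (A, t, -1), (B, q, 1), (B, c, 1), (B, s, -1), (c, d, 1), (d, t, 1),
    (d, s, 1)]

/-- In the four ladder identities the subset of `{s, t}` is what the graph above leaves to be
covered, and the right side shows what is passed on to `L`. The state of `s` reappears at `p` and
that of `t` at `q`, so the strands cross. Here `c` and `d` must be matched with each other, since
neither `s` nor `t` is available to `d`. -/
lemma pm_ladder_none {p q A B c d s t : X} {W : Finset X} {L : List (X × X × ℂ)}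
    (hnd : [p, q, A, B, c, d, s, t].Nodup) (hW : ∀ v ∈ [p, q, A, B, c, d, s, t], v ∉ W)
    (hL : ∀ v ∈ [A, B, c, d, s, t], Fresh v L) :
    pm (ladder p q A B c d s t ++ L) (W ∪ ({p, q, A, B, c, d} ∪ ∅)) = pm L W := by
  have hnd' := List.nodup_reverse.2 hnd
  simp only [List.reverse_cons, List.reverse_nil, List.nil_append, List.cons_append,
    List.nodup_cons, List.mem_cons, not_or, List.not_mem_nil, not_false_eq_true,
    forall_eq_or_imp] at hnd hnd' hW hL
  obtain ⟨hA, hB, hc, hd, hs, ht, -⟩ := hL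
  have hA' : ∀ {T : Finset X}, A ∈ T → pm L T = 0 := fun h => pm_fresh hA h
  have hB' : ∀ {T : Finset X}, B ∈ T → pm L T = 0 := fun h => pm_fresh hB h
  have hc' : ∀ {T : Finset X}, c ∈ T → pm L T = 0 := fun h => pm_fresh hc h
  have hd' : ∀ {T : Finset X}, d ∈ T → pm L T = 0 := fun h => pm_fresh hd h
  have hs' : ∀ {T : Finset X}, s ∈ T → pm L T = 0 := fun h => pm_fresh hs h
  have ht' : ∀ {T : Finset X}, t ∈ T → pm L T = 0 := fun h => pm_fresh ht h
  simp [ladder, pm, hA', hB', hc', hd', hnd, hnd', hW, Finset.sdiff_insert,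
    Finset.sdiff_singleton_eq_erase, Finset.erase_insert_of_ne]
-- The desired state comes from `A c`, `d s`, `B q`. The unwanted one, with `q` left over, arises
-- from `A p`, `B s`, `c d` with weight -1 and from `A p`, `B c`, `d s` with weight 1, and cancels;
-- this forces the negative weights.
lemma pm_ladder_left {p q A B c d s t : X} {W : Finset X} {L : List (X × X × ℂ)}
    (hnd : [p, q, A, B, c, d, s, t].Nodup) (hW : ∀ v ∈ [p, q, A, B, c, d, s, t], v ∉ W)
    (hL : ∀ v ∈ [A, B, c, d, s, t], Fresh v L) :
    pm (ladder p q A B c d s t ++ L) (W ∪ ({p, q, A, B, c, d} ∪ {s})) = pm L (W ∪ {p}) := by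
  have hnd' := List.nodup_reverse.2 hnd
  simp only [List.reverse_cons, List.reverse_nil, List.nil_append, List.cons_append,
    List.nodup_cons, List.mem_cons, not_or, List.not_mem_nil, not_false_eq_true,
    forall_eq_or_imp] at hnd hnd' hW hL
  obtain ⟨hA, hB, hc, hd, hs, ht, -⟩ := hL
  have hA' : ∀ {T : Finset X}, A ∈ T → pm L T = 0 := fun h => pm_fresh hA h
  have hB' : ∀ {T : Finset X}, B ∈ T → pm L T = 0 := fun h => pm_fresh hB h
  have hc' : ∀ {T : Finset X}, c ∈ T → pm L T = 0 := fun h => pm_fresh hc h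
  have hd' : ∀ {T : Finset X}, d ∈ T → pm L T = 0 := fun h => pm_fresh hd h
  have hs' : ∀ {T : Finset X}, s ∈ T → pm L T = 0 := fun h => pm_fresh hs h
  have ht' : ∀ {T : Finset X}, t ∈ T → pm L T = 0 := fun h => pm_fresh ht h
  simp [ladder, pm, hA', hB', hc', hd', hs', hnd, hnd', hW, Finset.sdiff_insert,
    Finset.sdiff_singleton_eq_erase, Finset.erase_insert_of_ne]
-- The mirror image of `pm_ladder_left`.
lemma pm_ladder_right {p q A B c d s t : X} {W : Finset X} {L : List (X × X × ℂ)}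
    (hnd : [p, q, A, B, c, d, s, t].Nodup) (hW : ∀ v ∈ [p, q, A, B, c, d, s, t], v ∉ W)
    (hL : ∀ v ∈ [A, B, c, d, s, t], Fresh v L) :
    pm (ladder p q A B c d s t ++ L) (W ∪ ({p, q, A, B, c, d} ∪ {t})) = pm L (W ∪ {q}) := by
  have hnd' := List.nodup_reverse.2 hnd
  simp only [List.reverse_cons, List.reverse_nil, List.nil_append, List.cons_append,
    List.nodup_cons, List.mem_cons, not_or, List.not_mem_nil, not_false_eq_true,
    forall_eq_or_imp] at hnd hnd' hW hL
  obtain ⟨hA, hB, hc, hd, hs, ht, -⟩ := hL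
  have hA' : ∀ {T : Finset X}, A ∈ T → pm L T = 0 := fun h => pm_fresh hA h
  have hB' : ∀ {T : Finset X}, B ∈ T → pm L T = 0 := fun h => pm_fresh hB h
  have hc' : ∀ {T : Finset X}, c ∈ T → pm L T = 0 := fun h => pm_fresh hc h
  have hd' : ∀ {T : Finset X}, d ∈ T → pm L T = 0 := fun h => pm_fresh hd h
  have hs' : ∀ {T : Finset X}, s ∈ T → pm L T = 0 := fun h => pm_fresh hs h
  have ht' : ∀ {T : Finset X}, t ∈ T → pm L T = 0 := fun h => pm_fresh ht h
  simp [ladder, pm, hA', hB', hc', hd', ht', hnd, hnd', hW, Finset.sdiff_insert,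
    Finset.sdiff_singleton_eq_erase, Finset.erase_insert_of_ne]
-- Three matchings of the gadget leave both `p` and `q`: `A t`, `B s`, `c d` of weight 1, and `A c`,
-- `d t`, `B s` and `A t`, `B c`, `d s` of weight -1 each. The total is -1, the sign of the
-- crossing.
lemma pm_ladder_both {p q A B c d s t : X} {W : Finset X} {L : List (X × X × ℂ)}
    (hnd : [p, q, A, B, c, d, s, t].Nodup) (hW : ∀ v ∈ [p, q, A, B, c, d, s, t], v ∉ W)
    (hL : ∀ v ∈ [A, B, c, d, s, t], Fresh v L) :
    pm (ladder p q A B c d s t ++ L) (W ∪ ({p, q, A, B, c, d} ∪ {s, t})) = -pm L (W ∪ {p, q}) := by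
  have hnd' := List.nodup_reverse.2 hnd
  simp only [List.reverse_cons, List.reverse_nil, List.nil_append, List.cons_append,
    List.nodup_cons, List.mem_cons, not_or, List.not_mem_nil, not_false_eq_true,
    forall_eq_or_imp] at hnd hnd' hW hL
  obtain ⟨hA, hB, hc, hd, hs, ht, -⟩ := hL
  have hA' : ∀ {T : Finset X}, A ∈ T → pm L T = 0 := fun h => pm_fresh hA h
  have hB' : ∀ {T : Finset X}, B ∈ T → pm L T = 0 := fun h => pm_fresh hB h
  have hc' : ∀ {T : Finset X}, c ∈ T → pm L T = 0 := fun h => pm_fresh hc h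
  have hd' : ∀ {T : Finset X}, d ∈ T → pm L T = 0 := fun h => pm_fresh hd h
  have hs' : ∀ {T : Finset X}, s ∈ T → pm L T = 0 := fun h => pm_fresh hs h
  have ht' : ∀ {T : Finset X}, t ∈ T → pm L T = 0 := fun h => pm_fresh ht h
  simp [ladder, pm, hA', hB', hc', hd', hs', ht', hnd, hnd', hW, Finset.sdiff_insert,
    Finset.sdiff_singleton_eq_erase, Finset.erase_insert_of_ne]
end pm

/-! ### Comparison of the recursive count with the sum over perfect matchings -/

section PerfMatch

/-- `M` covers every vertex of `S` exactly once, and no other vertex. -/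
def CoversExactly {X β : Type*} (src tgt : β → X) (M : Finset β) (S : Finset X) : Prop :=
  (∀ e ∈ M, src e ≠ tgt e ∧ src e ∈ S ∧ tgt e ∈ S) ∧
    ∀ v ∈ S, ∃! e, e ∈ M ∧ (v = src e ∨ v = tgt e)

/-- Removing the edge `e` from a matching frees its two ends: this is the recursion that defines
`pm`. -/
lemma coversExactly_insert {X β : Type*} [DecidableEq X] [DecidableEq β] {src tgt : β → X} {e : β}
    {M : Finset β} (he : e ∉ M) (S : Finset X) :
    CoversExactly src tgt (insert e M) S ↔
      (src e ≠ tgt e ∧ src e ∈ S ∧ tgt e ∈ S) ∧ CoversExactly src tgt M (S \ {src e, tgt e}) := by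
  constructor
  · rintro ⟨h1, h2⟩
    have he' := h1 e (by simp)
    refine ⟨he', fun f hf => ?_, fun v hv => ?_⟩
    · obtain ⟨a, b, c⟩ := h1 f (by simp [hf])
      have hfe : f ≠ e := fun h => he (h ▸ hf)
      have key : ∀ v ∈ S, (v = src e ∨ v = tgt e) → (v = src f ∨ v = tgt f) → False :=
        fun v hv h h' => hfe ((h2 v hv).unique ⟨by simp [hf], h'⟩ ⟨by simp, h⟩)
      simp only [Finset.mem_sdiff, Finset.mem_insert, Finset.mem_singleton]
      exact ⟨a, ⟨b, fun h => key _ b h (Or.inl rfl)⟩, ⟨c, fun h => key _ c h (Or.inr rfl)⟩⟩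
    · simp only [Finset.mem_sdiff, Finset.mem_insert, Finset.mem_singleton] at hv
      obtain ⟨f, ⟨hf, hvf⟩, hu⟩ := h2 v hv.1
      refine ⟨f, ⟨(Finset.mem_insert.1 hf).resolve_left ?_, hvf⟩, fun g hg => hu g ⟨by simp [hg.1], hg.2⟩⟩
      rintro rfl
      exact hv.2 hvf
  · rintro ⟨he', h1, h2⟩
    simp only [Finset.mem_sdiff, Finset.mem_insert, Finset.mem_singleton] at h1 h2
    refine ⟨fun f hf => ?_, fun v hv => ?_⟩
    · rcases Finset.mem_insert.1 hf with rfl | hf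
      · exact he'
      · exact ⟨(h1 f hf).1, (h1 f hf).2.1.1, (h1 f hf).2.2.1⟩
    · by_cases hve : v = src e ∨ v = tgt e
      · refine ⟨e, ⟨by simp, hve⟩, fun g hg => ?_⟩
        rcases Finset.mem_insert.1 hg.1 with rfl | hgM
        · rfl
        · have := h1 g hgM
          rcases hg.2 with h | h
          · exact absurd (h ▸ hve) this.2.1.2
          · exact absurd (h ▸ hve) this.2.2.2
      · obtain ⟨f, ⟨hf, hvf⟩, hu⟩ := h2 v ⟨hv, hve⟩
        refine ⟨f, ⟨by simp [hf], hvf⟩, fun g hg => hu g ⟨(Finset.mem_insert.1 hg.1).resolve_left ?_, hg.2⟩⟩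
        rintro rfl
        exact hve hg.2

open Classical in
lemma pm_eq_sum {X β : Type*} [DecidableEq X] (src tgt : β → X) (w : β → ℂ) {es : List β}
    (hes : es.Nodup) (S : Finset X) :
    pm (es.map fun e => (src e, tgt e, w e)) S =
      ∑ M ∈ es.toFinset.powerset with CoversExactly src tgt M S, ∏ e ∈ M, w e := by
  induction es generalizing S with
  | nil =>
    have : CoversExactly src tgt ∅ S ↔ S = ∅ := by
      simp [CoversExactly, Finset.eq_empty_iff_forall_notMem]
    simp [pm, Finset.filter_singleton, this]
    split_ifs <;> simp
  | cons e es ih =>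
    obtain ⟨he, hes⟩ := List.nodup_cons.1 hes
    have he' : e ∉ es.toFinset := by simpa using he
    rw [List.map_cons, pm, ih hes, ih hes, List.toFinset_cons]
    simp only [Finset.sum_filter]
    rw [Finset.sum_powerset_insert he']
    congr 1
    split_ifs with h
    · rw [Finset.mul_sum]
      refine Finset.sum_congr rfl fun M hM => ?_
      have heM : e ∉ M := fun h => he' (Finset.mem_powerset.1 hM h)
      rw [coversExactly_insert heM, Finset.prod_insert heM]
      simp [h]
    · refine (Finset.sum_eq_zero fun M hM => ?_).symm
      have heM : e ∉ M := fun h => he' (Finset.mem_powerset.1 hM h)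
      rw [coversExactly_insert heM, if_neg fun h' => h h'.1]

/-- Passage from multigraphs to lists. The map `φ` names vertices by coordinates, and `hlink` leaves
the direction in which an edge is listed free, as incidence does not depend on it. -/
lemma PerfMatch_eq_pm {α β X : Type*} [DecidableEq X] (G : Graph α β) {es : List β}
    (hes : es.Nodup) (hmem : ∀ e, e ∈ es ↔ e ∈ G.edgeSet) {φ : α → X}
    (hφ : Set.InjOn φ G.vertexSet) {V : Finset X} (hV : (V : Set X) = φ '' G.vertexSet)
    {src tgt : β → X}
    (hlink : ∀ e x y, G.IsLink e x y → (src e = φ x ∧ tgt e = φ y) ∨ (src e = φ y ∧ tgt e = φ x))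
    (w : β → ℂ) :
    PerfMatch G w = pm (es.map fun e => (src e, tgt e, w e)) V := by
  classical
  rw [pm_eq_sum _ _ _ hes, PerfMatch]
  have hVm : ∀ v, v ∈ V ↔ ∃ x ∈ G.vertexSet, φ x = v := fun v => by
    rw [← Finset.mem_coe, hV]; rfl
  have hinc : ∀ e ∈ G.edgeSet, ∀ x ∈ G.vertexSet,
      G.Inc e x ↔ (φ x = src e ∨ φ x = tgt e) := by
    intro e he x hx
    obtain ⟨a, b, hab⟩ := G.exists_isLink_of_mem_edgeSet he
    have h1 : G.Inc e x ↔ x = a ∨ x = b := by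
      constructor
      · exact fun h => h.eq_or_eq_of_isLink hab
      · rintro (rfl | rfl)
        exacts [hab.inc_left, hab.inc_right]
    have h2 : φ x = φ a ↔ x = a := hφ.eq_iff hx hab.left_mem
    have h3 : φ x = φ b ↔ x = b := hφ.eq_iff hx hab.right_mem
    rcases hlink e a b hab with ⟨h, h'⟩ | ⟨h, h'⟩ <;> rw [h1, h, h', h2, h3]
    exact or_comm
  have hloop : ∀ e ∈ G.edgeSet, (src e ∈ V ∧ tgt e ∈ V) ∧
      ((∀ v, ¬ G.IsLoopAt e v) ↔ src e ≠ tgt e) := by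
    intro e he
    obtain ⟨a, b, hab⟩ := G.exists_isLink_of_mem_edgeSet he
    have ha : φ a ∈ V := (hVm _).2 ⟨a, hab.left_mem, rfl⟩
    have hb : φ b ∈ V := (hVm _).2 ⟨b, hab.right_mem, rfl⟩
    have h1 : (∀ v, ¬ G.IsLoopAt e v) ↔ φ a ≠ φ b := by
      rw [Ne, hφ.eq_iff hab.left_mem hab.right_mem]
      constructor
      · rintro h rfl
        exact h a hab
      · intro h v hv
        exact h ((hv.eq_of_inc hab.inc_left).symm.trans (hv.eq_of_inc hab.inc_right))
    rw [h1]
    rcases hlink e a b hab with ⟨h, h'⟩ | ⟨h, h'⟩ <;> rw [h, h']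
    · exact ⟨⟨ha, hb⟩, Iff.rfl⟩
    · exact ⟨⟨hb, ha⟩, ne_comm⟩
  have key : ∀ M : Finset β, (M : Set β) ⊆ G.edgeSet →
      (IsPerfMatching G (M : Set β) ↔ CoversExactly src tgt M V) := by
    intro M hM
    unfold IsPerfMatching CoversExactly
    constructor
    · rintro ⟨-, h1, h2⟩
      refine ⟨fun e he => ⟨(hloop e (hM he)).2.1 (h1 e he), (hloop e (hM he)).1⟩, fun v hv => ?_⟩
      obtain ⟨x, hx, rfl⟩ := (hVm v).1 hv
      obtain ⟨e, ⟨he, hi⟩, hu⟩ := h2 x hx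
      exact ⟨e, ⟨he, (hinc e (hM he) x hx).1 hi⟩,
        fun f hf => hu f ⟨hf.1, (hinc f (hM hf.1) x hx).2 hf.2⟩⟩
    · rintro ⟨h1, h2⟩
      refine ⟨hM, fun e he => (hloop e (hM he)).2.2 (h1 e he).1, fun x hx => ?_⟩
      obtain ⟨e, ⟨he, hi⟩, hu⟩ := h2 (φ x) ((hVm _).2 ⟨x, hx, rfl⟩)
      exact ⟨e, ⟨he, (hinc e (hM he) x hx).2 hi⟩,
        fun f hf => hu f ⟨hf.1, (hinc f (hM hf.1) x hx).1 hf.2⟩⟩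
  have hset : {M : Set β | IsPerfMatching G M} = (fun M : Finset β => (M : Set β)) ''
      (({M ∈ es.toFinset.powerset | CoversExactly src tgt M V} : Finset (Finset β)) :
        Set (Finset β)) := by
    ext M
    simp only [Set.mem_ofPred_eq, Set.mem_image, Finset.coe_filter, Finset.mem_powerset]
    constructor
    · intro hM
      have hfin : M.Finite := (es.toFinset.finite_toSet).subset fun e he => by
        simpa [hmem] using hM.1 he
      lift M to Finset β using hfin
      exact ⟨M, ⟨fun e he => by simpa [hmem] using hM.1 he, (key M hM.1).1 hM⟩, rfl⟩
    · rintro ⟨M, ⟨hM, hc⟩, rfl⟩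
      exact (key M fun e he => by simpa [hmem] using hM he).2 hc
  rw [hset, finsum_mem_image (Finset.coe_injective.injOn), finsum_mem_coe_finset]
  exact Finset.sum_congr rfl fun M _ => finprod_mem_coe_finset _ _

end PerfMatch

/-! ### Outer graphs and their signatures -/

section Tangle
open Classical

/-- The constants that occur in edge labels. -/
noncomputable def unitConstants : Finset ℂ := {1, -1, Complex.I, -Complex.I}

variable {ι : Type*}

/-- The positions of the ports in `P` whose label belongs to `Z`. -/
noncomputable def portPts (P : List ((ℝ × ℝ) × ι)) (Z : Finset ι) : Finset (ℝ × ℝ) :=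
  ((P.filter (fun p => p.2 ∈ Z)).map Prod.fst).toFinset

lemma mem_portPts {P : List ((ℝ × ℝ) × ι)} {Z : Finset ι} {v : ℝ × ℝ} :
    v ∈ portPts P Z ↔ ∃ p ∈ P, p.2 ∈ Z ∧ p.1 = v := by
  simp [portPts, and_assoc]

/-- The labels of the ports in `P`. -/
noncomputable def portLabels (P : List ((ℝ × ℝ) × ι)) : Finset ι := (P.map Prod.snd).toFinset

/-- The part of the strip above the ports in `P` that an outer graph may use: everything of height
more than `M`, and the vertical rays that start in ports. -/
def Region (P : List ((ℝ × ℝ) × ι)) (M : ℝ) (v : ℝ × ℝ) : Prop :=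
  0 < v.1 ∧ v.1 < 1 ∧ (M < v.2 ∨ ∃ p ∈ P, p.1.1 = v.1 ∧ p.1.2 ≤ v.2)

/-- A straight-line drawing `(V, L)` above the ports `P` that acts on every graph which is attached
to it at the ports as the formal sum over the sets `Z` of labels, with coefficients `g Z`, of the
graphs in which just the ports with labels in `Z` are left to be covered. -/
structure Tangle (P : List ((ℝ × ℝ) × ι)) (M : ℝ) (V : Finset (ℝ × ℝ))
    (L : List ((ℝ × ℝ) × (ℝ × ℝ) × ℂ)) (g : Finset ι → ℂ) : Prop where
  ports_mem : ∀ p ∈ P, p.1 ∈ V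
  ends_mem : ∀ e ∈ L, e.1 ∈ V ∧ e.2.1 ∈ V ∧ e.1 ≠ e.2.1
  weight_mem : ∀ e ∈ L, e.2.2 ∈ unitConstants
  pairwise : L.Pairwise fun e f => Disjoint (openSegment ℝ e.1 e.2.1) (openSegment ℝ f.1 f.2.1)
  notMem_segment : ∀ e ∈ L, ∀ v ∈ V, v ∉ openSegment ℝ e.1 e.2.1
  region_vertex : ∀ v ∈ V, Region P M v
  region_segment : ∀ e ∈ L, ∀ z ∈ openSegment ℝ e.1 e.2.1, Region P M z
  signature : ∀ (L₁ : List ((ℝ × ℝ) × (ℝ × ℝ) × ℂ)) (W : Finset (ℝ × ℝ)),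
    (∀ v ∈ V, (∀ p ∈ P, p.1 ≠ v) → Fresh v L₁) → Disjoint W V →
      pm (L ++ L₁) (W ∪ V) =
        ∑ Z ∈ (portLabels P).powerset, g Z * pm L₁ (W ∪ portPts P Z)

/-- A layer `K` with new vertices `U` is inserted between the ports `P` and an outer graph on the
ports `P'`. The region of the old graph is disjoint from the layer, which excludes all crossings
between them. For the signature, the old graph is applied to `K ++ L₁`, and `hsig` evaluates the
layer. -/
lemma Tangle.extend {P P' : List ((ℝ × ℝ) × ι)} {M M' : ℝ} {V' U : Finset (ℝ × ℝ)}
    {L' K : List ((ℝ × ℝ) × (ℝ × ℝ) × ℂ)} {g g' : Finset ι → ℂ} (T : Tangle P' M' V' L' g')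
    (hP : ∀ p ∈ P, p.1 ∈ U ∨ ∃ p' ∈ P', p'.1 = p.1)
    (hends : ∀ e ∈ K, (e.1 ∈ U ∨ ∃ p' ∈ P', p'.1 = e.1) ∧ (e.2.1 ∈ U ∨ ∃ p' ∈ P', p'.1 = e.2.1) ∧
      e.1 ≠ e.2.1)
    (hwt : ∀ e ∈ K, e.2.2 ∈ unitConstants)
    (hpw : K.Pairwise fun e f => Disjoint (openSegment ℝ e.1 e.2.1) (openSegment ℝ f.1 f.2.1))
    (hvert : ∀ e ∈ K, ∀ v ∈ U, v ∉ openSegment ℝ e.1 e.2.1)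
    (hreg : ∀ z, Region P' M' z → Region P M z)
    (hU : ∀ v ∈ U, Region P M v ∧ ¬ Region P' M' v)
    (hK : ∀ e ∈ K, ∀ z ∈ openSegment ℝ e.1 e.2.1, Region P M z ∧ ¬ Region P' M' z)
    (hsig : ∀ (L₁ : List ((ℝ × ℝ) × (ℝ × ℝ) × ℂ)) (W : Finset (ℝ × ℝ)),
      (∀ v ∈ V' ∪ U, (∀ p ∈ P, p.1 ≠ v) → Fresh v L₁) → Disjoint W (V' ∪ U) →
      ∑ Z ∈ (portLabels P').powerset, g' Z * pm (K ++ L₁) (W ∪ U ∪ portPts P' Z) =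
        ∑ Z ∈ (portLabels P).powerset, g Z * pm L₁ (W ∪ portPts P Z)) :
    Tangle P M (V' ∪ U) (K ++ L') g := by
  have hmem : ∀ v : ℝ × ℝ, (v ∈ U ∨ ∃ p' ∈ P', p'.1 = v) → v ∈ V' ∪ U := by
    rintro v (h | ⟨p', hp', rfl⟩)
    · exact Finset.mem_union_right _ h
    · exact Finset.mem_union_left _ (T.ports_mem p' hp')
  have hUV : ∀ v ∈ U, v ∉ V' := fun v hv hv' => (hU v hv).2 (T.region_vertex v hv')
  refine ⟨fun p hp => hmem _ (hP p hp), fun e he => ?_, fun e he => ?_, ?_, fun e he v hv => ?_,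
    fun v hv => ?_, fun e he z hz => ?_, fun L₁ W hL₁ hW => ?_⟩
  · rcases List.mem_append.1 he with he | he
    · exact ⟨hmem _ (hends e he).1, hmem _ (hends e he).2.1, (hends e he).2.2⟩
    · obtain ⟨h1, h2, h3⟩ := T.ends_mem e he
      exact ⟨Finset.mem_union_left _ h1, Finset.mem_union_left _ h2, h3⟩
  · rcases List.mem_append.1 he with he | he
    exacts [hwt e he, T.weight_mem e he]
  · refine List.pairwise_append.2 ⟨hpw, T.pairwise, fun e he f hf => ?_⟩
    exact Set.disjoint_left.2 fun z hz hz' => (hK e he z hz).2 (T.region_segment f hf z hz')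
  · rcases List.mem_append.1 he with he | he <;> rcases Finset.mem_union.1 hv with hv | hv
    · exact fun h => (hK e he v h).2 (T.region_vertex v hv)
    · exact hvert e he v hv
    · exact T.notMem_segment e he v hv
    · exact fun h => (hU v hv).2 (T.region_segment e he v h)
  · rcases Finset.mem_union.1 hv with hv | hv
    exacts [hreg _ (T.region_vertex v hv), (hU v hv).1]
  · rcases List.mem_append.1 he with he | he
    exacts [(hK e he z hz).1, hreg _ (T.region_segment e he z hz)]
  -- From the point of view of the old graph, the new layer is a part of what is attached to its
  -- ports.
  · rw [← hsig L₁ W hL₁ hW, ← T.signature (K ++ L₁) (W ∪ U)]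
    · rw [Finset.union_right_comm, ← Finset.union_assoc]
      apply pm_perm
      rw [← List.append_assoc]
      exact List.Perm.append_right _ List.perm_append_comm
    · intro v hv hvP e he
      rcases List.mem_append.1 he with he | he
      · have key : ∀ u : ℝ × ℝ, (u ∈ U ∨ ∃ p' ∈ P', p'.1 = u) → u ≠ v := by
          rintro u (h | ⟨p', hp', rfl⟩) rfl
          exacts [hUV _ h hv, hvP p' hp' rfl]
        exact ⟨key _ (hends e he).1, key _ (hends e he).2.1⟩
      · refine hL₁ v (Finset.mem_union_left _ hv) (fun p hp h => ?_) e he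
        rcases hP p hp with h' | ⟨p', hp', h'⟩
        · exact hUV _ h' (h ▸ hv)
        · exact hvP p' hp' (h'.trans h)
    · rw [Finset.disjoint_left]
      intro v hv hv'
      rcases Finset.mem_union.1 hv with h | h
      · exact Finset.disjoint_left.1 hW h (Finset.mem_union_left _ hv')
      · exact hUV v h hv'

lemma openSegment_vert {x h k : ℝ} (hk : h < k) :
    openSegment ℝ ((x, h) : ℝ × ℝ) (x, k) = {z | z.1 = x ∧ h < z.2 ∧ z.2 < k} := by
  rw [← Prod.image_mk_openSegment_right, openSegment_eq_Ioo hk]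
  ext ⟨a, b⟩
  simp [eq_comm, and_comm]

lemma openSegment_vert' {x h k : ℝ} (hk : h < k) :
    openSegment ℝ ((x, k) : ℝ × ℝ) (x, h) = {z | z.1 = x ∧ h < z.2 ∧ z.2 < k} := by
  rw [openSegment_symm, openSegment_vert hk]

lemma openSegment_horiz {x y h : ℝ} (hk : x < y) :
    openSegment ℝ ((x, h) : ℝ × ℝ) (y, h) = {z | z.2 = h ∧ x < z.1 ∧ z.1 < y} := by
  rw [← Prod.image_mk_openSegment_left, openSegment_eq_Ioo hk]
  ext ⟨a, b⟩
  simp [eq_comm, and_comm]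

lemma openSegment_horiz' {x y h : ℝ} (hk : x < y) :
    openSegment ℝ ((y, h) : ℝ × ℝ) (x, h) = {z | z.2 = h ∧ x < z.1 ∧ z.1 < y} := by
  rw [openSegment_symm, openSegment_horiz hk]

/-- Outer graphs of size at most `n` and with signature `g` exist for all sequences of ports with
label sequence `w`. -/
def Solvable (w : List ι) (g : Finset ι → ℂ) (n : ℕ) : Prop :=
  ∀ P : List ((ℝ × ℝ) × ι), P.map Prod.snd = w → P.Pairwise (fun p q => p.1.1 < q.1.1) →
    (∀ p ∈ P, 0 < p.1.1 ∧ p.1.1 < 1) → ∀ M : ℝ, (∀ p ∈ P, p.1.2 ≤ M) →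
      ∃ V L, Tangle P M V L g ∧ V.card + L.length ≤ n

lemma solvable_nil {g : Finset ι → ℂ} (hg : g ∅ = 1) : Solvable [] g 0 := by
  intro P hP _ _ M _
  obtain rfl : P = [] := by simpa using hP
  refine ⟨∅, [], ⟨by simp, by simp, by simp, by simp, by simp, by simp, by simp, ?_⟩, by simp⟩
  intro L₁ W _ _
  simp [portLabels, portPts, hg]

end Tangle

/-! ### The layer in which two neighbouring strands cross -/

section Tangle
open Classical
variable {ι : Type*}

lemma exists_ports_of_map {l₁ l₂ : List ι} {a b : ι} {P : List ((ℝ × ℝ) × ι)}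
    (hP : P.map Prod.snd = l₁ ++ a :: b :: l₂) (hs : P.Pairwise (fun p q => p.1.1 < q.1.1)) :
    ∃ (P₁ P₂ : List ((ℝ × ℝ) × ι)) (x h y k : ℝ), P = P₁ ++ ((x, h), a) :: ((y, k), b) :: P₂ ∧
      P₁.map Prod.snd = l₁ ∧ P₂.map Prod.snd = l₂ ∧ x < y ∧
      (∀ p ∈ P₁, p.1.1 < x) ∧ (∀ p ∈ P₂, y < p.1.1) ∧
      (P₁ ++ P₂).Pairwise (fun p q => p.1.1 < q.1.1) := by
  obtain ⟨P₁, P', rfl, h1, h2⟩ := List.map_eq_append_iff.1 hP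
  obtain ⟨⟨⟨x, h⟩, a'⟩, P'', rfl, rfl, h3⟩ := List.map_eq_cons_iff.1 h2
  obtain ⟨⟨⟨y, k⟩, b'⟩, P₂, rfl, rfl, h4⟩ := List.map_eq_cons_iff.1 h3
  refine ⟨P₁, P₂, x, h, y, k, rfl, h1, h4, ?_⟩
  rw [List.pairwise_append] at hs
  obtain ⟨s1, s2, s3⟩ := hs
  simp only [List.pairwise_cons, List.mem_cons, forall_eq_or_imp] at s2 s3
  exact ⟨s2.1.1, fun p hp => (s3 p hp).1, fun p hp => s2.2.1 p hp,
    List.pairwise_append.2 ⟨s1, s2.2.2, fun p hp q hq => (s3 p hp).2.2 q hq⟩⟩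

lemma portPts_insert {P₁ P₂ : List ((ℝ × ℝ) × ι)} {u v : ℝ × ℝ} {a b : ι} (Z : Finset ι) :
    portPts (P₁ ++ (u, a) :: (v, b) :: P₂) Z = portPts (P₁ ++ P₂) Z ∪
      ((if a ∈ Z then {u} else ∅) ∪ (if b ∈ Z then {v} else ∅)) := by
  ext z
  by_cases ha : a ∈ Z <;> by_cases hb : b ∈ Z <;>
    simp [mem_portPts, ha, hb, or_and_right, exists_or] <;> grind

/-- The gadget is an axis-parallel grid whose vertical lines at `x` and `y` extend down to the
ports. The last clause places its edges above `M` or on the rays of these two ports, and keeps them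
off the rays of the new ports at height `M + 2`. -/
lemma ladder_geometry {x y m h k M : ℝ} (hxm : x < m) (hmy : m < y) (hh : h ≤ M) (hk : k ≤ M)
    {p q A B c d s t : ℝ × ℝ} (hp : p = (x, h)) (hq : q = (y, k)) (hA : A = (x, M + 1))
    (hB : B = (y, M + 1)) (hc : c = (m, M + 1)) (hd : d = (m, M + 2)) (hs : s = (y, M + 2))
    (ht : t = (x, M + 2)) :
    [p, q, A, B, c, d, s, t].Nodup ∧
    (ladder p q A B c d s t).Pairwise
      (fun e f => Disjoint (openSegment ℝ e.1 e.2.1) (openSegment ℝ f.1 f.2.1)) ∧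
    (∀ e ∈ ladder p q A B c d s t, ∀ v ∈ [p, q, A, B, c, d], v ∉ openSegment ℝ e.1 e.2.1) ∧
    (∀ e ∈ ladder p q A B c d s t, ∀ z ∈ openSegment ℝ e.1 e.2.1, x ≤ z.1 ∧ z.1 ≤ y ∧ z.2 ≤ M + 2 ∧
      (z.1 = x ∨ z.1 = y → z.2 < M + 2) ∧ (M < z.2 ∨ (z.1 = x ∧ h ≤ z.2) ∨ (z.1 = y ∧ k ≤ z.2))) := by
  subst hp hq hA hB hc hd hs ht
  have e1 : openSegment ℝ (x, M + 1) (x, h) = {z | z.1 = x ∧ h < z.2 ∧ z.2 < M + 1} :=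
    openSegment_vert' (by linarith)
  have e2 : openSegment ℝ (x, M + 1) (m, M + 1) = {z | z.2 = M + 1 ∧ x < z.1 ∧ z.1 < m} :=
    openSegment_horiz hxm
  have e3 : openSegment ℝ (x, M + 1) (x, M + 2) = {z | z.1 = x ∧ M + 1 < z.2 ∧ z.2 < M + 2} :=
    openSegment_vert (by linarith)
  have e4 : openSegment ℝ (y, M + 1) (y, k) = {z | z.1 = y ∧ k < z.2 ∧ z.2 < M + 1} :=
    openSegment_vert' (by linarith)
  have e5 : openSegment ℝ (y, M + 1) (m, M + 1) = {z | z.2 = M + 1 ∧ m < z.1 ∧ z.1 < y} :=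
    openSegment_horiz' hmy
  have e6 : openSegment ℝ (y, M + 1) (y, M + 2) = {z | z.1 = y ∧ M + 1 < z.2 ∧ z.2 < M + 2} :=
    openSegment_vert (by linarith)
  have e7 : openSegment ℝ (m, M + 1) (m, M + 2) = {z | z.1 = m ∧ M + 1 < z.2 ∧ z.2 < M + 2} :=
    openSegment_vert (by linarith)
  have e8 : openSegment ℝ (m, M + 2) (x, M + 2) = {z | z.2 = M + 2 ∧ x < z.1 ∧ z.1 < m} :=
    openSegment_horiz' hxm
  have e9 : openSegment ℝ (m, M + 2) (y, M + 2) = {z | z.2 = M + 2 ∧ m < z.1 ∧ z.1 < y} :=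
    openSegment_horiz hmy
  refine ⟨?_, ?_, ?_, ?_⟩
  · simp only [List.nodup_cons, List.mem_cons, not_or, List.not_mem_nil, not_false_eq_true,
      Prod.mk.injEq, not_and, List.nodup_nil, and_true]
    refine ⟨⟨?_, ?_, ?_, ?_, ?_, ?_, ?_⟩, ⟨?_, ?_, ?_, ?_, ?_, ?_⟩, ⟨?_, ?_, ?_, ?_, ?_⟩,
      ⟨?_, ?_, ?_, ?_⟩, ⟨?_, ?_, ?_⟩, ⟨?_, ?_⟩, ?_⟩ <;> intros <;> linarith
  · simp only [ladder, List.pairwise_cons, List.mem_cons, List.not_mem_nil, forall_eq_or_imp, e1,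
      e2, e3, e4, e5, e6, e7, e8, e9, Set.disjoint_left, Set.mem_ofPred_eq, IsEmpty.forall_iff,
      implies_true, and_true, List.Pairwise.nil]
    refine ⟨⟨?_, ?_, ?_, ?_, ?_, ?_, ?_, ?_⟩, ⟨?_, ?_, ?_, ?_, ?_, ?_, ?_⟩,
      ⟨?_, ?_, ?_, ?_, ?_, ?_⟩, ⟨?_, ?_, ?_, ?_, ?_⟩, ⟨?_, ?_, ?_, ?_⟩, ⟨?_, ?_, ?_⟩, ⟨?_, ?_⟩, ?_⟩ <;>
      · rintro z ⟨h1, h2, h3⟩ ⟨h4, h5, h6⟩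
        linarith
  · simp only [ladder, List.mem_cons, List.not_mem_nil, forall_eq_or_imp, e1, e2, e3, e4, e5, e6,
      e7, e8, e9, Set.mem_ofPred_eq, not_and, not_lt, IsEmpty.forall_iff, implies_true, and_true]
    refine ⟨⟨?_, ?_, ?_, ?_, ?_, ?_⟩, ⟨?_, ?_, ?_, ?_, ?_, ?_⟩, ⟨?_, ?_, ?_, ?_, ?_, ?_⟩,
      ⟨?_, ?_, ?_, ?_, ?_, ?_⟩, ⟨?_, ?_, ?_, ?_, ?_, ?_⟩, ⟨?_, ?_, ?_, ?_, ?_, ?_⟩,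
      ⟨?_, ?_, ?_, ?_, ?_, ?_⟩, ⟨?_, ?_, ?_, ?_, ?_, ?_⟩, ⟨?_, ?_, ?_, ?_, ?_, ?_⟩⟩ <;> intros <;>
      linarith
  · simp only [ladder, List.mem_cons, List.not_mem_nil, forall_eq_or_imp, e1, e2, e3, e4, e5, e6,
      e7, e8, e9, Set.mem_ofPred_eq, IsEmpty.forall_iff, implies_true, and_true]
    refine ⟨?_, ?_, ?_, ?_, ?_, ?_, ?_, ?_, ?_⟩ <;>
      · rintro z ⟨h1, h2, h3⟩
        refine ⟨by linarith, by linarith, by linarith, ?_, ?_⟩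
        · rintro (h | h) <;> linarith
        · first
            | (left; linarith)
            | exact Or.inr (Or.inl ⟨h1, h2.le⟩)
            | exact Or.inr (Or.inr ⟨h1, h2.le⟩)

/-- A ladder is put on top of two adjacent ports and the given outer graph above it. All other ports
stay in place: the rays above them belong to the region of the upper graph, so they need no new
edges in this layer. -/
lemma Solvable.swap {l₁ l₂ : List ι} {a b : ι} {g : Finset ι → ℂ} {n : ℕ}
    (H : Solvable (l₁ ++ b :: a :: l₂) g n) :
    Solvable (l₁ ++ a :: b :: l₂) (fun Z => (if a ∈ Z ∧ b ∈ Z then -1 else 1) * g Z) (n + 15) := by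
  intro P hP hs h01 M hM
  obtain ⟨P₁, P₂, x, h, y, k, rfl, hl₁, hl₂, hxy, hP₁, hP₂, hs'⟩ := exists_ports_of_map hP hs
  clear hP hs
  simp only [List.mem_append, List.mem_cons, or_imp, forall_and, forall_eq] at h01 hM
  obtain ⟨⟨h01a, h01x, h01y, h01b⟩, h01a', h01x', h01y', h01b'⟩ := h01
  obtain ⟨hMa, hMx, hMy, hMb⟩ := hM
  obtain ⟨m, hxm, hmy⟩ := exists_between hxy
  obtain ⟨V, L, T, hn⟩ := H (P₁ ++ ((x, M + 2), b) :: ((y, M + 2), a) :: P₂) (by simp [hl₁, hl₂])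
    (by
      rw [List.pairwise_append] at hs' ⊢
      simp only [List.pairwise_cons, List.mem_cons, forall_eq_or_imp]
      exact ⟨hs'.1, ⟨⟨hxy, fun p hp => hxy.trans (hP₂ p hp)⟩, hP₂, hs'.2.1⟩,
        fun p hp => ⟨hP₁ p hp, (hP₁ p hp).trans hxy, hs'.2.2 p hp⟩⟩)
    (by
      simp only [List.mem_append, List.mem_cons, or_imp, forall_and, forall_eq]
      exact ⟨⟨h01a, h01x, h01y, h01b⟩, h01a', h01x', h01y', h01b'⟩) (M + 2)
    (by
      simp only [List.mem_append, List.mem_cons, or_imp, forall_and, forall_eq]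
      exact ⟨fun p hp => by linarith [hMa p hp], le_rfl, le_rfl, fun p hp => by linarith [hMb p hp]⟩)
  obtain ⟨p, hp⟩ : ∃ p : ℝ × ℝ, p = (x, h) := ⟨_, rfl⟩
  obtain ⟨q, hq⟩ : ∃ p : ℝ × ℝ, p = (y, k) := ⟨_, rfl⟩
  obtain ⟨A, hA⟩ : ∃ p : ℝ × ℝ, p = (x, M + 1) := ⟨_, rfl⟩
  obtain ⟨B, hB⟩ : ∃ p : ℝ × ℝ, p = (y, M + 1) := ⟨_, rfl⟩
  obtain ⟨c, hc⟩ : ∃ p : ℝ × ℝ, p = (m, M + 1) := ⟨_, rfl⟩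
  obtain ⟨d, hd⟩ : ∃ p : ℝ × ℝ, p = (m, M + 2) := ⟨_, rfl⟩
  obtain ⟨s, hs⟩ : ∃ p : ℝ × ℝ, p = (y, M + 2) := ⟨_, rfl⟩
  obtain ⟨t, ht⟩ : ∃ p : ℝ × ℝ, p = (x, M + 2) := ⟨_, rfl⟩
  rw [← ht, ← hs] at T
  rw [← hp, ← hq]
  obtain ⟨hnd, hpw, hvert, hseg⟩ := ladder_geometry hxm hmy hMx hMy hp hq hA hB hc hd hs ht
  -- The layer avoids the region of the upper graph. Its top row has height exactly `M + 2`, and the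
  -- ends `t` and `s` of this row are vertices of the upper graph, hence excluded here.
  have hnot : ∀ z : ℝ × ℝ, x ≤ z.1 → z.1 ≤ y → z.2 ≤ M + 2 →
      (z.1 = x ∨ z.1 = y → z.2 < M + 2) → ¬ Region (P₁ ++ (t, b) :: (s, a) :: P₂) (M + 2) z := by
    rintro z hx hy hz hz' ⟨-, -, h | ⟨p, hp, hp1, hp2⟩⟩
    · linarith
    · simp only [List.mem_append, List.mem_cons] at hp
      rcases hp with hp | rfl | rfl | hp
      · linarith [hP₁ p hp]
      · simp only [ht] at hp1 hp2
        linarith [hz' (Or.inl hp1.symm)]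
      · simp only [hs] at hp1 hp2
        linarith [hz' (Or.inr hp1.symm)]
      · linarith [hP₂ p hp]
  have hin : ∀ z : ℝ × ℝ, x ≤ z.1 → z.1 ≤ y →
      (M < z.2 ∨ (z.1 = x ∧ h ≤ z.2) ∨ (z.1 = y ∧ k ≤ z.2)) →
      Region (P₁ ++ (p, a) :: (q, b) :: P₂) M z := by
    rintro z hx hy hz
    refine ⟨by linarith, by linarith, ?_⟩
    rcases hz with hz | ⟨hz, hz'⟩ | ⟨hz, hz'⟩
    · exact Or.inl hz
    · exact Or.inr ⟨(p, a), by simp, by simp [hp, hz], by simpa [hp] using hz'⟩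
    · exact Or.inr ⟨(q, b), by simp, by simp [hq, hz], by simpa [hq] using hz'⟩
  have htm : (t, b) ∈ P₁ ++ (t, b) :: (s, a) :: P₂ := by simp
  have hsm : (s, a) ∈ P₁ ++ (t, b) :: (s, a) :: P₂ := by simp
  have hmem : ∀ v ∈ [p, q, A, B, c, d, s, t], v ∈ V ∪ {p, q, A, B, c, d} := by
    have h1 := T.ports_mem _ htm
    have h2 := T.ports_mem _ hsm
    intro v hv
    simp only [List.mem_cons, List.not_mem_nil, or_false] at hv
    simp only [Finset.mem_union, Finset.mem_insert, Finset.mem_singleton]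
    rcases hv with rfl | rfl | rfl | rfl | rfl | rfl | rfl | rfl <;> simp [h1, h2]
  refine ⟨V ∪ {p, q, A, B, c, d}, ladder p q A B c d s t ++ L,
    T.extend ?_ ?_ ?_ hpw ?_ ?_ ?_ ?_ ?_, ?_⟩
  · simp only [List.mem_append, List.mem_cons]
    rintro r (hr | rfl | rfl | hr)
    · exact Or.inr ⟨r, by simp [hr], rfl⟩
    · simp
    · simp
    · exact Or.inr ⟨r, by simp [hr], rfl⟩
  · have ht' : ∃ p' ∈ P₁ ++ (t, b) :: (s, a) :: P₂, p'.1 = t := ⟨_, htm, rfl⟩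
    have hs' : ∃ p' ∈ P₁ ++ (t, b) :: (s, a) :: P₂, p'.1 = s := ⟨_, hsm, rfl⟩
    have hnd' := List.nodup_reverse.2 hnd
    simp only [List.reverse_cons, List.reverse_nil, List.nil_append, List.cons_append,
      List.nodup_cons, List.mem_cons, not_or, List.not_mem_nil, not_false_eq_true] at hnd hnd'
    simp only [ladder, List.mem_cons, List.not_mem_nil, forall_eq_or_imp, ht', hs', hnd, hnd',
      Finset.mem_insert, Finset.mem_singleton]
    simp [hnd, hnd']
  · simp [ladder, unitConstants]
  · exact fun e he v hv => hvert e he v (by simpa using hv)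
  · rintro z ⟨h0, h1, hz | ⟨r, hr, hr1, hr2⟩⟩
    · exact ⟨h0, h1, Or.inl (by linarith)⟩
    · simp only [List.mem_append, List.mem_cons] at hr
      rcases hr with hr | rfl | rfl | hr
      · exact ⟨h0, h1, Or.inr ⟨r, by simp [hr], hr1, hr2⟩⟩
      · exact ⟨h0, h1, Or.inl (by simp only [ht] at hr2; linarith)⟩
      · exact ⟨h0, h1, Or.inl (by simp only [hs] at hr2; linarith)⟩
      · exact ⟨h0, h1, Or.inr ⟨r, by simp [hr], hr1, hr2⟩⟩
  · have hU : ∀ v ∈ [p, q, A, B, c, d], x ≤ v.1 ∧ v.1 ≤ y ∧ v.2 ≤ M + 2 ∧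
        (v.1 = x ∨ v.1 = y → v.2 < M + 2) ∧
        (M < v.2 ∨ (v.1 = x ∧ h ≤ v.2) ∨ (v.1 = y ∧ k ≤ v.2)) := by
      simp only [List.mem_cons, List.not_mem_nil, or_false, forall_eq_or_imp, forall_eq, hp, hq,
        hA, hB, hc, hd, le_refl, and_self, true_or, or_true, true_and, and_true]
      refine ⟨⟨?_, ?_, ?_⟩, ⟨?_, ?_, ?_⟩, ⟨?_, ?_, ?_, ?_⟩, ⟨?_, ?_, ?_, ?_⟩, ⟨?_, ?_, ?_, ?_, ?_⟩,
        ⟨?_, ?_, ?_, ?_⟩⟩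
      all_goals first | linarith | (left; linarith) | (rintro (h | h) <;> linarith)
    intro v hv
    obtain ⟨h1, h2, h3, h4, h5⟩ := hU v (by simpa using hv)
    exact ⟨hin v h1 h2 h5, hnot v h1 h2 h3 h4⟩
  · intro e he z hz
    obtain ⟨h1, h2, h3, h4, h5⟩ := hseg e he z hz
    exact ⟨hin z h1 h2 h5, hnot z h1 h2 h3 h4⟩
  · intro L₁ W hL₁ hW
    have hlab : portLabels (P₁ ++ (t, b) :: (s, a) :: P₂) =
        portLabels (P₁ ++ (p, a) :: (q, b) :: P₂) := by
      ext i
      simp only [portLabels, List.mem_toFinset, List.map_append, List.map_cons, List.mem_append,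
        List.mem_cons]
      tauto
    rw [hlab]
    refine Finset.sum_congr rfl fun Z _ => ?_
    rw [portPts_insert, portPts_insert]
    have hx' : ∀ v ∈ [p, q, A, B, c, d, s, t], x ≤ v.1 ∧ v.1 ≤ y := by
      simp only [List.mem_cons, List.not_mem_nil, or_false, forall_eq_or_imp, forall_eq, hp, hq,
        hA, hB, hc, hd, hs, ht, le_refl, hxy.le, hxm.le, hmy.le, and_self]
    have hy' : ∀ v ∈ [A, B, c, d, s, t], M < v.2 := by
      simp only [List.mem_cons, List.not_mem_nil, or_false, forall_eq_or_imp, forall_eq, hA, hB, hc,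
        hd, hs, ht, lt_add_iff_pos_right, Nat.ofNat_pos, one_pos, and_self]
    have hR : ∀ v ∈ [p, q, A, B, c, d, s, t], v ∉ W ∪ portPts (P₁ ++ P₂) Z := by
      intro v hv hvW
      rcases Finset.mem_union.1 hvW with hvW | hvW
      · exact Finset.disjoint_left.1 hW hvW (hmem v hv)
      · obtain ⟨r, hr, -, rfl⟩ := mem_portPts.1 hvW
        have hv' := hx' _ hv
        rcases List.mem_append.1 hr with hr | hr
        · linarith [hP₁ r hr]
        · linarith [hP₂ r hr]
    have hF : ∀ v ∈ [A, B, c, d, s, t], Fresh v L₁ := by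
      intro v hv
      have hv' : v ∈ [p, q, A, B, c, d, s, t] := List.mem_cons_of_mem _ (List.mem_cons_of_mem _ hv)
      refine hL₁ v (hmem v hv') fun r hr hrv => ?_
      have h1 := hx' v hv'
      have h2 := hy' v hv
      subst hrv
      simp only [List.mem_append, List.mem_cons] at hr
      rcases hr with hr | rfl | rfl | hr
      · linarith [hP₁ r hr]
      · simp only [hp] at h2; linarith
      · simp only [hq] at h2; linarith
      · linarith [hP₂ r hr]
    have key : ∀ X Y : Finset (ℝ × ℝ), W ∪ {p, q, A, B, c, d} ∪ (X ∪ Y) =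
        (W ∪ X) ∪ ({p, q, A, B, c, d} ∪ Y) := fun X Y => by
      ext z; simp only [Finset.mem_union]; tauto
    rw [key, ← Finset.union_assoc W]
    -- Above the layer `s` carries the label `a` of `p`, and `t` the label `b` of `q`. The four
    -- cases are therefore the four ladder identities.
    by_cases ha : a ∈ Z <;> by_cases hb : b ∈ Z <;>
      simp only [ha, hb, if_true, if_false, and_true, and_false, Finset.empty_union,
        Finset.union_empty]
    · rw [Finset.union_comm {t} {s}, ← Finset.insert_eq, ← Finset.insert_eq,
        pm_ladder_both hnd hR hF]
      ring
    · rw [pm_ladder_left hnd hR hF, one_mul]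
    · rw [pm_ladder_right hnd hR hF, one_mul]
    · have := pm_ladder_none hnd hR hF
      rw [Finset.union_empty] at this
      rw [this, one_mul]
  -- The layer adds at most six vertices and nine edges, since `s` and `t` were counted above.
  · have h1 : (V ∪ {p, q, A, B, c, d}).card ≤ V.card + 6 :=
      (Finset.card_union_le _ _).trans (Nat.add_le_add_left Finset.card_le_six _)
    simp only [List.length_append, ladder, List.length_cons, List.length_nil]
    omega

end Tangle

/-! ### The layer in which two neighbouring ports are joined -/

section Tangle
open Classical
variable {ι : Type*}

/-- Either the middle edge `A B` is used, and `p` and `q` remain for `L`, or both outer edges are.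
-/
lemma pm_cap {X : Type*} [DecidableEq X] {p q A B : X} {W : Finset X} {L : List (X × X × ℂ)} {u : ℂ}
    (hnd : [p, q, A, B].Nodup) (hW : ∀ v ∈ [p, q, A, B], v ∉ W)
    (hL : ∀ v ∈ [A, B], Fresh v L) :
    pm ([(A, p, 1), (A, B, u), (B, q, 1)] ++ L) (W ∪ {p, q, A, B}) =
      pm L W + u * pm L (W ∪ {p, q}) := by
  have hnd' := List.nodup_reverse.2 hnd
  simp only [List.reverse_cons, List.reverse_nil, List.nil_append, List.cons_append,
    List.nodup_cons, List.mem_cons, not_or, List.not_mem_nil, not_false_eq_true,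
    forall_eq_or_imp] at hnd hnd' hW hL
  obtain ⟨hA, hB, -⟩ := hL
  have hA' : ∀ {T : Finset X}, A ∈ T → pm L T = 0 := fun h => pm_fresh hA h
  have hB' : ∀ {T : Finset X}, B ∈ T → pm L T = 0 := fun h => pm_fresh hB h
  simp [pm, hA', hB', hnd, hnd', hW, Finset.sdiff_insert, Finset.sdiff_singleton_eq_erase,
    Finset.erase_insert_of_ne]
  ring

/-- The two ports of the label `a` are joined by a path and disappear from the word seen by the
upper graph. Hence membership of `a` in `Z` only multiplies the signature by `u`. -/
lemma Solvable.cap {l₁ l₂ : List ι} {a : ι} {g g' : Finset ι → ℂ} {n : ℕ} {u : ℂ}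
    (H : Solvable (l₁ ++ l₂) g n) (hu : u ∈ unitConstants) (ha : a ∉ l₁ ++ l₂)
    (hg : ∀ Z, a ∉ Z → g' Z = g Z ∧ g' (insert a Z) = u * g Z) :
    Solvable (l₁ ++ a :: a :: l₂) g' (n + 7) := by
  intro P hP hs h01 M hM
  obtain ⟨P₁, P₂, x, h, y, k, rfl, hl₁, hl₂, hxy, hP₁, hP₂, hs'⟩ := exists_ports_of_map hP hs
  clear hP hs
  simp only [List.mem_append, List.mem_cons, or_imp, forall_and, forall_eq] at h01 hM
  obtain ⟨⟨h01a, h01x, h01y, h01b⟩, h01a', h01x', h01y', h01b'⟩ := h01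
  obtain ⟨hMa, hMx, hMy, hMb⟩ := hM
  obtain ⟨V, L, T, hn⟩ := H (P₁ ++ P₂) (by simp [hl₁, hl₂]) hs'
    (by
      simp only [List.mem_append, or_imp, forall_and]
      exact ⟨⟨h01a, h01b⟩, h01a', h01b'⟩) (M + 1)
    (by
      simp only [List.mem_append, or_imp, forall_and]
      exact ⟨fun p hp => by linarith [hMa p hp], fun p hp => by linarith [hMb p hp]⟩)
  obtain ⟨p, hp⟩ : ∃ p : ℝ × ℝ, p = (x, h) := ⟨_, rfl⟩
  obtain ⟨q, hq⟩ : ∃ p : ℝ × ℝ, p = (y, k) := ⟨_, rfl⟩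
  obtain ⟨A, hA⟩ : ∃ p : ℝ × ℝ, p = (x, M + 1) := ⟨_, rfl⟩
  obtain ⟨B, hB⟩ : ∃ p : ℝ × ℝ, p = (y, M + 1) := ⟨_, rfl⟩
  rw [← hp, ← hq]
  have e1 : openSegment ℝ A p = {z | z.1 = x ∧ h < z.2 ∧ z.2 < M + 1} := by
    rw [hA, hp, openSegment_vert' (by linarith)]
  have e2 : openSegment ℝ A B = {z | z.2 = M + 1 ∧ x < z.1 ∧ z.1 < y} := by
    rw [hA, hB, openSegment_horiz hxy]
  have e3 : openSegment ℝ B q = {z | z.1 = y ∧ k < z.2 ∧ z.2 < M + 1} := by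
    rw [hB, hq, openSegment_vert' (by linarith)]
  have hnd : [p, q, A, B].Nodup := by
    simp only [List.nodup_cons, List.mem_cons, not_or, List.not_mem_nil, not_false_eq_true, hp, hq,
      hA, hB, Prod.mk.injEq, not_and, List.nodup_nil, and_true]
    refine ⟨⟨?_, ?_, ?_⟩, ⟨?_, ?_⟩, ?_⟩ <;> intros <;> linarith
  have hnot : ∀ z : ℝ × ℝ, x ≤ z.1 → z.1 ≤ y → z.2 ≤ M + 1 → ¬ Region (P₁ ++ P₂) (M + 1) z := by
    rintro z hx hy hz ⟨-, -, h | ⟨p, hp, hp1, hp2⟩⟩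
    · linarith
    · rcases List.mem_append.1 hp with hp | hp
      · linarith [hP₁ p hp]
      · linarith [hP₂ p hp]
  have hin : ∀ z : ℝ × ℝ, x ≤ z.1 → z.1 ≤ y →
      (M < z.2 ∨ (z.1 = x ∧ h ≤ z.2) ∨ (z.1 = y ∧ k ≤ z.2)) →
      Region (P₁ ++ (p, a) :: (q, a) :: P₂) M z := by
    rintro z hx hy hz
    refine ⟨by linarith, by linarith, ?_⟩
    rcases hz with hz | ⟨hz, hz'⟩ | ⟨hz, hz'⟩
    · exact Or.inl hz
    · exact Or.inr ⟨(p, a), by simp, by simp [hp, hz], by simpa [hp] using hz'⟩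
    · exact Or.inr ⟨(q, a), by simp, by simp [hq, hz], by simpa [hq] using hz'⟩
  have hmem : ∀ v ∈ [p, q, A, B], v ∈ V ∪ {p, q, A, B} := fun v hv =>
    Finset.mem_union_right _ (by simpa using hv)
  refine ⟨V ∪ {p, q, A, B}, [(A, p, 1), (A, B, u), (B, q, 1)] ++ L,
    T.extend ?_ ?_ ?_ ?_ ?_ ?_ ?_ ?_ ?_, ?_⟩
  · simp only [List.mem_append, List.mem_cons]
    rintro r (hr | rfl | rfl | hr)
    · exact Or.inr ⟨r, by simp [hr], rfl⟩
    · simp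
    · simp
    · exact Or.inr ⟨r, by simp [hr], rfl⟩
  · have hnd' := List.nodup_reverse.2 hnd
    simp only [List.reverse_cons, List.reverse_nil, List.nil_append, List.cons_append,
      List.nodup_cons, List.mem_cons, not_or, List.not_mem_nil, not_false_eq_true] at hnd hnd'
    simp [hnd, hnd']
  · simp [unitConstants] at hu ⊢
    exact hu
  · simp only [List.pairwise_cons, List.mem_cons, List.not_mem_nil, forall_eq_or_imp, e1,
      e2, e3, Set.disjoint_left, Set.mem_ofPred_eq, IsEmpty.forall_iff, implies_true, and_true,
      List.Pairwise.nil]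
    refine ⟨⟨?_, ?_⟩, ?_⟩ <;>
      · rintro z ⟨h1, h2, h3⟩ ⟨h4, h5, h6⟩
        linarith
  · simp only [List.mem_cons, List.not_mem_nil, forall_eq_or_imp, e1, e2, e3, Set.mem_ofPred_eq,
      not_and, not_lt, IsEmpty.forall_iff, implies_true, and_true, Finset.mem_insert,
      Finset.mem_singleton, forall_eq]
    simp only [hp, hq, hA, hB]
    refine ⟨⟨?_, ?_, ?_, ?_⟩, ⟨?_, ?_, ?_, ?_⟩, ⟨?_, ?_, ?_, ?_⟩⟩ <;> intros <;> linarith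
  · rintro z ⟨h0, h1, hz | ⟨r, hr, hr1, hr2⟩⟩
    · exact ⟨h0, h1, Or.inl (by linarith)⟩
    · refine ⟨h0, h1, Or.inr ⟨r, ?_, hr1, hr2⟩⟩
      rcases List.mem_append.1 hr with hr | hr <;> simp [hr]
  · intro v hv
    simp only [Finset.mem_insert, Finset.mem_singleton] at hv
    rcases hv with rfl | rfl | rfl | rfl
    · simp only [hp] at *
      exact ⟨hin _ (by simp) hxy.le (by simp), hnot _ (by simp) hxy.le (by simp; linarith)⟩
    · simp only [hq] at *
      exact ⟨hin _ hxy.le (by simp) (by simp), hnot _ hxy.le (by simp) (by simp; linarith)⟩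
    · simp only [hA] at *
      exact ⟨hin _ (by simp) hxy.le (by simp), hnot _ (by simp) hxy.le (by simp)⟩
    · simp only [hB] at *
      exact ⟨hin _ hxy.le (by simp) (by simp), hnot _ hxy.le (by simp) (by simp)⟩
  · simp only [List.mem_cons, List.not_mem_nil, forall_eq_or_imp, e1, e2, e3, Set.mem_ofPred_eq,
      IsEmpty.forall_iff, implies_true, and_true]
    refine ⟨?_, ?_, ?_⟩ <;>
      · rintro z ⟨h1, h2, h3⟩
        refine ⟨hin _ (by linarith) (by linarith) ?_, hnot _ (by linarith) (by linarith) (by linarith)⟩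
        first
          | (left; linarith)
          | exact Or.inr (Or.inl ⟨h1, h2.le⟩)
          | exact Or.inr (Or.inr ⟨h1, h2.le⟩)
  · intro L₁ W hL₁ hW
    have hlab : portLabels (P₁ ++ (p, a) :: (q, a) :: P₂) = insert a (portLabels (P₁ ++ P₂)) := by
      ext i
      simp only [portLabels, List.mem_toFinset, List.map_append, List.map_cons, List.mem_append,
        List.mem_cons, Finset.mem_insert]
      tauto
    have ha' : a ∉ portLabels (P₁ ++ P₂) := by
      rw [portLabels, List.map_append, hl₁, hl₂]
      simpa using ha
    -- The sets without and with `a` are paired; together they give the two terms of `pm_cap`.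
    rw [hlab, Finset.sum_powerset_insert ha', ← Finset.sum_add_distrib]
    refine Finset.sum_congr rfl fun Z hZ => ?_
    have haZ : a ∉ Z := fun h => ha' (Finset.mem_powerset.1 hZ h)
    rw [(hg Z haZ).1, (hg Z haZ).2, portPts_insert, portPts_insert]
    have hx' : ∀ v ∈ [p, q, A, B], x ≤ v.1 ∧ v.1 ≤ y := by
      simp only [List.mem_cons, List.not_mem_nil, or_false, forall_eq_or_imp, forall_eq, hp, hq,
        hA, hB, le_refl, hxy.le, and_self]
    have hR : ∀ v ∈ [p, q, A, B], v ∉ W ∪ portPts (P₁ ++ P₂) Z := by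
      intro v hv hvW
      rcases Finset.mem_union.1 hvW with hvW | hvW
      · exact Finset.disjoint_left.1 hW hvW (hmem v hv)
      · obtain ⟨r, hr, -, rfl⟩ := mem_portPts.1 hvW
        have hv' := hx' _ hv
        rcases List.mem_append.1 hr with hr | hr
        · linarith [hP₁ r hr]
        · linarith [hP₂ r hr]
    have hF : ∀ v ∈ [A, B], Fresh v L₁ := by
      intro v hv
      have hv' : v ∈ [p, q, A, B] := List.mem_cons_of_mem _ (List.mem_cons_of_mem _ hv)
      have h2 : M < v.2 := by
        simp only [List.mem_cons, List.not_mem_nil, or_false] at hv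
        rcases hv with rfl | rfl
        · simp [hA]
        · simp [hB]
      refine hL₁ v (hmem v hv') fun r hr hrv => ?_
      have h1 := hx' v hv'
      subst hrv
      simp only [List.mem_append, List.mem_cons] at hr
      rcases hr with hr | rfl | rfl | hr
      · linarith [hP₁ r hr]
      · simp only [hp] at h2; linarith
      · simp only [hq] at h2; linarith
      · linarith [hP₂ r hr]
    have hins : portPts (P₁ ++ P₂) (insert a Z) = portPts (P₁ ++ P₂) Z := by
      ext v
      simp only [mem_portPts, Finset.mem_insert]
      refine exists_congr fun r => and_congr_right fun hr => ?_
      have : r.2 ≠ a := by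
        rintro rfl
        exact ha' (List.mem_toFinset.2 (List.mem_map_of_mem hr))
      simp [this]
    rw [hins, Finset.union_right_comm, pm_cap hnd hR hF]
    simp only [haZ, Finset.mem_insert_self, if_true, if_false, Finset.union_empty,
      ← Finset.insert_eq, ← Finset.union_assoc]
    ring
  · have h1 : (V ∪ {p, q, A, B}).card ≤ V.card + 4 :=
      (Finset.card_union_le _ _).trans (Nat.add_le_add_left Finset.card_le_four _)
    simp only [List.length_append, List.length_cons, List.length_nil]
    omega

end Tangle

/-! ### Outer graphs for the words of handles and cross caps -/

section Words
open Classical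
variable {ι : Type*}

lemma Solvable.of_eq {w w' : List ι} {g g' : Finset ι → ℂ} {n n' : ℕ} (H : Solvable w g n)
    (hw : w = w') (hg : ∀ Z, g Z = g' Z) (hn : n ≤ n') : Solvable w' g' n' := by
  obtain rfl : g = g' := funext hg
  subst hw
  intro P h1 h2 h3 M h4
  obtain ⟨V, L, T, h⟩ := H P h1 h2 h3 M h4
  exact ⟨V, L, T, h.trans hn⟩

/-- The number of entries of the list `A` that belong to `Z`. -/
noncomputable def countIn (A : List ι) (Z : Finset ι) : ℕ := A.countP (fun a => a ∈ Z)

lemma countIn_cons (a : ι) (A : List ι) (Z : Finset ι) :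
    countIn (a :: A) Z = countIn A Z + if a ∈ Z then 1 else 0 := by
  simp [countIn, List.countP_cons]

lemma countIn_reverse (A : List ι) (Z : Finset ι) : countIn A.reverse Z = countIn A Z := by
  simp [countIn]

lemma countIn_insert {A : List ι} {a : ι} (h : a ∉ A) (Z : Finset ι) :
    countIn A (insert a Z) = countIn A Z := by
  unfold countIn
  refine List.countP_congr fun b hb => ?_
  have : b ≠ a := fun e => h (e ▸ hb)
  simp [this]

/-- The strand of `b` crosses every strand of `X` once, and only crossings of two strands in `Z`
contribute a sign. -/
lemma Solvable.move {l₁ X l₂ : List ι} {b : ι} {g : Finset ι → ℂ} {n : ℕ}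
    (H : Solvable (l₁ ++ b :: (X ++ l₂)) g n) :
    Solvable (l₁ ++ X ++ b :: l₂)
      (fun Z => (-1) ^ (countIn X Z * if b ∈ Z then 1 else 0) * g Z) (n + 15 * X.length) := by
  induction X generalizing l₁ g n with
  | nil => exact H.of_eq (by simp) (by simp [countIn]) (by simp)
  | cons x X ih =>
    have h1 : Solvable (l₁ ++ x :: b :: (X ++ l₂)) _ (n + 15) := Solvable.swap H
    refine (ih (l₁ := l₁ ++ [x]) (h1.of_eq (by simp) (fun Z => rfl) le_rfl)).of_eq (by simp)
      (fun Z => ?_) (by simp; ring_nf; rfl)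
    rw [countIn_cons]
    by_cases hb : b ∈ Z <;> by_cases hx : x ∈ Z <;> simp [hb, hx, pow_succ]

lemma Solvable.swap_blocks {l₁ X Y l₂ : List ι} {g : Finset ι → ℂ} {n : ℕ}
    (H : Solvable (l₁ ++ Y ++ X ++ l₂) g n) :
    Solvable (l₁ ++ X ++ Y ++ l₂)
      (fun Z => (-1) ^ (countIn X Z * countIn Y Z) * g Z) (n + 15 * (X.length * Y.length)) := by
  induction Y generalizing l₁ with
  | nil => exact H.of_eq (by simp) (by simp [countIn]) (by simp)
  | cons b Y ih =>
    have h1 := ih (l₁ := l₁ ++ [b]) (H.of_eq (by simp) (fun Z => rfl) le_rfl)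
    have h2 := Solvable.move (l₁ := l₁) (X := X) (b := b) (l₂ := Y ++ l₂)
      (h1.of_eq (by simp) (fun Z => rfl) le_rfl)
    refine h2.of_eq (by simp) (fun Z => ?_) (by simp; ring_nf; rfl)
    rw [countIn_cons, ← mul_assoc, ← pow_add]
    congr 2
    ring

/-- Strands that join a block to its reversal are nested, so no crossings are needed. -/
lemma Solvable.cap_blocks {l₁ A l₂ : List ι} {g : Finset ι → ℂ} {n : ℕ} {u : ℂ}
    (H : Solvable (l₁ ++ l₂) g n) (hu : u ∈ unitConstants) (hA : A.Nodup)
    (hd : ∀ a ∈ A, a ∉ l₁ ++ l₂) (hg : ∀ a ∈ A, ∀ Z, g (insert a Z) = g Z) :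
    Solvable (l₁ ++ A ++ A.reverse ++ l₂) (fun Z => u ^ countIn A Z * g Z) (n + 7 * A.length) := by
  induction A generalizing l₁ l₂ g n with
  | nil => exact H.of_eq (by simp) (by simp [countIn]) (by simp)
  | cons a A ih =>
    obtain ⟨haA, hA⟩ := List.nodup_cons.1 hA
    have h1 : Solvable (l₁ ++ a :: a :: l₂) (fun Z => (if a ∈ Z then u else 1) * g Z) (n + 7) :=
      H.cap hu (hd a (by simp)) fun Z hZ => by simp [hZ, hg a (by simp)]
    have h2 := ih (l₁ := l₁ ++ [a]) (l₂ := a :: l₂) (h1.of_eq (by simp) (fun Z => rfl) le_rfl) hA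
      (fun b hb => by
        have h3 := hd b (by simp [hb])
        have h4 : b ≠ a := fun e => haA (e ▸ hb)
        simp only [List.mem_append, not_or] at h3
        simp [h3, h4])
      (fun b hb Z => by
        have h4 : a ≠ b := fun e => haA (e ▸ hb)
        simp [h4, hg b (by simp [hb])])
    refine h2.of_eq (by simp) (fun Z => ?_) (by simp; ring_nf; rfl)
    rw [countIn_cons]
    by_cases ha : a ∈ Z <;> simp [ha, pow_succ, mul_assoc]

/-- Exchanging the two middle blocks of `A B A⁻¹ B⁻¹` yields `A A⁻¹ B B⁻¹`, at the price of one
crossing for each pair of strands from `A` and `B`. Both pairs of blocks can then be joined by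
nested strands. -/
lemma Solvable.handle {A B l : List ι} {g : Finset ι → ℂ} {n : ℕ} {u v : ℂ}
    (H : Solvable l g n) (hu : u ∈ unitConstants) (hv : v ∈ unitConstants) (hA : A.Nodup)
    (hB : B.Nodup) (hAB : ∀ a ∈ A, a ∉ B) (hAl : ∀ a ∈ A, a ∉ l) (hBl : ∀ a ∈ B, a ∉ l)
    (hgA : ∀ a ∈ A, ∀ Z, g (insert a Z) = g Z) (hgB : ∀ a ∈ B, ∀ Z, g (insert a Z) = g Z) :
    Solvable (A ++ B ++ A.reverse ++ B.reverse ++ l)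
      (fun Z => (-1) ^ (countIn A Z * countIn B Z) * u ^ countIn A Z * v ^ countIn B Z * g Z)
      (n + 15 * (A.length * B.length) + 7 * A.length + 7 * B.length) := by
  have h1 := Solvable.cap_blocks (l₁ := []) (l₂ := l) H hv hB hBl hgB
  have h2 := Solvable.cap_blocks (l₁ := []) (l₂ := B ++ B.reverse ++ l) (A := A) (u := u)
    (h1.of_eq (by simp) (fun Z => rfl) le_rfl) hu hA
    (fun a ha => by simp [hAB a ha, hAl a ha])
    (fun a ha Z => by rw [countIn_insert (hAB a ha), hgA a ha])
  have h3 := Solvable.swap_blocks (l₁ := A) (X := B) (Y := A.reverse) (l₂ := B.reverse ++ l)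
    (h2.of_eq (by simp) (fun Z => rfl) le_rfl)
  refine h3.of_eq (by simp) (fun Z => ?_) (by simp; ring_nf; rfl)
  rw [countIn_reverse, mul_comm (countIn B Z)]
  ring

/-- Induction on the block: in `a A a A` the second `a` is moved past `A` and joined to the first.
The strand of `a` crosses each strand of `A` once, which accounts for `(n + 1).choose 2 = n.choose 2
+ n`. -/
lemma Solvable.crossCap {A l : List ι} {g : Finset ι → ℂ} {n : ℕ} {u : ℂ}
    (H : Solvable l g n) (hu : u ∈ unitConstants) (hA : A.Nodup) (hAl : ∀ a ∈ A, a ∉ l)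
    (hg : ∀ a ∈ A, ∀ Z, g (insert a Z) = g Z) :
    Solvable (A ++ A ++ l)
      (fun Z => (-1) ^ ((countIn A Z).choose 2) * u ^ countIn A Z * g Z)
      (n + 15 * A.length ^ 2) := by
  induction A with
  | nil => exact H.of_eq (by simp) (by simp [countIn]) (by simp)
  | cons a A ih =>
    obtain ⟨haA, hA⟩ := List.nodup_cons.1 hA
    have h1 := ih hA (fun b hb => hAl b (by simp [hb])) (fun b hb => hg b (by simp [hb]))
    have h2 : Solvable ([] ++ a :: a :: (A ++ A ++ l)) (fun Z => (if a ∈ Z then u else 1) *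
        ((-1) ^ ((countIn A Z).choose 2) * u ^ countIn A Z * g Z)) _ :=
      Solvable.cap (l₁ := []) h1 hu (by simp [haA, hAl a]) fun Z hZ => by
        simp [hZ, countIn_insert haA, hg a]
    have h3 := Solvable.move (l₁ := [a]) (X := A) (b := a) (l₂ := A ++ l)
      (h2.of_eq (by simp) (fun Z => rfl) le_rfl)
    refine h3.of_eq (by simp) (fun Z => ?_) (by simp; ring_nf; omega)
    rw [countIn_cons]
    by_cases ha : a ∈ Z
    · simp only [ha, if_true, Nat.choose_succ_succ' _ 1, Nat.choose_one_right, pow_add, mul_one,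
        pow_one]
      ring
    · simp [ha]

/-- The labels of the ports along the polygon with side word `W`, if `lab s` are those along a side
with the symbol `s`. -/
def labelWord (lab : ℕ → List ι) (W : SideWord) : List ι :=
  W.flatMap fun s => if s.2 then (lab s.1).reverse else lab s.1

/-- The contribution of a cross cap to the signature. -/
noncomputable def capSign (lab : ℕ → List ι) (u : ℕ → ℂ) (Z : Finset ι) (j : ℕ) : ℂ :=
  (-1) ^ ((countIn (lab j) Z).choose 2) * u j ^ countIn (lab j) Z

/-- The contribution of a handle to the signature. -/
noncomputable def handleSign (lab : ℕ → List ι) (u : ℕ → ℂ) (Z : Finset ι) (i : ℕ) : ℂ :=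
  (-1) ^ (countIn (lab (2 * i)) Z * countIn (lab (2 * i + 1)) Z) *
    u (2 * i) ^ countIn (lab (2 * i)) Z * u (2 * i + 1) ^ countIn (lab (2 * i + 1)) Z

/-- Different cross caps occupy disjoint factors of the word, so their contributions multiply. The
quadratic bound in the total number of strands is superadditive and thus survives the induction. -/
lemma solvable_crossCaps {lab : ℕ → List ι} {u : ℕ → ℂ} (hu : ∀ s, u s ∈ unitConstants)
    (hlab : ∀ s, (lab s).Nodup) (hdis : ∀ s t a, a ∈ lab s → a ∈ lab t → s = t) (js : List ℕ)
    (hjs : js.Nodup) :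
    Solvable (js.flatMap fun j => lab j ++ lab j) (fun Z => (js.map (capSign lab u Z)).prod)
      (15 * (js.map fun j => (lab j).length).sum ^ 2) := by
  induction js with
  | nil => exact (solvable_nil (by simp)).of_eq (by simp) (fun Z => rfl) (by simp)
  | cons j js ih =>
    obtain ⟨hj, hjs⟩ := List.nodup_cons.1 hjs
    have key : ∀ a ∈ lab j, ∀ i ∈ js, a ∉ lab i := fun a ha i hi hai =>
      hj (hdis j i a ha hai ▸ hi)
    refine (Solvable.crossCap (u := u j) (ih hjs) (hu j) (hlab j) (fun a ha h => ?_)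
      (fun a ha Z => ?_)).of_eq (by simp) (fun Z => by simp [capSign])
      (by simp only [List.map_cons, List.sum_cons]; nlinarith [Nat.zero_le ((lab j).length *
            (js.map fun j => (lab j).length).sum)])
    · obtain ⟨i, hi, hai⟩ := List.mem_flatMap.1 h
      exact key a ha i hi (by simpa using hai)
    · congr 1
      refine List.map_congr_left fun i hi => ?_
      rw [capSign, countIn_insert (key a ha i hi), capSign]

/-- The handles are put in front of a word `l` that is already solved and whose signature ignores
their labels. -/
lemma solvable_handles {lab : ℕ → List ι} {u : ℕ → ℂ} (hu : ∀ s, u s ∈ unitConstants)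
    (hlab : ∀ s, (lab s).Nodup) (hdis : ∀ s t a, a ∈ lab s → a ∈ lab t → s = t) (is : List ℕ)
    (his : is.Nodup) {l : List ι} {g : Finset ι → ℂ} {T : ℕ} (H : Solvable l g (15 * T ^ 2))
    (hl : ∀ i ∈ is, ∀ a, a ∈ lab (2 * i) ∨ a ∈ lab (2 * i + 1) →
      a ∉ l ∧ ∀ Z, g (insert a Z) = g Z) :
    Solvable ((is.flatMap fun i => lab (2 * i) ++ lab (2 * i + 1) ++ (lab (2 * i)).reverse ++
        (lab (2 * i + 1)).reverse) ++ l)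
      (fun Z => (is.map (handleSign lab u Z)).prod * g Z)
      (15 * ((is.map fun i => (lab (2 * i)).length + (lab (2 * i + 1)).length).sum + T) ^ 2) := by
  induction is with
  | nil => exact H.of_eq (by simp) (by simp) (by simp)
  | cons i is ih =>
    obtain ⟨hi, his⟩ := List.nodup_cons.1 his
    have key : ∀ a, a ∈ lab (2 * i) ∨ a ∈ lab (2 * i + 1) → ∀ j ∈ is,
        a ∉ lab (2 * j) ∧ a ∉ lab (2 * j + 1) := by
      intro a ha j hj
      have hij : i ≠ j := fun h => hi (h ▸ hj)
      constructor <;> intro h <;> rcases ha with ha | ha <;> have := hdis _ _ a ha h <;> omega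
    have hnot : ∀ a, a ∈ lab (2 * i) ∨ a ∈ lab (2 * i + 1) →
        a ∉ (is.flatMap fun i => lab (2 * i) ++ lab (2 * i + 1) ++ (lab (2 * i)).reverse ++
        (lab (2 * i + 1)).reverse) ++ l := by
      intro a ha h
      rcases List.mem_append.1 h with h | h
      · obtain ⟨j, hj, haj⟩ := List.mem_flatMap.1 h
        simp [key a ha j hj] at haj
      · exact (hl i (by simp) a ha).1 h
    have hg : ∀ a, a ∈ lab (2 * i) ∨ a ∈ lab (2 * i + 1) → ∀ Z,
        (is.map (handleSign lab u (insert a Z))).prod * g (insert a Z) =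
          (is.map (handleSign lab u Z)).prod * g Z := by
      intro a ha Z
      rw [(hl i (by simp) a ha).2 Z]
      congr 2
      refine List.map_congr_left fun j hj => ?_
      rw [handleSign, countIn_insert (key a ha j hj).1, countIn_insert (key a ha j hj).2, handleSign]
    refine (Solvable.handle (u := u (2 * i)) (v := u (2 * i + 1))
      (ih his fun j hj => hl j (by simp [hj])) (hu _) (hu _) (hlab (2 * i)) (hlab (2 * i + 1))
      (fun a ha h => ?_) (fun a ha => hnot a (Or.inl ha)) (fun a ha => hnot a (Or.inr ha))
      (fun a ha => hg a (Or.inl ha)) (fun a ha => hg a (Or.inr ha))).of_eq (by simp)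
      (fun Z => by simp [handleSign, mul_assoc]) ?_
    · have := hdis _ _ a ha h
      omega
    · simp only [List.map_cons, List.sum_cons]
      generalize (is.map fun i => (lab (2 * i)).length + (lab (2 * i + 1)).length).sum = S
      generalize (lab (2 * i)).length = a
      generalize (lab (2 * i + 1)).length = b
      -- The terms linear in `a` and `b` of the cost of a handle are absorbed by squares.
      have h1 : a ≤ a ^ 2 := Nat.le_self_pow (by norm_num) a
      have h2 : b ≤ b ^ 2 := Nat.le_self_pow (by norm_num) b
      nlinarith [Nat.zero_le ((a + b) * (S + T)), Nat.zero_le (a * b)]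

lemma labelWord_sideWord (lab : ℕ → List ι) (k c : ℕ) :
    labelWord lab (sideWord k c) =
      ((List.range k).flatMap fun i => lab (2 * i) ++ lab (2 * i + 1) ++ (lab (2 * i)).reverse ++
        (lab (2 * i + 1)).reverse) ++
      ((List.range c).map (2 * k + ·)).flatMap fun j => lab j ++ lab j := by
  simp [labelWord, sideWord, List.flatMap_append, List.flatMap_assoc, List.flatMap_map]

lemma sum_range_two_mul (f : ℕ → ℕ) (k : ℕ) :
    ∑ s ∈ Finset.range (2 * k), f s = ∑ i ∈ Finset.range k, (f (2 * i) + f (2 * i + 1)) := by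
  induction k with
  | zero => simp
  | succ k ih => rw [Finset.sum_range_succ, ← ih, mul_add, Finset.sum_range_succ,
      Finset.sum_range_succ]; ring

lemma solvable_sideWord {lab : ℕ → List ι} {u : ℕ → ℂ} (hu : ∀ s, u s ∈ unitConstants)
    (hlab : ∀ s, (lab s).Nodup) (hdis : ∀ s t a, a ∈ lab s → a ∈ lab t → s = t) (k c : ℕ) :
    Solvable (labelWord lab (sideWord k c))
      (fun Z => (∏ i ∈ Finset.range k, handleSign lab u Z i) *
        ∏ j ∈ Finset.range c, capSign lab u Z (2 * k + j))
      (15 * (∑ s ∈ Finset.range (2 * k + c), (lab s).length) ^ 2) := by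
  have h1 := solvable_crossCaps hu hlab hdis ((List.range c).map (2 * k + ·))
    (List.nodup_range.map (add_right_injective _))
  have h2 := solvable_handles hu hlab hdis (List.range k) List.nodup_range h1 (fun i hi a ha => by
    have key : ∀ j, a ∉ lab (2 * k + j) := fun j hj => by
      rw [List.mem_range] at hi
      rcases ha with ha | ha <;> have := hdis _ _ a ha hj <;> omega
    constructor
    · simp [key]
    · intro Z
      congr 1
      refine List.map_congr_left fun j hj => ?_
      obtain ⟨j, -, rfl⟩ := List.mem_map.1 hj
      rw [capSign, countIn_insert (key j), capSign])
  refine h2.of_eq (labelWord_sideWord lab k c).symm (fun Z => ?_) (le_of_eq ?_)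
  · rw [List.map_map, ← List.prod_toFinset _ List.nodup_range,
      ← List.prod_toFinset _ List.nodup_range, List.toFinset_range, List.toFinset_range]
    rfl
  · rw [List.map_map, ← List.sum_toFinset _ List.nodup_range,
      ← List.sum_toFinset _ List.nodup_range, List.toFinset_range, List.toFinset_range,
      Finset.sum_range_add, sum_range_two_mul]
    rfl

end Words

/-! ### Averaging the signs away -/

section Coefficients
open Classical
variable {ι : Type*}

/-- A choice of a sign for each symbol of a handle and of `±i` for each symbol of a cross cap. -/
abbrev SignChoice (k c : ℕ) := (Fin k → Bool × Bool) × (Fin c → Bool)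

/-- The sign that a Boolean stands for. -/
noncomputable def boolSign (b : Bool) : ℂ := if b then -1 else 1

/-- The imaginary unit `±i` that a Boolean stands for. -/
noncomputable def boolImag (b : Bool) : ℂ := if b then -Complex.I else Complex.I

/-- The weight that the choice `θ` assigns to the strands with symbol `s`. -/
noncomputable def strandWeight {k c : ℕ} (θ : SignChoice k c) (s : ℕ) : ℂ :=
  if h : s / 2 < k then boolSign (if s % 2 = 0 then (θ.1 ⟨s / 2, h⟩).1 else (θ.1 ⟨s / 2, h⟩).2)
  else if h : s - 2 * k < c then boolImag (θ.2 ⟨s - 2 * k, h⟩) else 1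

lemma strandWeight_mem {k c : ℕ} (θ : SignChoice k c) (s : ℕ) :
    strandWeight θ s ∈ unitConstants := by
  unfold strandWeight boolSign boolImag unitConstants
  split_ifs <;> simp

/-- The coefficient of the choice `θ`. -/
noncomputable def signCoeff {k c : ℕ} (θ : SignChoice k c) : ℂ :=
  (∏ i, if (θ.1 i).1 && (θ.1 i).2 then (-1 / 2 : ℂ) else 1 / 2) *
    ∏ j, if θ.2 j then (1 + Complex.I) / 2 else (1 - Complex.I) / 2

/-- The four terms add up to `(-1)^(m n)` times half of `1 + (-1)^m + (-1)^n - (-1)^(m+n)`, and the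
latter is again `(-1)^(m n)`. -/
lemma sum_handle (m n : ℕ) :
    ∑ b : Bool × Bool, (if b.1 && b.2 then (-1 / 2 : ℂ) else 1 / 2) *
      ((-1) ^ (m * n) * boolSign b.1 ^ m * boolSign b.2 ^ n) = 1 := by
  simp only [Fintype.sum_prod_type, Fintype.sum_bool, boolSign]
  rcases Nat.even_or_odd m with hm | hm <;> rcases Nat.even_or_odd n with hn | hn <;>
    simp [hm.neg_one_pow, hn.neg_one_pow, pow_mul] <;> norm_num

/-- For `n = 0` and `n = 1` this is a direct computation. Replacing `n` by `n + 2` changes the sign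
of both factors, as `(±i)^2 = -1`. -/
lemma sum_crossCap (n : ℕ) :
    ∑ b : Bool, (if b then (1 + Complex.I) / 2 else (1 - Complex.I) / 2) *
      ((-1) ^ (n.choose 2) * boolImag b ^ n) = 1 := by
  simp only [Fintype.sum_bool, boolImag, if_true, Bool.false_eq_true, if_false]
  have hI := Complex.I_sq
  have step : ∀ n : ℕ, ((-1 : ℂ)) ^ ((n + 2).choose 2) = -(-1) ^ (n.choose 2) := by
    intro n
    have : (n + 2).choose 2 = n.choose 2 + 2 * n + 1 := by
      rw [Nat.choose_succ_succ' (n + 1) 1, Nat.choose_succ_succ' n 1, Nat.choose_one_right,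
        Nat.choose_one_right]
      ring
    rw [this, pow_succ, pow_add, pow_mul]
    simp
  induction n using Nat.twoStepInduction with
  | zero => simp; ring
  | one => simp; linear_combination -hI
  | more n ih _ =>
    rw [step, pow_add, pow_add, neg_sq, hI]
    linear_combination ih

lemma sum_prod_fun {κ : Type*} [Fintype κ] {n : ℕ} (f : Fin n → κ → ℂ)
    (h : ∀ i, ∑ b, f i b = 1) : ∑ x : Fin n → κ, ∏ i, f i (x i) = 1 := by
  rw [← Fintype.piFinset_univ, ← Finset.prod_univ_sum (fun _ => Finset.univ) f]
  simp [h]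

lemma sum_prod_mul_prod {κ κ' : Type*} [Fintype κ] [Fintype κ'] {m n : ℕ} (f : Fin m → κ → ℂ)
    (g : Fin n → κ' → ℂ) (hf : ∀ i, ∑ b, f i b = 1) (hg : ∀ i, ∑ b, g i b = 1) :
    ∑ x : (Fin m → κ) × (Fin n → κ'), (∏ i, f i (x.1 i)) * ∏ j, g j (x.2 j) = 1 := by
  rw [Fintype.sum_prod_type, ← Fintype.sum_mul_sum (fun x : Fin m → κ => ∏ i, f i (x i))
    (fun y : Fin n → κ' => ∏ j, g j (y j)), sum_prod_fun f hf, sum_prod_fun g hg, mul_one]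

/-- The choices for different handles and cross caps are independent, so the sum factors into the
sums of `sum_handle` and `sum_crossCap`, all equal to 1. This holds for every `Z`, although the
signatures depend on `Z`. -/
lemma sum_signCoeff (k c : ℕ) (lab : ℕ → List ι) (Z : Finset ι) :
    ∑ θ : SignChoice k c, signCoeff θ *
      ((∏ i ∈ Finset.range k, handleSign lab (strandWeight θ) Z i) *
        ∏ j ∈ Finset.range c, capSign lab (strandWeight θ) Z (2 * k + j)) = 1 := by
  have h1 : ∀ θ : SignChoice k c, ∏ i ∈ Finset.range k, handleSign lab (strandWeight θ) Z i =
      ∏ i : Fin k, ((-1) ^ (countIn (lab (2 * i)) Z * countIn (lab (2 * i + 1)) Z) *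
        boolSign (θ.1 i).1 ^ countIn (lab (2 * i)) Z *
          boolSign (θ.1 i).2 ^ countIn (lab (2 * i + 1)) Z) := by
    intro θ
    rw [Finset.prod_range]
    refine Finset.prod_congr rfl fun i _ => ?_
    have e1 : 2 * (i : ℕ) / 2 = i := by omega
    have e2 : (2 * (i : ℕ) + 1) / 2 = i := by omega
    have e3 : (2 * (i : ℕ) + 1) % 2 = 1 := by omega
    simp [handleSign, strandWeight, e1, e2, e3]
  have h2 : ∀ θ : SignChoice k c, ∏ j ∈ Finset.range c, capSign lab (strandWeight θ) Z (2 * k + j) =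
      ∏ j : Fin c, ((-1) ^ ((countIn (lab (2 * k + j)) Z).choose 2) *
        boolImag (θ.2 j) ^ countIn (lab (2 * k + j)) Z) := by
    intro θ
    rw [Finset.prod_range]
    refine Finset.prod_congr rfl fun j _ => ?_
    -- The symbols from `2 * k` on belong to cross caps, so `strandWeight` takes its second branch.
    have e1 : ¬ (2 * k + (j : ℕ)) / 2 < k := by omega
    simp [capSign, strandWeight, e1]
  rw [← sum_prod_mul_prod (fun (i : Fin k) (b : Bool × Bool) =>
      (if b.1 && b.2 then (-1 / 2 : ℂ) else 1 / 2) *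
        ((-1) ^ (countIn (lab (2 * i)) Z * countIn (lab (2 * i + 1)) Z) *
          boolSign b.1 ^ countIn (lab (2 * i)) Z * boolSign b.2 ^ countIn (lab (2 * i + 1)) Z))
    (fun (j : Fin c) (b : Bool) =>
      (if b then (1 + Complex.I) / 2 else (1 - Complex.I) / 2) *
        ((-1) ^ ((countIn (lab (2 * k + j)) Z).choose 2) *
          boolImag b ^ countIn (lab (2 * k + j)) Z))
    (fun i => sum_handle _ _) (fun j => sum_crossCap _)]
  refine Finset.sum_congr rfl fun θ _ => ?_
  rw [h1, h2, signCoeff, mul_mul_mul_comm, ← Finset.prod_mul_distrib, ← Finset.prod_mul_distrib]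

end Coefficients

/-! ### From coordinates to planar multigraphs -/

section Drawing
open Classical

/-- An edge of a labelled graph drawn in the plane, with ends given by coordinates. -/
structure DrawnEdge (β : Type*) where
  src : ℝ × ℝ
  tgt : ℝ × ℝ
  const : ℂ
  orig : Option β
  curve : ℝ → ℂ

variable {β : Type*}

instance : Inhabited (DrawnEdge β) := ⟨⟨0, 0, 0, none, 0⟩⟩

/-- The weighted edge that arises from a drawn edge by evaluating its label. -/
noncomputable def DrawnEdge.eval (w : β → ℂ) (d : DrawnEdge β) : (ℝ × ℝ) × (ℝ × ℝ) × ℂ :=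
  (d.src, d.tgt, d.const * d.orig.elim 1 w)

/-- The edges in `E` form a drawing without crossings on the vertex set `V`, where the vertex with
the coordinates `v` is the point `Φ v`. -/
structure IsDrawing (Φ : ℝ × ℝ → ℂ) (V : Finset (ℝ × ℝ)) (E : List (DrawnEdge β)) : Prop where
  injOn : Set.InjOn Φ V
  ends_mem : ∀ d ∈ E, d.src ∈ V ∧ d.tgt ∈ V
  continuousOn : ∀ d ∈ E, ContinuousOn d.curve (Set.Icc 0 1)
  curve_ends : ∀ d ∈ E, d.curve 0 = Φ d.src ∧ d.curve 1 = Φ d.tgt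
  curve_ne : ∀ d ∈ E, ∀ v ∈ V, ∀ t ∈ Set.Ioo (0 : ℝ) 1, d.curve t ≠ Φ v
  curve_injOn : ∀ d ∈ E, Set.InjOn d.curve (Set.Ioo 0 1)
  pairwise : E.Pairwise fun d d' => ∀ t ∈ Set.Ioo (0 : ℝ) 1, ∀ t' ∈ Set.Ioo (0 : ℝ) 1,
    d.curve t ≠ d'.curve t'

lemma exists_enumeration {X : Type*} [Inhabited X] (V : Finset X) :
    ∃ ψ : ℕ → X, Set.InjOn ψ {i | i < V.card} ∧ ψ '' {i | i < V.card} = V := by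
  refine ⟨fun i => if h : i < V.card then V.equivFin.symm ⟨i, h⟩ else default, ?_, ?_⟩
  · intro i hi j hj h
    rw [Set.mem_ofPred_eq] at hi hj
    simp only [hi, hj, dif_pos] at h
    simpa using V.equivFin.symm.injective (Subtype.ext h)
  · ext v
    constructor
    · rintro ⟨i, hi, rfl⟩
      rw [Set.mem_ofPred_eq] at hi
      simp only [hi, dif_pos, SetLike.mem_coe, Finset.coe_mem]
    · intro hv
      exact ⟨V.equivFin ⟨v, hv⟩, (V.equivFin ⟨v, hv⟩).2, by simp⟩

/-- The edges are the positions in the list `E`, so that parallel edges remain distinct. By `horig`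
no original edge occurs at two positions. -/
lemma IsDrawing.exists_graph {Φ : ℝ × ℝ → ℂ} {V : Finset (ℝ × ℝ)} {E : List (DrawnEdge β)}
    (D : IsDrawing Φ V E) (horig : E.Pairwise fun d d' => d.orig = d'.orig → d.orig = none) :
    ∃ (H : Graph ℕ ℕ) (u : ℕ → ℂ) (o : ℕ → Option β), H.vertexSet.Finite ∧ H.edgeSet.Finite ∧
      IsPlanarGraph H ∧ H.vertexSet.ncard = V.card ∧ H.edgeSet.ncard = E.length ∧
      (∀ f ∈ H.edgeSet, ∃ d ∈ E, u f = d.const ∧ o f = d.orig) ∧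
      (∀ e, (∃ d ∈ E, d.orig = some e) → ∃! f, f ∈ H.edgeSet ∧ o f = some e) ∧
      ∀ w : β → ℂ, PerfMatch H (fun f => u f * (o f).elim 1 w) =
        pm (E.map (DrawnEdge.eval w)) V := by
  obtain ⟨ψ, hψ, hψV⟩ := exists_enumeration V
  have hget : ∀ f, f < E.length → E.getD f default ∈ E := fun f hf => by
    rw [List.getD_eq_getElem _ _ hf]
    exact List.getElem_mem hf
  have hsurj : ∀ v ∈ V, ∃ i < V.card, ψ i = v := fun v hv => by
    have : v ∈ ψ '' {i | i < V.card} := hψV ▸ hv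
    exact this
  have hψm : ∀ i < V.card, ψ i ∈ V := fun i hi => by
    have : ψ i ∈ ψ '' {i | i < V.card} := ⟨i, hi, rfl⟩
    rwa [hψV] at this
  let link : ℕ → ℕ → ℕ → Prop := fun f x y => f < E.length ∧ x < V.card ∧ y < V.card ∧
    (((E.getD f default).src = ψ x ∧ (E.getD f default).tgt = ψ y) ∨
      ((E.getD f default).src = ψ y ∧ (E.getD f default).tgt = ψ x))
  let H : Graph ℕ ℕ :=
    { vertexSet := {i | i < V.card}
      IsLink := link
      edgeSet := {f | f < E.length}
      isLink_symm := fun f _ => ⟨fun x y h => ⟨h.1, h.2.2.1, h.2.1, h.2.2.2.symm⟩⟩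
      eq_or_eq_of_isLink_of_isLink := by
        rintro f x y v z ⟨-, hx, hy, h⟩ ⟨-, hv, hz, h'⟩
        rcases h with ⟨h1, h2⟩ | ⟨h1, h2⟩ <;> rcases h' with ⟨h3, h4⟩ | ⟨h3, h4⟩
        · exact Or.inl (hψ hx hv (h1.symm.trans h3))
        · exact Or.inr (hψ hx hz (h1.symm.trans h3))
        · exact Or.inr (hψ hx hz (h2.symm.trans h4))
        · exact Or.inl (hψ hx hv (h2.symm.trans h4))
      edge_mem_iff_exists_isLink := by
        intro f
        constructor
        · intro hf
          obtain ⟨x, hx, hx'⟩ := hsurj _ (D.ends_mem _ (hget f hf)).1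
          obtain ⟨y, hy, hy'⟩ := hsurj _ (D.ends_mem _ (hget f hf)).2
          exact ⟨x, y, hf, hx, hy, Or.inl ⟨hx'.symm, hy'.symm⟩⟩
        · rintro ⟨x, y, h, -⟩
          exact h
      left_mem_of_isLink := fun f x y h => h.2.1 }
  have hpw : ∀ f f', f < E.length → f' < E.length → ∀ t ∈ Set.Ioo (0 : ℝ) 1,
      ∀ t' ∈ Set.Ioo (0 : ℝ) 1, (E.getD f default).curve t = (E.getD f' default).curve t' →
        f = f' ∧ t = t' := by
    intro f f' hf hf' t ht t' ht' h
    rcases lt_trichotomy f f' with hlt | rfl | hlt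
    · rw [List.getD_eq_getElem _ _ hf, List.getD_eq_getElem _ _ hf'] at h
      exact absurd h (List.pairwise_iff_getElem.1 D.pairwise f f' hf hf' hlt t ht t' ht')
    · exact ⟨rfl, D.curve_injOn _ (hget f hf) ht ht' h⟩
    · rw [List.getD_eq_getElem _ _ hf, List.getD_eq_getElem _ _ hf'] at h
      exact absurd h.symm (List.pairwise_iff_getElem.1 D.pairwise f' f hf' hf hlt t' ht' t ht)
  refine ⟨H, fun f => (E.getD f default).const, fun f => (E.getD f default).orig,
    Set.finite_lt_nat _, Set.finite_lt_nat _, ⟨?_⟩, ?_, ?_, fun f hf => ⟨_, hget f hf, rfl, rfl⟩,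
    ?_, ?_⟩
  · exact
      { pos := fun i => Φ (ψ i)
        curve := fun f => (E.getD f default).curve
        pos_injOn := fun i hi j hj h => hψ hi hj (D.injOn (hψm i hi) (hψm j hj) h)
        curve_continuousOn := fun f hf => D.continuousOn _ (hget f hf)
        curve_ends := by
          rintro f x y ⟨hf, hx, hy, h⟩
          obtain ⟨h0, h1⟩ := D.curve_ends _ (hget f hf)
          rcases h with ⟨h, h'⟩ | ⟨h, h'⟩
          · exact Or.inl ⟨h0.trans (by rw [h]), h1.trans (by rw [h'])⟩
          · exact Or.inr ⟨h0.trans (by rw [h]), h1.trans (by rw [h'])⟩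
        curve_ne_pos := fun f hf v hv t ht => D.curve_ne _ (hget f hf) _ (hψm v hv) t ht
        curve_inj := fun f hf f' hf' t ht t' ht' h => hpw f f' hf hf' t ht t' ht' h }
  · exact Set.ncard_Iio_nat _
  · exact Set.ncard_Iio_nat _
  · rintro e ⟨d, hd, hde⟩
    obtain ⟨f, hf, rfl⟩ := List.getElem_of_mem hd
    refine ⟨f, ⟨hf, by simpa [hf] using hde⟩, ?_⟩
    rintro f' ⟨hf', h⟩
    replace hf' : f' < E.length := hf'
    dsimp only at h
    rw [List.getD_eq_getElem _ _ hf'] at h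
    by_contra hne
    rcases lt_or_gt_of_ne hne with hlt | hlt
    · have := List.pairwise_iff_getElem.1 horig f' f hf' hf hlt (h.trans hde.symm)
      simp [h] at this
    · have := List.pairwise_iff_getElem.1 horig f f' hf hf' hlt (hde.trans h.symm)
      simp [hde] at this
  · intro w
    rw [PerfMatch_eq_pm H List.nodup_range (es := List.range E.length) (φ := ψ) (V := V)
      (src := fun f => (E.getD f default).src) (tgt := fun f => (E.getD f default).tgt)
      (by intro e; exact List.mem_range) hψ hψV.symm (fun f x y h => h.2.2.2)]
    congr 1
    refine List.ext_getElem (by simp) fun i h1 h2 => ?_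
    simp only [List.length_map, List.length_range] at h1
    simp [DrawnEdge.eval, h1]

end Drawing

/-! ### Subdivision of edges at their passages -/

section Subdivision
variable {X : Type*} [DecidableEq X]

/-- The ends of the connections in `Z`, which go from `a` to `b`. -/
def connPts {ι : Type*} (a b : ι → X) (Z : Finset ι) : Finset X := Z.biUnion fun l => {a l, b l}

lemma mem_connPts {ι : Type*} {a b : ι → X} {Z : Finset ι} {v : X} :
    v ∈ connPts a b Z ↔ ∃ l ∈ Z, v = a l ∨ v = b l := by
  simp [connPts]

/-- The set `Z` consists of the connections that are not used; their ends have to be covered by `L`.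
-/
lemma pm_connections {ι : Type*} [DecidableEq ι] {a b : ι → X} (L : List (X × X × ℂ)) {cl : List ι}
    (hcl : cl.Nodup) (hab : ∀ l ∈ cl, ∀ l' ∈ cl, a l ≠ b l')
    (ha : ∀ l ∈ cl, ∀ l' ∈ cl, a l = a l' → l = l') (hb : ∀ l ∈ cl, ∀ l' ∈ cl, b l = b l' → l = l')
    {S : Finset X} (hS : ∀ l ∈ cl, a l ∉ S ∧ b l ∉ S) :
    pm (cl.map (fun l => (a l, b l, 1)) ++ L) (S ∪ connPts a b cl.toFinset) =
      ∑ Z ∈ cl.toFinset.powerset, pm L (S ∪ connPts a b Z) := by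
  induction cl generalizing S with
  | nil => simp
  | cons l cl ih =>
    obtain ⟨hl, hcl⟩ := List.nodup_cons.1 hcl
    have ih' := fun {S : Finset X} => ih hcl
      (fun l hl l' hl' => hab l (by simp [hl]) l' (by simp [hl']))
      (fun l hl l' hl' => ha l (by simp [hl]) l' (by simp [hl']))
      (fun l hl l' hl' => hb l (by simp [hl]) l' (by simp [hl'])) (S := S)
    have hne : ∀ m ∈ cl, a m ≠ a l ∧ a m ≠ b l ∧ b m ≠ a l ∧ b m ≠ b l := fun m hm => by
      have hml : m ≠ l := fun h => hl (h ▸ hm)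
      exact ⟨fun h => hml (ha m (by simp [hm]) l (by simp) h), hab m (by simp [hm]) l (by simp),
        (hab l (by simp) m (by simp [hm])).symm,
        fun h => hml (hb m (by simp [hm]) l (by simp) h)⟩
    have hpt : ∀ v, v ∈ connPts a b cl.toFinset → v ≠ a l ∧ v ≠ b l := by
      intro v hv
      obtain ⟨m, hm, h⟩ := mem_connPts.1 hv
      have := hne m (by simpa using hm)
      rcases h with rfl | rfl <;> simp [this]
    have hins : ∀ Z : Finset ι, S ∪ connPts a b (insert l Z) = (S ∪ {a l, b l}) ∪ connPts a b Z := by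
      intro Z
      rw [connPts, Finset.biUnion_insert, ← Finset.union_assoc]
      rfl
    have hlS := hS l (by simp)
    rw [List.map_cons, List.cons_append, pm, List.toFinset_cons,
      Finset.sum_powerset_insert (by simpa using hl), hins]
    simp only [hins]
    rw [ih' (S := S ∪ {a l, b l}), if_pos, one_mul]
    · have e1 : (S ∪ {a l, b l} ∪ connPts a b cl.toFinset) \ {a l, b l} =
          S ∪ connPts a b cl.toFinset := by
        ext v
        have := hpt v
        simp only [Finset.mem_sdiff, Finset.mem_union, Finset.mem_insert, Finset.mem_singleton]
        grind
      rw [e1, ih' fun m hm => hS m (by simp [hm]), add_comm]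
    · simp [hab l (by simp) l (by simp)]
    · intro m hm
      have h1 := hS m (by simp [hm])
      simp [h1, hne m hm]

/-- The pieces of a path that replaces an edge of weight `w` from `x` to `y` and has the inner
vertices `p 0, q 0, …, p (c - 1), q (c - 1)`, in this order. -/
def pathPieces (x y : X) (p q : ℕ → X) (w : ℂ) (c : ℕ) : List (X × X × ℂ) :=
  (List.range (c + 1)).map fun i =>
    (if i = 0 then x else q (i - 1), if i = c then y else p i, if i = 0 then w else 1)

lemma pathPieces_eq (x y : X) (p q : ℕ → X) (w : ℂ) (c : ℕ) :
    pathPieces x y p q w c = ((List.range c).map fun i =>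
      (if i = 0 then x else q (i - 1), p i, if i = 0 then w else 1)) ++
        [(if c = 0 then x else q (c - 1), y, if c = 0 then w else 1)] := by
  rw [pathPieces, List.range_succ, List.map_append]
  simp only [List.map_cons, List.map_nil, if_true]
  congr 1
  refine List.map_congr_left fun i hi => ?_
  rw [if_neg (List.mem_range.1 hi).ne]

/-- Induction on the number of passages: the last edge of the path is subdivided by two further
vertices, as in `pm_subdiv`. -/
lemma pm_path {x : X} {p q : ℕ → X} {w : ℂ} {c : ℕ} {y : X} {L : List (X × X × ℂ)} {S : Finset X}
    (hpq : ∀ i < c, ∀ j < c, p i ≠ q j) (hp : ∀ i < c, ∀ j < c, p i = p j → i = j)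
    (hq : ∀ i < c, ∀ j < c, q i = q j → i = j) (hS : ∀ i < c, p i ∉ S ∧ q i ∉ S)
    (hx : ∀ i < c, p i ≠ x ∧ q i ≠ x) (hy : ∀ i < c, p i ≠ y ∧ q i ≠ y)
    (hL : ∀ i < c, Fresh (p i) L ∧ Fresh (q i) L) :
    pm (pathPieces x y p q w c ++ ((List.range c).map fun i => (p i, q i, 1)) ++ L)
      (S ∪ connPts p q (Finset.range c)) = pm ((x, y, w) :: L) S := by
  induction c with
  | zero => simp [pathPieces, connPts]
  | succ c ih =>
    have ih' := ih (fun i hi j hj => hpq i (by omega) j (by omega))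
      (fun i hi j hj => hp i (by omega) j (by omega)) (fun i hi j hj => hq i (by omega) j (by omega))
      (fun i hi => hS i (by omega)) (fun i hi => hx i (by omega)) (fun i hi => hy i (by omega))
      (fun i hi => hL i (by omega))
    rw [← ih', pathPieces_eq, pathPieces_eq, List.range_succ]
    simp only [List.map_append, List.map_cons, List.map_nil, Nat.succ_ne_zero, if_false,
      Nat.add_sub_cancel]
    set B : List (X × X × ℂ) := (List.range c).map fun i =>
      (if i = 0 then x else q (i - 1), p i, if i = 0 then w else 1) with hB
    set C : List (X × X × ℂ) := (List.range c).map fun i => (p i, q i, 1) with hC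
    set s := if c = 0 then x else q (c - 1) with hs
    set w' : ℂ := if c = 0 then w else 1
    -- The edge to be subdivided runs from the last entrance, or from `x` if there is none, to `y`;
    -- it has the weight `w` only if it is the whole path.
    have hsub := pm_subdiv (x := s) (y := y) (p := p c) (q := q c) w' (L := B ++ (C ++ L))
      (S := S ∪ connPts p q (Finset.range c)) (hpq c (by omega) c (by omega))
    have hr : ∀ i < c, p i ≠ p c ∧ p i ≠ q c ∧ q i ≠ p c ∧ q i ≠ q c := fun i hi =>
      ⟨fun h => hi.ne (hp i (by omega) c (by omega) h), hpq i (by omega) c (by omega),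
        (hpq c (by omega) i (by omega)).symm, fun h => hi.ne (hq i (by omega) c (by omega) h)⟩
    have hnot : ∀ v, (v = p c ∨ v = q c) → v ∉ S ∪ connPts p q (Finset.range c) := by
      rintro v hv h
      rcases Finset.mem_union.1 h with h | h
      · rcases hv with rfl | rfl
        exacts [(hS c (by omega)).1 h, (hS c (by omega)).2 h]
      · obtain ⟨i, hi, h⟩ := mem_connPts.1 h
        have := hr i (by simpa using hi)
        rcases hv with rfl | rfl <;> rcases h with h | h <;> simp [h] at this
    have hsne : p c ≠ s ∧ q c ≠ s := by
      rw [hs]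
      split_ifs with h0
      · exact hx c (by omega)
      · have := hr (c - 1) (by omega)
        exact ⟨this.2.2.1.symm, this.2.2.2.symm⟩
    have hfr : ∀ v, (v = p c ∨ v = q c) → Fresh v (B ++ (C ++ L)) := by
      rintro v hv e he
      have hxc := hx c (by omega)
      rcases List.mem_append.1 he with he | he
      · obtain ⟨i, hi, rfl⟩ := List.mem_map.1 he
        rw [List.mem_range] at hi
        have h1 := hr i hi
        have h2 : ∀ j, i = j + 1 → q j ≠ p c ∧ q j ≠ q c := fun j hj => (hr j (by omega)).2.2
        rcases hv with rfl | rfl <;> refine ⟨?_, ?_⟩ <;> dsimp only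
        · split_ifs with h0
          exacts [hxc.1.symm, (h2 (i - 1) (by omega)).1]
        · exact h1.1
        · split_ifs with h0
          exacts [hxc.2.symm, (h2 (i - 1) (by omega)).2]
        · exact h1.2.1
      · rcases List.mem_append.1 he with he | he
        · obtain ⟨i, hi, rfl⟩ := List.mem_map.1 he
          have h1 := hr i (List.mem_range.1 hi)
          rcases hv with rfl | rfl
          exacts [⟨h1.1, h1.2.2.1⟩, ⟨h1.2.1, h1.2.2.2⟩]
        · rcases hv with rfl | rfl
          exacts [(hL c (by omega)).1 e he, (hL c (by omega)).2 e he]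
    have hyc := hy c (by omega)
    have hsub' := hsub (hnot _ (Or.inl rfl)) (hnot _ (Or.inr rfl)) hsne.1 hyc.1 hsne.2 hyc.2
      (hfr _ (Or.inl rfl)) (hfr _ (Or.inr rfl))
    have hset : S ∪ connPts p q (Finset.range (c + 1)) =
        insert (p c) (insert (q c) (S ∪ connPts p q (Finset.range c))) := by
      rw [Finset.range_add_one, connPts, Finset.biUnion_insert]
      ext v
      simp only [Finset.mem_union, Finset.mem_insert, Finset.mem_singleton, connPts]
      tauto
    rw [hset]
    refine (pm_perm ?_ _).trans (hsub'.trans (pm_perm ?_ _))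
    · rw [List.perm_iff_count]
      intro e
      simp only [List.count_append, List.count_cons, List.count_nil]
      omega
    · rw [List.perm_iff_count]
      intro e
      simp only [List.count_append, List.count_cons, List.count_nil]
      omega

/-- All edges are subdivided one after the other; the edges not yet treated are moved into `L`. -/
lemma pm_paths {β : Type*} [DecidableEq β] {x y : β → X} {p q : β × ℕ → X} {w : β → ℂ} {c : β → ℕ}
    {es : List β} (hes : es.Nodup) {L : List (X × X × ℂ)} {S : Finset X} {Q : Set (β × ℕ)}
    (hQ : ∀ l, l ∈ Q ↔ l.1 ∈ es ∧ l.2 < c l.1)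
    (hpq : ∀ l ∈ Q, ∀ l' ∈ Q, p l ≠ q l') (hp : Set.InjOn p Q) (hq : Set.InjOn q Q)
    (hS : ∀ l ∈ Q, p l ∉ S ∧ q l ∉ S)
    (hx : ∀ l ∈ Q, ∀ e ∈ es, p l ≠ x e ∧ q l ≠ x e ∧ p l ≠ y e ∧ q l ≠ y e)
    (hL : ∀ l ∈ Q, Fresh (p l) L ∧ Fresh (q l) L) :
    pm ((es.flatMap fun e => pathPieces (x e) (y e) (fun i => p (e, i)) (fun i => q (e, i)) (w e)
        (c e) ++ (List.range (c e)).map fun i => (p (e, i), q (e, i), 1)) ++ L)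
      (S ∪ es.toFinset.biUnion fun e => connPts (fun i => p (e, i)) (fun i => q (e, i))
        (Finset.range (c e))) = pm ((es.map fun e => (x e, y e, w e)) ++ L) S := by
  induction es generalizing L Q with
  | nil => simp
  | cons e es ih =>
    obtain ⟨he, hes⟩ := List.nodup_cons.1 hes
    have hQe : ∀ i < c e, (e, i) ∈ Q := fun i hi => (hQ _).2 ⟨by simp, hi⟩
    have hQ' : ∀ l, l ∈ {l : β × ℕ | l.1 ∈ es ∧ l.2 < c l.1} → l ∈ Q ∧ l.1 ≠ e := fun l hl =>
      ⟨(hQ l).2 ⟨List.mem_cons_of_mem _ hl.1, hl.2⟩, fun h => he (h ▸ hl.1)⟩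
    have ih' := ih hes (L := (x e, y e, w e) :: L) (Q := {l : β × ℕ | l.1 ∈ es ∧ l.2 < c l.1})
      (fun l => Iff.rfl) (fun l hl l' hl' => hpq l (hQ' l hl).1 l' (hQ' l' hl').1)
      (hp.mono fun l hl => (hQ' l hl).1) (hq.mono fun l hl => (hQ' l hl).1)
      (fun l hl => hS l (hQ' l hl).1)
      (fun l hl f hf => hx l (hQ' l hl).1 f (List.mem_cons_of_mem _ hf))
      (fun l hl => by
        have h1 := hx l (hQ' l hl).1 e (by simp)
        have h2 := hL l (hQ' l hl).1
        constructor <;> intro f hf <;> rcases List.mem_cons.1 hf with rfl | hf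
        exacts [⟨h1.1.symm, h1.2.2.1.symm⟩, h2.1 f hf, ⟨h1.2.1.symm, h1.2.2.2.symm⟩, h2.2 f hf])
    set R := es.flatMap fun e => pathPieces (x e) (y e) (fun i => p (e, i)) (fun i => q (e, i)) (w e)
        (c e) ++ (List.range (c e)).map fun i => (p (e, i), q (e, i), (1 : ℂ)) with hR
    set T := es.toFinset.biUnion fun e => connPts (fun i => p (e, i)) (fun i => q (e, i))
        (Finset.range (c e)) with hT
    have hfresh : ∀ l ∈ Q, l.1 = e → ∀ f ∈ R, f.1 ≠ p l ∧ f.1 ≠ q l ∧ f.2.1 ≠ p l ∧ f.2.1 ≠ q l := by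
      intro l hl hle f hf
      obtain ⟨e', he', hf⟩ := List.mem_flatMap.1 hf
      have hne : e' ≠ e := fun h => he (h ▸ he')
      have hx' := hx l hl e' (List.mem_cons_of_mem _ he')
      have hpt : ∀ i < c e', p (e', i) ≠ p l ∧ p (e', i) ≠ q l ∧ q (e', i) ≠ p l ∧
          q (e', i) ≠ q l := by
        intro i hi
        have hm : (e', i) ∈ Q := (hQ _).2 ⟨List.mem_cons_of_mem _ he', hi⟩
        have hml : (e', i) ≠ l := fun h => hne (by rw [← hle, ← h])
        exact ⟨fun h => hml (hp hm hl h), hpq _ hm _ hl, (hpq _ hl _ hm).symm,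
          fun h => hml (hq hm hl h)⟩
      rcases List.mem_append.1 hf with hf | hf
      · obtain ⟨i, hi, rfl⟩ := List.mem_map.1 hf
        rw [List.mem_range] at hi
        dsimp only
        have h1 : i ≠ 0 → _ := fun h0 => hpt (i - 1) (by omega)
        have h2 : i ≠ c e' → _ := fun h0 => hpt i (by omega)
        refine ⟨?_, ?_, ?_, ?_⟩ <;> split_ifs with h0
        exacts [hx'.1.symm, (h1 h0).2.2.1, hx'.2.1.symm, (h1 h0).2.2.2, hx'.2.2.1.symm, (h2 h0).1,
          hx'.2.2.2.symm, (h2 h0).2.1]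
      · obtain ⟨i, hi, rfl⟩ := List.mem_map.1 hf
        have := hpt i (List.mem_range.1 hi)
        exact ⟨this.1, this.2.1, this.2.2.1, this.2.2.2⟩
    have hTn : ∀ l ∈ Q, l.1 = e → p l ∉ T ∧ q l ∉ T := by
      intro l hl hle
      have key : ∀ v ∈ T, v ≠ p l ∧ v ≠ q l := by
        intro v hv
        obtain ⟨e', he', hv⟩ := Finset.mem_biUnion.1 hv
        obtain ⟨i, hi, hv⟩ := mem_connPts.1 hv
        have hf : (p (e', i), q (e', i), (1 : ℂ)) ∈ R :=
          List.mem_flatMap.2 ⟨e', by simpa using he', List.mem_append_right _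
            (List.mem_map.2 ⟨i, by simpa using hi, rfl⟩)⟩
        have := hfresh l hl hle _ hf
        rcases hv with rfl | rfl
        exacts [⟨this.1, this.2.1⟩, ⟨this.2.2.1, this.2.2.2⟩]
      exact ⟨fun h => (key _ h).1 rfl, fun h => (key _ h).2 rfl⟩
    have hpath := pm_path (x := x e) (y := y e) (p := fun i => p (e, i)) (q := fun i => q (e, i))
      (w := w e) (c := c e) (L := R ++ L) (S := S ∪ T)
      (fun i hi j hj => hpq _ (hQe i hi) _ (hQe j hj))
      (fun i hi j hj h => by simpa using hp (hQe i hi) (hQe j hj) h)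
      (fun i hi j hj h => by simpa using hq (hQe i hi) (hQe j hj) h)
      (fun i hi => by
        have h1 := hTn _ (hQe i hi) rfl
        have h2 := hS _ (hQe i hi)
        simp [h1, h2])
      (fun i hi => ⟨(hx _ (hQe i hi) e (by simp)).1, (hx _ (hQe i hi) e (by simp)).2.1⟩)
      (fun i hi => (hx _ (hQe i hi) e (by simp)).2.2)
      (fun i hi => by
        have h1 := hfresh _ (hQe i hi) rfl
        have h2 := hL _ (hQe i hi)
        constructor <;> intro f hf <;> rcases List.mem_append.1 hf with hf | hf
        exacts [⟨(h1 f hf).1, (h1 f hf).2.2.1⟩, h2.1 f hf, ⟨(h1 f hf).2.1, (h1 f hf).2.2.2⟩,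
          h2.2 f hf])
    have hset : S ∪ (e :: es).toFinset.biUnion (fun e => connPts (fun i => p (e, i))
        (fun i => q (e, i)) (Finset.range (c e))) =
        S ∪ T ∪ connPts (fun i => p (e, i)) (fun i => q (e, i)) (Finset.range (c e)) := by
      rw [List.toFinset_cons, Finset.biUnion_insert, Finset.union_assoc, Finset.union_comm T]
    rw [hset, List.flatMap_cons, List.append_assoc, hpath, List.map_cons, List.cons_append,
      ← pm_perm List.perm_middle, ih']
    exact pm_perm List.perm_middle _

end Subdivision

/-! ### Wrapping the strip around the disc -/

section Chart
open Classical

/-- The point with the polar coordinates `(2 π x, r)`. -/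
noncomputable def polarPoint (v : ℝ × ℝ) : ℂ :=
  (v.2 : ℂ) * Complex.exp (2 * Real.pi * Complex.I * (v.1 : ℂ))

lemma norm_polarPoint (v : ℝ × ℝ) : ‖polarPoint v‖ = |v.2| := by
  have h : (2 * Real.pi * Complex.I * (v.1 : ℂ)) = ((2 * Real.pi * v.1 : ℝ) : ℂ) * Complex.I := by
    push_cast; ring
  rw [polarPoint, norm_mul, h, Complex.norm_exp_ofReal_mul_I, mul_one, Complex.norm_real,
    Real.norm_eq_abs]

lemma continuous_polarPoint : Continuous polarPoint := by
  unfold polarPoint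
  fun_prop

/-- The radius is the norm, and two angles in the open interval from 0 to one full turn cannot
differ by a nonzero multiple of a turn. -/
lemma polarPoint_inj {v v' : ℝ × ℝ} (hv : 0 < v.1 ∧ v.1 < 1 ∧ 0 < v.2)
    (hv' : 0 < v'.1 ∧ v'.1 < 1 ∧ 0 < v'.2) (h : polarPoint v = polarPoint v') : v = v' := by
  have h2 : v.2 = v'.2 := by
    have := congrArg norm h
    rwa [norm_polarPoint, norm_polarPoint, abs_of_pos hv.2.2, abs_of_pos hv'.2.2] at this
  refine Prod.ext ?_ h2
  rw [polarPoint, polarPoint, h2] at h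
  have h3 := mul_left_cancel₀ (by exact_mod_cast hv'.2.2.ne') h
  obtain ⟨n, hn⟩ := Complex.exp_eq_exp_iff_exists_int.1 h3
  have hpi : (2 * Real.pi * Complex.I : ℂ) ≠ 0 := Complex.two_pi_I_ne_zero
  have h4 : (v.1 : ℂ) = v'.1 + n := by
    apply mul_left_cancel₀ hpi
    linear_combination hn
  have h5 : v.1 = v'.1 + n := by exact_mod_cast h4
  have h6 : n = 0 := by
    have h7 : (-1 : ℝ) < n := by linarith
    have h8 : (n : ℝ) < 1 := by linarith
    have h9 : -1 < n := by exact_mod_cast h7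
    have h10 : n < 1 := by exact_mod_cast h8
    omega
  simpa [h6] using h5

/-- The coordinates of a point of the open unit disc. -/
def discCoord (z : ℂ) : ℝ × ℝ := (z.re, z.im)

/-- The point with given coordinates: polar coordinates outside the disc. -/
noncomputable def chartPoint (v : ℝ × ℝ) : ℂ := if v.2 < 1 then ⟨v.1, v.2⟩ else polarPoint v

lemma chartPoint_discCoord {z : ℂ} (hz : z ∈ Metric.ball (0 : ℂ) 1) :
    chartPoint (discCoord z) = z := by
  have h : z.im < 1 := (Complex.im_le_norm z).trans_lt (by simpa using hz)
  simp [chartPoint, discCoord, h]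

lemma chartPoint_of_le {v : ℝ × ℝ} (h : 1 ≤ v.2) : chartPoint v = polarPoint v := by
  simp [chartPoint, h]

/-- An edge of an outer graph as a drawn edge. -/
noncomputable def outerEdge {β : Type*} (e : (ℝ × ℝ) × (ℝ × ℝ) × ℂ) : DrawnEdge β where
  src := e.1
  tgt := e.2.1
  const := e.2.2
  orig := none
  curve t := polarPoint (AffineMap.lineMap e.1 e.2.1 t)

/-- The inner curves run in the open disc, while the outer graph has radius at least 1, because its
ports have height 1 and its region starts there. Thus inner and outer parts meet only in ports, and
on the outer region polar coordinates are injective. -/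
lemma Tangle.isDrawing {ι β : Type*} {P : List ((ℝ × ℝ) × ι)} {V : Finset (ℝ × ℝ)}
    {L : List ((ℝ × ℝ) × (ℝ × ℝ) × ℂ)} {g : Finset ι → ℂ} (T : Tangle P 1 V L g)
    (hP : ∀ p ∈ P, p.1.2 = 1) {V₀ : Finset ℂ} (hV₀ : ∀ z ∈ V₀, z ∈ Metric.ball (0 : ℂ) 1)
    {A : List (DrawnEdge β)}
    (hends : ∀ d ∈ A, d.src ∈ V₀.image discCoord ∪ V ∧ d.tgt ∈ V₀.image discCoord ∪ V)
    (hcont : ∀ d ∈ A, ContinuousOn d.curve (Set.Icc 0 1))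
    (hcurve : ∀ d ∈ A, d.curve 0 = chartPoint d.src ∧ d.curve 1 = chartPoint d.tgt)
    (hball : ∀ d ∈ A, ∀ t ∈ Set.Ioo (0 : ℝ) 1, d.curve t ∈ Metric.ball (0 : ℂ) 1)
    (hne : ∀ d ∈ A, ∀ z ∈ V₀, ∀ t ∈ Set.Ioo (0 : ℝ) 1, d.curve t ≠ z)
    (hinj : ∀ d ∈ A, Set.InjOn d.curve (Set.Ioo 0 1))
    (hpw : A.Pairwise fun d d' => ∀ t ∈ Set.Ioo (0 : ℝ) 1, ∀ t' ∈ Set.Ioo (0 : ℝ) 1,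
      d.curve t ≠ d'.curve t') :
    IsDrawing chartPoint (V₀.image discCoord ∪ V) (A ++ L.map outerEdge) := by
  have hreg : ∀ v, Region P 1 v → 0 < v.1 ∧ v.1 < 1 ∧ 1 ≤ v.2 := by
    rintro v ⟨h0, h1, h | ⟨p, hp, -, h⟩⟩
    · exact ⟨h0, h1, h.le⟩
    · exact ⟨h0, h1, by rwa [hP p hp] at h⟩
  have hpol : ∀ v, Region P 1 v → ∀ v', Region P 1 v' → polarPoint v = polarPoint v' → v = v' := by
    intro v hv v' hv' h
    have h1 := hreg v hv
    have h2 := hreg v' hv'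
    exact polarPoint_inj ⟨h1.1, h1.2.1, by linarith⟩ ⟨h2.1, h2.2.1, by linarith⟩ h
  have hout : ∀ v, Region P 1 v → polarPoint v ∉ Metric.ball (0 : ℂ) 1 := by
    intro v hv
    have h1 := hreg v hv
    rw [mem_ball_zero_iff, norm_polarPoint, abs_of_pos (by linarith)]
    linarith
  have hseg : ∀ e ∈ L, ∀ t ∈ Set.Ioo (0 : ℝ) 1,
      AffineMap.lineMap e.1 e.2.1 t ∈ openSegment ℝ e.1 e.2.1 := by
    intro e _ t ht
    rw [openSegment_eq_image_lineMap]
    exact ⟨t, ht, rfl⟩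
  have hchart : ∀ v ∈ V, chartPoint v = polarPoint v := fun v hv =>
    chartPoint_of_le (hreg v (T.region_vertex v hv)).2.2
  refine ⟨?_, ?_, ?_, ?_, ?_, ?_, ?_⟩
  · intro v hv v' hv' h
    simp only [Finset.coe_union, Finset.coe_image, Set.mem_union, Set.mem_image,
      Finset.mem_coe] at hv hv'
    rcases hv with ⟨z, hz, rfl⟩ | hv <;> rcases hv' with ⟨z', hz', rfl⟩ | hv'
    · rw [chartPoint_discCoord (hV₀ z hz), chartPoint_discCoord (hV₀ z' hz')] at h
      rw [h]
    · rw [chartPoint_discCoord (hV₀ z hz), hchart v' hv'] at h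
      exact absurd (h ▸ hV₀ z hz) (hout v' (T.region_vertex v' hv'))
    · rw [chartPoint_discCoord (hV₀ z' hz'), hchart v hv] at h
      exact absurd (h ▸ hV₀ z' hz') (hout v (T.region_vertex v hv))
    · rw [hchart v hv, hchart v' hv'] at h
      exact hpol v (T.region_vertex v hv) v' (T.region_vertex v' hv') h
  · intro d hd
    rcases List.mem_append.1 hd with hd | hd
    · exact hends d hd
    · obtain ⟨e, he, rfl⟩ := List.mem_map.1 hd
      have := T.ends_mem e he
      exact ⟨Finset.mem_union_right _ this.1, Finset.mem_union_right _ this.2.1⟩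
  · intro d hd
    rcases List.mem_append.1 hd with hd | hd
    · exact hcont d hd
    · obtain ⟨e, he, rfl⟩ := List.mem_map.1 hd
      exact (continuous_polarPoint.comp AffineMap.lineMap_continuous).continuousOn
  · intro d hd
    rcases List.mem_append.1 hd with hd | hd
    · exact hcurve d hd
    · obtain ⟨e, he, rfl⟩ := List.mem_map.1 hd
      have := T.ends_mem e he
      simp [outerEdge, hchart _ this.1, hchart _ this.2.1]
  · intro d hd v hv t ht
    rcases List.mem_append.1 hd with hd | hd
    · rcases Finset.mem_union.1 hv with hv | hv
      · obtain ⟨z, hz, rfl⟩ := Finset.mem_image.1 hv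
        rw [chartPoint_discCoord (hV₀ z hz)]
        exact hne d hd z hz t ht
      · rw [hchart v hv]
        intro h
        exact hout v (T.region_vertex v hv) (h ▸ hball d hd t ht)
    · obtain ⟨e, he, rfl⟩ := List.mem_map.1 hd
      have h1 := hseg e he t ht
      have h2 := T.region_segment e he _ h1
      rcases Finset.mem_union.1 hv with hv | hv
      · obtain ⟨z, hz, rfl⟩ := Finset.mem_image.1 hv
        rw [chartPoint_discCoord (hV₀ z hz)]
        intro h
        exact hout _ h2 (by rw [show polarPoint _ = z from h]; exact hV₀ z hz)
      · rw [hchart v hv]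
        intro h
        have h3 := hpol _ h2 v (T.region_vertex v hv) h
        exact T.notMem_segment e he v hv (h3 ▸ h1)
  · intro d hd
    rcases List.mem_append.1 hd with hd | hd
    · exact hinj d hd
    · obtain ⟨e, he, rfl⟩ := List.mem_map.1 hd
      intro t ht t' ht' h
      exact AffineMap.lineMap_injective ℝ (T.ends_mem e he).2.2
        (hpol _ (T.region_segment e he _ (hseg e he t ht)) _
          (T.region_segment e he _ (hseg e he t' ht')) h)
  · refine List.pairwise_append.2 ⟨hpw, ?_, ?_⟩
    · rw [List.pairwise_map]
      refine T.pairwise.imp_of_mem fun {e f} he hf hef t ht t' ht' h => ?_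
      have h1 := hseg e he t ht
      have h2 := hseg f hf t' ht'
      have h3 := hpol _ (T.region_segment e he _ h1) _ (T.region_segment f hf _ h2) h
      exact Set.disjoint_left.1 hef h1 (h3 ▸ h2)
    · intro d hd d' hd' t ht t' ht' h
      obtain ⟨e, he, rfl⟩ := List.mem_map.1 hd'
      have h1 := hball d hd t ht
      rw [h] at h1
      exact hout _ (T.region_segment e he _ (hseg e he t' ht')) h1

end Chart

/-! ### The sides of the polygon and the order of the ports -/

section Sides
open Classical

lemma length_sideWord (k c : ℕ) : (sideWord k c).length = 4 * k + 2 * c := by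
  simp [sideWord, List.length_flatMap, mul_comm]

lemma getElem_handles (k j : ℕ) (h : j < 4 * k)
    (h' : j < ((List.range k).flatMap fun i => [(2 * i, false), (2 * i + 1, false), (2 * i, true),
      (2 * i + 1, true)]).length) :
    (((List.range k).flatMap fun i => [(2 * i, false), (2 * i + 1, false), (2 * i, true),
      (2 * i + 1, true)])[j]).1 = 2 * (j / 4) + j % 2 := by
  induction k with
  | zero => omega
  | succ k ih =>
    have hl : ((List.range k).flatMap fun i => [(2 * i, false), (2 * i + 1, false), (2 * i, true),
      (2 * i + 1, true)]).length = 4 * k := by simp [List.length_flatMap, mul_comm]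
    simp only [List.range_succ, List.flatMap_append, List.getElem_append]
    split_ifs with h1
    · exact ih (by omega) h1
    · simp only [hl] at h1 ⊢
      obtain ⟨r, rfl⟩ : ∃ r, j = 4 * k + r := ⟨j - 4 * k, by omega⟩
      have hr : r < 4 := by omega
      simp only [Nat.add_sub_cancel_left, List.flatMap_cons, List.flatMap_nil, List.append_nil]
      interval_cases r <;> simp <;> omega

lemma getElem_crossCaps (m c j : ℕ) (h : j < 2 * c)
    (h' : j < ((List.range c).flatMap fun i => [(m + i, false), (m + i, false)]).length) :
    (((List.range c).flatMap fun i => [(m + i, false), (m + i, false)])[j]).1 = m + j / 2 := by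
  induction c with
  | zero => omega
  | succ c ih =>
    have hl : ((List.range c).flatMap fun i => [(m + i, false), (m + i, false)]).length =
      2 * c := by simp [List.length_flatMap, mul_comm]
    simp only [List.range_succ, List.flatMap_append, List.getElem_append]
    split_ifs with h1
    · exact ih (by omega) h1
    · simp only [hl] at h1 ⊢
      obtain ⟨r, rfl⟩ : ∃ r, j = 2 * c + r := ⟨j - 2 * c, by omega⟩
      have hr : r < 2 := by omega
      simp only [Nat.add_sub_cancel_left, List.flatMap_cons, List.flatMap_nil, List.append_nil]
      interval_cases r <;> simp <;> omega

lemma sideWord_symbol (k c : ℕ) (j : Fin (sideWord k c).length) :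
    ((sideWord k c).get j).1 =
      if (j : ℕ) < 4 * k then 2 * ((j : ℕ) / 4) + (j : ℕ) % 2
      else 2 * k + ((j : ℕ) - 4 * k) / 2 := by
  obtain ⟨j, hj⟩ := j
  have hl : ((List.range k).flatMap fun i => [(2 * i, false), (2 * i + 1, false), (2 * i, true),
      (2 * i + 1, true)]).length = 4 * k := by simp [List.length_flatMap, mul_comm]
  have hj' := hj
  rw [length_sideWord] at hj'
  simp only [List.get_eq_getElem, sideWord, List.getElem_append, hl]
  split_ifs with h1
  · exact getElem_handles k j h1 _
  · exact getElem_crossCaps (2 * k) c (j - 4 * k) (by omega) _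

lemma sideWord_symbol_lt (k c : ℕ) (j : Fin (sideWord k c).length) :
    ((sideWord k c).get j).1 < 2 * k + c := by
  have hj := j.2.trans_eq (length_sideWord k c)
  rw [sideWord_symbol]
  split_ifs <;> omega

/-- No symbol labels more than two sides. Hence a gluing point determines both of its positions on
the boundary. -/
lemma sideWord_symbol_unique (k c : ℕ) {i j l : Fin (sideWord k c).length} (hij : i ≠ j)
    (h : ((sideWord k c).get i).1 = ((sideWord k c).get j).1)
    (h' : ((sideWord k c).get l).1 = ((sideWord k c).get i).1) : l = i ∨ l = j := by
  have hi := i.2.trans_eq (length_sideWord k c)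
  have hj := j.2.trans_eq (length_sideWord k c)
  have hl := l.2.trans_eq (length_sideWord k c)
  rw [Ne, Fin.ext_iff] at hij
  rw [Fin.ext_iff, Fin.ext_iff]
  rw [sideWord_symbol, sideWord_symbol] at h h'
  split_ifs at h h' <;> omega

/-- The parameter along a side, oriented according to its letter, of the point that has the
parameter `t` along the symbol of the side. -/
def orientParam (b : Bool) (t : ℝ) : ℝ := if b then 1 - t else t

lemma orientParam_mem {b : Bool} {t : ℝ} (ht : t ∈ Set.Ioo (0 : ℝ) 1) :
    orientParam b t ∈ Set.Ioo (0 : ℝ) 1 := by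
  unfold orientParam
  split_ifs
  · exact ⟨by linarith [ht.2], by linarith [ht.1]⟩
  · exact ht

/-- The coordinates of the point with parameter `t` along the symbol of side `j` of the polygon. -/
noncomputable def sideCoord (W : SideWord) (j : Fin W.length) (t : ℝ) : ℝ × ℝ :=
  (((j : ℕ) + orientParam (W.get j).2 t) / W.length, 1)

lemma sideCoord_lt {W : SideWord} {i j : Fin W.length} (hij : i < j) {t t' : ℝ}
    (ht : t ∈ Set.Ioo (0 : ℝ) 1) (ht' : t' ∈ Set.Ioo (0 : ℝ) 1) :
    (sideCoord W i t).1 < (sideCoord W j t').1 := by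
  have h1 := (orientParam_mem (b := (W.get i).2) ht).2
  have h2 := (orientParam_mem (b := (W.get j).2) ht').1
  have h3 : ((i : ℕ) : ℝ) + 1 ≤ (j : ℕ) := by exact_mod_cast hij
  have hn : (0 : ℝ) < W.length := by exact_mod_cast i.pos
  exact div_lt_div_of_pos_right (by linarith) hn

lemma sideCoord_inj {W : SideWord} {i j : Fin W.length} {t t' : ℝ}
    (ht : t ∈ Set.Ioo (0 : ℝ) 1) (ht' : t' ∈ Set.Ioo (0 : ℝ) 1)
    (h : sideCoord W i t = sideCoord W j t') : i = j ∧ t = t' := by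
  have h1 : (sideCoord W i t).1 = (sideCoord W j t').1 := by rw [h]
  rcases lt_trichotomy i j with hlt | rfl | hlt
  · exact absurd h1 (sideCoord_lt hlt ht ht').ne
  · refine ⟨rfl, ?_⟩
    have hn : (W.length : ℝ) ≠ 0 := by exact_mod_cast i.pos.ne'
    have h2 := (div_left_inj' hn).1 h1
    unfold orientParam at h2
    split_ifs at h2 <;> linarith
  · exact absurd h1.symm (sideCoord_lt hlt ht' ht).ne

lemma sideCoord_mem {W : SideWord} {j : Fin W.length} {t : ℝ} (ht : t ∈ Set.Ioo (0 : ℝ) 1) :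
    0 < (sideCoord W j t).1 ∧ (sideCoord W j t).1 < 1 := by
  have h1 := orientParam_mem (b := (W.get j).2) ht
  have hn : (0 : ℝ) < W.length := by exact_mod_cast j.pos
  have h3 : ((j : ℕ) : ℝ) + 1 ≤ W.length := by exact_mod_cast j.2
  have h4 : (0 : ℝ) ≤ (j : ℕ) := by positivity
  exact ⟨div_pos (by linarith [h1.1]) hn, (div_lt_one hn).2 (by linarith [h1.2])⟩

lemma chartPoint_sideCoord (W : SideWord) (j : Fin W.length) (t : ℝ) :
    chartPoint (sideCoord W j t) = sidePoint W.length j (orientParam (W.get j).2 t) := by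
  rw [chartPoint_of_le (by simp [sideCoord])]
  simp [polarPoint, sideCoord, sidePoint]

/-- With the parameter taken along the symbol instead of counterclockwise, glued points have equal
parameters for both kinds of gluing. -/
lemma Glued.exists_param {W : SideWord} {p q : ℂ} (h : Glued W p q) :
    ∃ (j j' : Fin W.length) (t : ℝ), j ≠ j' ∧ (W.get j).1 = (W.get j').1 ∧ t ∈ Set.Ioo (0 : ℝ) 1 ∧
      p = chartPoint (sideCoord W j t) ∧ q = chartPoint (sideCoord W j' t) := by
  obtain ⟨j, j', hj, hs, t, ht, hp, hq⟩ := h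
  refine ⟨j, j', orientParam (W.get j).2 t, hj, hs, orientParam_mem ht, ?_, ?_⟩
  · rw [chartPoint_sideCoord, hp]
    congr 1
    unfold orientParam
    split_ifs <;> ring
  · rw [chartPoint_sideCoord, hq]
    congr 1
    unfold orientParam
    cases (W.get j).2 <;> cases (W.get j').2 <;> simp

variable {ι : Type*}

/-- The connections in `cl` with symbol `s`, in the order of their parameters `τ`. -/
noncomputable def sortedLabels (cl : List ι) (sym : ι → ℕ) (τ : ι → ℝ) (s : ℕ) : List ι :=
  (cl.filter fun l => sym l = s).insertionSort fun l l' => τ l ≤ τ l'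

lemma mem_sortedLabels {cl : List ι} {sym : ι → ℕ} {τ : ι → ℝ} {s : ℕ} {l : ι} :
    l ∈ sortedLabels cl sym τ s ↔ l ∈ cl ∧ sym l = s := by
  simp [sortedLabels]

lemma nodup_sortedLabels {cl : List ι} (hcl : cl.Nodup) (sym : ι → ℕ) (τ : ι → ℝ) (s : ℕ) :
    (sortedLabels cl sym τ s).Nodup :=
  (List.perm_insertionSort _ _).nodup_iff.2 (hcl.filter _)

lemma pairwise_sortedLabels {cl : List ι} (hcl : cl.Nodup) {sym : ι → ℕ} {τ : ι → ℝ}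
    (hτ : ∀ l ∈ cl, ∀ l' ∈ cl, sym l = sym l' → τ l = τ l' → l = l') (s : ℕ) :
    (sortedLabels cl sym τ s).Pairwise fun l l' => τ l < τ l' := by
  have h1 : (sortedLabels cl sym τ s).Pairwise fun l l' => τ l ≤ τ l' :=
    haveI : Std.Total fun l l' : ι => τ l ≤ τ l' := ⟨fun a b => le_total _ _⟩
    haveI : IsTrans ι fun l l' : ι => τ l ≤ τ l' := ⟨fun a b c => le_trans⟩
    List.pairwise_insertionSort _ _
  have h2 : (sortedLabels cl sym τ s).Pairwise fun l l' => l ≠ l' := nodup_sortedLabels hcl sym τ s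
  refine (h1.and h2).imp_of_mem fun {l l'} hl hl' h => lt_of_le_of_ne h.1 fun e => h.2 ?_
  rw [mem_sortedLabels] at hl hl'
  exact hτ l hl.1 l' hl'.1 (hl.2.trans hl'.2.symm) e

lemma sum_length_sortedLabels {cl : List ι} {sym : ι → ℕ} (τ : ι → ℝ) {m : ℕ}
    (h : ∀ l ∈ cl, sym l < m) :
    ∑ s ∈ Finset.range m, (sortedLabels cl sym τ s).length = cl.length := by
  simp only [sortedLabels, List.length_insertionSort]
  induction cl with
  | nil => simp
  | cons l cl ih =>
    have hl := h l (by simp)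
    rw [List.length_cons, ← ih fun l hl => h l (by simp [hl])]
    simp only [List.filter_cons, decide_eq_true_eq]
    have : ∀ s, (if sym l = s then l :: cl.filter fun l => sym l = s
        else cl.filter fun l => sym l = s).length =
          (cl.filter fun l => sym l = s).length + if s = sym l then 1 else 0 := by
      intro s
      by_cases hs : sym l = s
      · simp [hs]
      · simp [hs, Ne.symm hs]
    simp only [this, Finset.sum_add_distrib, Finset.sum_ite_eq', Finset.mem_range, hl, if_true]

/-- The ports along the sides of the polygon, in counterclockwise order. -/
noncomputable def portList (W : SideWord) (lab : ℕ → List ι) (τ : ι → ℝ) : List ((ℝ × ℝ) × ι) :=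
  (List.finRange W.length).flatMap fun j =>
    (if (W.get j).2 then (lab (W.get j).1).reverse else lab (W.get j).1).map fun l =>
      (sideCoord W j (τ l), l)

lemma mem_portList {W : SideWord} {lab : ℕ → List ι} {τ : ι → ℝ} {p : (ℝ × ℝ) × ι} :
    p ∈ portList W lab τ ↔ ∃ j, p.2 ∈ lab (W.get j).1 ∧ p.1 = sideCoord W j (τ p.2) := by
  simp only [portList, List.mem_flatMap, List.mem_finRange, true_and, List.mem_map]
  refine exists_congr fun j => ?_
  constructor
  · rintro ⟨l, hl, rfl⟩
    refine ⟨?_, rfl⟩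
    split_ifs at hl
    exacts [List.mem_reverse.1 hl, hl]
  · rintro ⟨h1, h2⟩
    refine ⟨p.2, ?_, Prod.ext h2.symm rfl⟩
    split_ifs
    exacts [List.mem_reverse.2 h1, h1]

lemma map_snd_portList (W : SideWord) (lab : ℕ → List ι) (τ : ι → ℝ) :
    (portList W lab τ).map Prod.snd = labelWord lab W := by
  have h : labelWord lab W = labelWord lab ((List.finRange W.length).map W.get) := by
    rw [List.map_get_finRange]
  rw [h, labelWord, List.flatMap_map, portList, List.map_flatMap]
  simp [List.map_map, Function.comp_def]

lemma pairwise_portList {W : SideWord} {lab : ℕ → List ι} {τ : ι → ℝ}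
    (hτ : ∀ s, ∀ l ∈ lab s, τ l ∈ Set.Ioo (0 : ℝ) 1)
    (hlab : ∀ s, (lab s).Pairwise fun l l' => τ l < τ l') :
    (portList W lab τ).Pairwise fun p q => p.1.1 < q.1.1 := by
  rw [portList, List.pairwise_flatMap]
  constructor
  · intro j _
    have hn : (0 : ℝ) < W.length := by exact_mod_cast j.pos
    rw [List.pairwise_map]
    cases hb : (W.get j).2
    · simp only [Bool.false_eq_true, if_false]
      refine (hlab _).imp fun {l l'} h => ?_
      simp only [sideCoord, hb, orientParam]
      exact div_lt_div_of_pos_right (by simpa using h) hn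
    · simp only [if_true]
      rw [List.pairwise_reverse]
      refine (hlab _).imp fun {l l'} h => ?_
      simp only [sideCoord, hb, orientParam]
      exact div_lt_div_of_pos_right (by simpa using h) hn
  · refine (List.pairwise_lt_finRange _).imp fun {i j} hij p hp q hq => ?_
    have key : ∀ (i : Fin W.length) (p : (ℝ × ℝ) × ι),
        p ∈ (if (W.get i).2 then (lab (W.get i).1).reverse else lab (W.get i).1).map (fun l =>
          (sideCoord W i (τ l), l)) → ∃ t ∈ Set.Ioo (0 : ℝ) 1, p.1 = sideCoord W i t := by
      intro i p hp
      obtain ⟨l, hl, rfl⟩ := List.mem_map.1 hp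
      refine ⟨τ l, hτ (W.get i).1 l ?_, rfl⟩
      split_ifs at hl
      exacts [List.mem_reverse.1 hl, hl]
    obtain ⟨t, ht, h1⟩ := key i p hp
    obtain ⟨t', ht', h2⟩ := key j q hq
    rw [h1, h2]
    exact sideCoord_lt hij ht ht'

end Sides

/-! ### Attaching the outer graph to a graph cut along the boundary -/

section Cut
open Classical
variable {ι β : Type*}

/-- A graph that is drawn in the open disc, up to edges that end in ports on the boundary of the
polygon with side word `W`; the ports along a side of symbol `s` are labelled by `lab s`. -/
structure PolygonCut (W : SideWord) (lab : ℕ → List ι) (P : List ((ℝ × ℝ) × ι)) (V₀ : Finset ℂ)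
    (A : List (DrawnEdge β)) : Prop where
  lab_nodup : ∀ s, (lab s).Nodup
  lab_disjoint : ∀ s t l, l ∈ lab s → l ∈ lab t → s = t
  map_snd : P.map Prod.snd = labelWord lab W
  ports_pairwise : P.Pairwise fun p q => p.1.1 < q.1.1
  ports_mem : ∀ p ∈ P, 0 < p.1.1 ∧ p.1.1 < 1
  ports_height : ∀ p ∈ P, p.1.2 = 1
  mem_ball : ∀ z ∈ V₀, z ∈ Metric.ball (0 : ℂ) 1
  ends : ∀ d ∈ A, (d.src ∈ V₀.image discCoord ∨ ∃ p ∈ P, p.1 = d.src) ∧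
    (d.tgt ∈ V₀.image discCoord ∨ ∃ p ∈ P, p.1 = d.tgt)
  continuousOn : ∀ d ∈ A, ContinuousOn d.curve (Set.Icc 0 1)
  curve_ends : ∀ d ∈ A, d.curve 0 = chartPoint d.src ∧ d.curve 1 = chartPoint d.tgt
  curve_mem : ∀ d ∈ A, ∀ t ∈ Set.Ioo (0 : ℝ) 1, d.curve t ∈ Metric.ball (0 : ℂ) 1
  curve_ne : ∀ d ∈ A, ∀ z ∈ V₀, ∀ t ∈ Set.Ioo (0 : ℝ) 1, d.curve t ≠ z
  curve_injOn : ∀ d ∈ A, Set.InjOn d.curve (Set.Ioo 0 1)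
  pairwise : A.Pairwise fun d d' => ∀ t ∈ Set.Ioo (0 : ℝ) 1, ∀ t' ∈ Set.Ioo (0 : ℝ) 1,
    d.curve t ≠ d'.curve t'
  const_eq : ∀ d ∈ A, d.const = 1
  orig_pairwise : A.Pairwise fun d d' => d.orig = d'.orig → d.orig = none

/-- The planar graph is the union of the pieces in the disc with the outer graph of
`solvable_sideWord`, drawn from height 1 upwards. The signature of the outer graph evaluates its
matchings. -/
lemma PolygonCut.exists_graph {k c : ℕ} {lab : ℕ → List ι} {P : List ((ℝ × ℝ) × ι)}
    {V₀ : Finset ℂ} {A : List (DrawnEdge β)} (K : PolygonCut (sideWord k c) lab P V₀ A) {u : ℕ → ℂ}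
    (hu : ∀ s, u s ∈ unitConstants) :
    ∃ (H : Graph ℕ ℕ) (v : ℕ → ℂ) (o : ℕ → Option β), H.vertexSet.Finite ∧ H.edgeSet.Finite ∧
      IsPlanarGraph H ∧ H.vertexSet.ncard + H.edgeSet.ncard ≤
        V₀.card + A.length + 15 * (∑ s ∈ Finset.range (2 * k + c), (lab s).length) ^ 2 ∧
      (∀ f ∈ H.edgeSet, v f ∈ unitConstants) ∧
      (∀ f ∈ H.edgeSet, ∀ e, o f = some e → ∃ d ∈ A, d.orig = some e) ∧
      (∀ e, (∃ d ∈ A, d.orig = some e) → ∃! f, f ∈ H.edgeSet ∧ o f = some e) ∧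
      ∀ w : β → ℂ, PerfMatch H (fun f => v f * (o f).elim 1 w) =
        ∑ Z ∈ (portLabels P).powerset, ((∏ i ∈ Finset.range k, handleSign lab u Z i) *
          ∏ j ∈ Finset.range c, capSign lab u Z (2 * k + j)) *
            pm (A.map (DrawnEdge.eval w)) (V₀.image discCoord ∪ portPts P Z) := by
  obtain ⟨V, L, T, hcard⟩ := solvable_sideWord hu K.lab_nodup K.lab_disjoint k c P K.map_snd
    K.ports_pairwise K.ports_mem 1 fun p hp => (K.ports_height p hp).le
  have hpV : ∀ v : ℝ × ℝ, (v ∈ V₀.image discCoord ∨ ∃ p ∈ P, p.1 = v) →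
      v ∈ V₀.image discCoord ∪ V := by
    rintro v (h | ⟨p, hp, rfl⟩)
    exacts [Finset.mem_union_left _ h, Finset.mem_union_right _ (T.ports_mem p hp)]
  -- Vertices in the disc have second coordinate less than 1 and outer vertices at least 1, so the
  -- two kinds of coordinates do not clash.
  have hout : ∀ v ∈ V, v ∉ V₀.image discCoord := by
    intro v hv h
    obtain ⟨z, hz, rfl⟩ := Finset.mem_image.1 h
    have h1 : z.im < 1 := (Complex.im_le_norm z).trans_lt (by simpa using K.mem_ball z hz)
    obtain ⟨-, -, h2 | ⟨p, hp, -, h2⟩⟩ := T.region_vertex _ hv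
    · exact absurd h2 h1.le.not_gt
    · rw [K.ports_height p hp] at h2
      exact absurd h2 h1.not_ge
  have hD := T.isDrawing K.ports_height K.mem_ball
    (fun d hd => ⟨hpV _ (K.ends d hd).1, hpV _ (K.ends d hd).2⟩) K.continuousOn K.curve_ends
    K.curve_mem K.curve_ne K.curve_injOn K.pairwise
  have hnone : ∀ e : (ℝ × ℝ) × (ℝ × ℝ) × ℂ, (outerEdge e : DrawnEdge β).orig = none := fun e => rfl
  have hor : (A ++ L.map outerEdge).Pairwise fun (d d' : DrawnEdge β) =>
      d.orig = d'.orig → d.orig = none := by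
    refine List.pairwise_append.2 ⟨K.orig_pairwise, ?_, ?_⟩
    · rw [List.pairwise_map]
      exact List.pairwise_of_forall fun e f _ => hnone e
    · intro d hd d' hd' h
      obtain ⟨e, he, rfl⟩ := List.mem_map.1 hd'
      exact h
  obtain ⟨H, v, o, h1, h2, h3, h4, h5, h6, h7, h8⟩ := hD.exists_graph hor
  refine ⟨H, v, o, h1, h2, h3, ?_, ?_, ?_, ?_, ?_⟩
  · rw [h4, h5, List.length_append, List.length_map]
    have := Finset.card_union_le (V₀.image discCoord) V
    have := Finset.card_image_le (s := V₀) (f := discCoord)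
    omega
  · intro f hf
    obtain ⟨d, hd, hv, -⟩ := h6 f hf
    rw [hv]
    rcases List.mem_append.1 hd with hd | hd
    · rw [K.const_eq d hd]
      simp [unitConstants]
    · obtain ⟨e, he, rfl⟩ := List.mem_map.1 hd
      exact T.weight_mem e he
  · intro f hf e he
    obtain ⟨d, hd, -, ho⟩ := h6 f hf
    rcases List.mem_append.1 hd with hd | hd
    · exact ⟨d, hd, ho.symm.trans he⟩
    · obtain ⟨e', he', rfl⟩ := List.mem_map.1 hd
      rw [ho, hnone] at he
      cases he
  · rintro e ⟨d, hd, he⟩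
    exact h7 e ⟨d, List.mem_append_left _ hd, he⟩
  · intro w
    have heval : (L.map outerEdge).map (DrawnEdge.eval w) = L := by
      rw [List.map_map]
      exact List.map_id'' (fun e => by simp [DrawnEdge.eval, outerEdge]) L
    rw [h8, List.map_append, heval, pm_perm List.perm_append_comm, T.signature]
    · intro v hv hvP e he
      obtain ⟨d, hd, rfl⟩ := List.mem_map.1 he
      have key : ∀ x : ℝ × ℝ, (x ∈ V₀.image discCoord ∨ ∃ p ∈ P, p.1 = x) → x ≠ v := by
        rintro x (h | ⟨p, hp, rfl⟩) rfl
        exacts [hout _ hv h, hvP p hp rfl]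
      exact ⟨key _ (K.ends d hd).1, key _ (K.ends d hd).2⟩
    · exact Finset.disjoint_right.2 hout

end Cut

/-! ### Pieces and passages of a plane model -/

section Model
open Classical
variable {α β : Type*} {G : Graph α β}

/-- The passages of the edges in `es` through the boundary of the polygon. -/
def passages (n : β → ℕ) (es : List β) : List (β × ℕ) :=
  es.flatMap fun e => (List.range (n e)).map fun i => (e, i)

lemma mem_passages {n : β → ℕ} {es : List β} {l : β × ℕ} :
    l ∈ passages n es ↔ l.1 ∈ es ∧ l.2 < n l.1 := by
  obtain ⟨e, i⟩ := l
  simp [passages]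

lemma nodup_passages {es : List β} (n : β → ℕ) (hes : es.Nodup) : (passages n es).Nodup := by
  rw [passages, List.nodup_flatMap]
  refine ⟨fun e _ => List.nodup_range.map fun i j h => (Prod.mk.inj h).2, hes.imp ?_⟩
  rintro e f hef l h h'
  obtain ⟨i, -, rfl⟩ := List.mem_map.1 h
  obtain ⟨j, -, h⟩ := List.mem_map.1 h'
  exact hef (Prod.mk.inj h).1.symm

lemma length_passages (n : β → ℕ) (es : List β) : (passages n es).length = (es.map n).sum := by
  simp [passages, List.length_flatMap]

/-- The piece number `i` of the edge `e`, where `a` and `b` are the coordinates of the exits and of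
the entrances. -/
def PlaneModel.piece {W : SideWord} (D : PlaneModel W G) (a b : β × ℕ → ℝ × ℝ) (e : β) (i : ℕ) :
    DrawnEdge β where
  src := if i = 0 then discCoord (D.arc e 0 0) else b (e, i - 1)
  tgt := if i = D.crossings e then discCoord (D.arc e (D.crossings e) 1) else a (e, i)
  const := 1
  orig := if i = 0 then some e else none
  curve := D.arc e i

/-- The pieces of the edges in `es`. -/
def PlaneModel.pieces {W : SideWord} (D : PlaneModel W G) (a b : β × ℕ → ℝ × ℝ) (es : List β) :
    List (DrawnEdge β) :=
  es.flatMap fun e => (List.range (D.crossings e + 1)).map (D.piece a b e)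

lemma PlaneModel.mem_pieces {W : SideWord} (D : PlaneModel W G) {a b : β × ℕ → ℝ × ℝ} {es : List β}
    {d : DrawnEdge β} :
    d ∈ D.pieces a b es ↔ ∃ e ∈ es, ∃ i ≤ D.crossings e, d = D.piece a b e i := by
  simp [PlaneModel.pieces, eq_comm]

lemma PlaneModel.length_pieces {W : SideWord} (D : PlaneModel W G) (a b : β × ℕ → ℝ × ℝ)
    (es : List β) : (D.pieces a b es).length = es.length + (es.map D.crossings).sum := by
  induction es with
  | nil => rfl
  | cons e es ih =>
    rw [PlaneModel.pieces, List.flatMap_cons, List.length_append, ← PlaneModel.pieces, ih]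
    simp
    omega

lemma PlaneModel.pairwise_pieces {W : SideWord} (D : PlaneModel W G) {a b : β × ℕ → ℝ × ℝ}
    {es : List β} (hes : es.Nodup) {R : DrawnEdge β → DrawnEdge β → Prop}
    (hR : ∀ e ∈ es, ∀ i ≤ D.crossings e, ∀ e' ∈ es, ∀ i' ≤ D.crossings e', (e ≠ e' ∨ i < i') →
      R (D.piece a b e i) (D.piece a b e' i')) : (D.pieces a b es).Pairwise R := by
  rw [PlaneModel.pieces, List.pairwise_flatMap]
  constructor
  · intro e he
    rw [List.pairwise_map]
    refine List.pairwise_lt_range.imp_of_mem fun {i j} hi hj hij => ?_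
    rw [List.mem_range] at hi hj
    exact hR e he i (by omega) e he j (by omega) (Or.inr hij)
  · refine hes.imp_of_mem fun {e f} he hf hef d hd d' hd' => ?_
    obtain ⟨i, hi, rfl⟩ := List.mem_map.1 hd
    obtain ⟨j, hj, rfl⟩ := List.mem_map.1 hd'
    rw [List.mem_range] at hi hj
    exact hR e he i (by omega) f hf j (by omega) (Or.inl hef)

lemma PlaneModel.map_eval_pieces {W : SideWord} (D : PlaneModel W G) (a b : β × ℕ → ℝ × ℝ)
    (es : List β) (w : β → ℂ) :
    (D.pieces a b es).map (DrawnEdge.eval w) = es.flatMap fun e =>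
      pathPieces (discCoord (D.arc e 0 0)) (discCoord (D.arc e (D.crossings e) 1))
        (fun i => a (e, i)) (fun i => b (e, i)) (w e) (D.crossings e) := by
  rw [PlaneModel.pieces, List.map_flatMap]
  congr 1
  funext e
  rw [List.map_map, pathPieces]
  refine List.map_congr_left fun i _ => ?_
  simp only [Function.comp, DrawnEdge.eval, PlaneModel.piece, one_mul]
  split_ifs <;> rfl

/-- The passages `cl` of edges through the boundary of the polygon take place from the points with
the coordinates `a` to the points with the coordinates `b`, which have the parameter `τ` along the
sides of symbol `sym`. -/
structure IsPassage {ι : Type*} (W : SideWord) (cl : List ι) (a b : ι → ℝ × ℝ) (sym : ι → ℕ)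
    (τ : ι → ℝ) : Prop where
  exists_sides : ∀ l ∈ cl, ∃ j j' : Fin W.length, j ≠ j' ∧ (W.get j).1 = sym l ∧
    (W.get j').1 = sym l ∧ τ l ∈ Set.Ioo (0 : ℝ) 1 ∧ a l = sideCoord W j (τ l) ∧
      b l = sideCoord W j' (τ l)
  inj : ∀ l ∈ cl, ∀ l' ∈ cl, a l = a l' → l = l'
  ne : ∀ l ∈ cl, ∀ l' ∈ cl, a l ≠ b l'

namespace IsPassage
variable {ι : Type*} {k c : ℕ} {cl : List ι} {a b : ι → ℝ × ℝ} {sym : ι → ℕ} {τ : ι → ℝ}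

lemma mem_Ioo (K : IsPassage (sideWord k c) cl a b sym τ) :
    ∀ l ∈ cl, τ l ∈ Set.Ioo (0 : ℝ) 1 := fun l hl => by
  obtain ⟨j, j', -, -, -, h, -⟩ := K.exists_sides l hl
  exact h

lemma height (K : IsPassage (sideWord k c) cl a b sym τ) :
    ∀ l ∈ cl, (a l).2 = 1 ∧ (b l).2 = 1 := fun l hl => by
  obtain ⟨j, j', -, -, -, -, h, h'⟩ := K.exists_sides l hl
  rw [h, h']
  exact ⟨rfl, rfl⟩

lemma sym_lt (K : IsPassage (sideWord k c) cl a b sym τ) :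
    ∀ l ∈ cl, sym l < 2 * k + c := fun l hl => by
  obtain ⟨j, j', -, h, -⟩ := K.exists_sides l hl
  rw [← h]
  exact sideWord_symbol_lt k c j

lemma eq_sideCoord (K : IsPassage (sideWord k c) cl a b sym τ) {l : ι} (hl : l ∈ cl)
    {j : Fin (sideWord k c).length} (hj : ((sideWord k c).get j).1 = sym l) :
    sideCoord _ j (τ l) = a l ∨ sideCoord _ j (τ l) = b l := by
  obtain ⟨i, i', hne, h, h', -, ha, hb⟩ := K.exists_sides l hl
  rcases sideWord_symbol_unique k c hne (h.trans h'.symm) (hj.trans h.symm) with rfl | rfl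
  exacts [Or.inl ha.symm, Or.inr hb.symm]

/-- Equal symbols and parameters mean the same point of the surface. The exit of `l` is then the
exit or the entrance of `l'`; the latter is excluded, and exits are distinct. -/
lemma inj_param (K : IsPassage (sideWord k c) cl a b sym τ) :
    ∀ l ∈ cl, ∀ l' ∈ cl, sym l = sym l' → τ l = τ l' → l = l' := by
  intro l hl l' hl' hs ht
  obtain ⟨i, i', hne, h, h', -, ha, hb⟩ := K.exists_sides l hl
  rcases K.eq_sideCoord hl' (h.trans hs) with h1 | h1
  · exact K.inj l hl l' hl' (by rw [← h1, ← ht, ha])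
  · exact absurd (by rw [← h1, ← ht, ha]) (K.ne l hl l' hl')

/-- A plane model only requires that exits differ from exits and from entrances. That entrances are
distinct follows, since an entrance determines the symbol and the parameter. -/
lemma inj_right (K : IsPassage (sideWord k c) cl a b sym τ) :
    ∀ l ∈ cl, ∀ l' ∈ cl, b l = b l' → l = l' := by
  intro l hl l' hl' h
  obtain ⟨i, i', -, -, h1, ht, -, hb⟩ := K.exists_sides l hl
  obtain ⟨j, j', -, -, h2, ht', -, hb'⟩ := K.exists_sides l' hl'
  rw [hb, hb'] at h
  obtain ⟨h3, h4⟩ := sideCoord_inj ht ht' h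
  exact K.inj_param l hl l' hl' (by rw [← h1, ← h2, h3]) h4

lemma mem_ports (K : IsPassage (sideWord k c) cl a b sym τ) {p : (ℝ × ℝ) × ι} :
    p ∈ portList (sideWord k c) (sortedLabels cl sym τ) τ ↔
      p.2 ∈ cl ∧ (p.1 = a p.2 ∨ p.1 = b p.2) := by
  rw [mem_portList]
  constructor
  · rintro ⟨j, hj, hp⟩
    rw [mem_sortedLabels] at hj
    rw [hp]
    exact ⟨hj.1, K.eq_sideCoord hj.1 hj.2.symm⟩
  · rintro ⟨hl, h⟩
    obtain ⟨j, j', -, hj, hj', -, ha, hb⟩ := K.exists_sides p.2 hl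
    rcases h with h | h
    · exact ⟨j, mem_sortedLabels.2 ⟨hl, hj.symm⟩, h.trans ha⟩
    · exact ⟨j', mem_sortedLabels.2 ⟨hl, hj'.symm⟩, h.trans hb⟩

lemma portLabels_eq [DecidableEq ι] (K : IsPassage (sideWord k c) cl a b sym τ) :
    portLabels (portList (sideWord k c) (sortedLabels cl sym τ) τ) = cl.toFinset := by
  ext l
  simp only [portLabels, List.mem_toFinset, List.mem_map]
  constructor
  · rintro ⟨p, hp, rfl⟩
    exact (K.mem_ports.1 hp).1
  · intro hl
    exact ⟨(a l, l), K.mem_ports.2 ⟨hl, Or.inl rfl⟩, rfl⟩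

lemma portPts_eq [DecidableEq ι] (K : IsPassage (sideWord k c) cl a b sym τ)
    {Z : Finset ι} (hZ : Z ⊆ cl.toFinset) :
    portPts (portList (sideWord k c) (sortedLabels cl sym τ) τ) Z = connPts a b Z := by
  ext v
  rw [mem_portPts, mem_connPts]
  constructor
  · rintro ⟨p, hp, hpZ, rfl⟩
    exact ⟨p.2, hpZ, (K.mem_ports.1 hp).2⟩
  · rintro ⟨l, hl, h⟩
    exact ⟨(v, l), K.mem_ports.2 ⟨List.mem_toFinset.1 (hZ hl), h⟩, hl, rfl⟩

end IsPassage

end Model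

/-! ### The cut graph of a plane model and the theorem -/

section Model
open Classical
variable {α β : Type*} {G : Graph α β}

lemma IsPassage.polygonCut {k c : ℕ} {D : PlaneModel (sideWord k c) G} (hV : G.vertexSet.Finite)
    {es : List β} (hes : es.Nodup) (hmem : ∀ e, e ∈ es ↔ e ∈ G.edgeSet) {a b : β × ℕ → ℝ × ℝ}
    {sym : β × ℕ → ℕ} {τ : β × ℕ → ℝ}
    (K : IsPassage (sideWord k c) (passages D.crossings es) a b sym τ)
    (hexit : ∀ l ∈ passages D.crossings es, D.arc l.1 l.2 1 = chartPoint (a l))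
    (hentr : ∀ l ∈ passages D.crossings es, D.arc l.1 (l.2 + 1) 0 = chartPoint (b l)) :
    PolygonCut (sideWord k c) (sortedLabels (passages D.crossings es) sym τ)
      (portList (sideWord k c) (sortedLabels (passages D.crossings es) sym τ) τ)
      (hV.toFinset.image D.pos) (D.pieces a b es) := by
  have hcl := nodup_passages D.crossings hes
  have hends : ∀ e ∈ es, D.arc e 0 0 ∈ hV.toFinset.image D.pos ∧
      D.arc e (D.crossings e) 1 ∈ hV.toFinset.image D.pos := by
    intro e he
    obtain ⟨x, y, hxy⟩ := G.exists_isLink_of_mem_edgeSet ((hmem e).1 he)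
    have hx := Finset.mem_image_of_mem D.pos (hV.mem_toFinset.2 hxy.left_mem)
    have hy := Finset.mem_image_of_mem D.pos (hV.mem_toFinset.2 hxy.right_mem)
    rcases D.arc_ends e x y hxy with ⟨h, h'⟩ | ⟨h, h'⟩ <;> rw [h, h']
    exacts [⟨hx, hy⟩, ⟨hy, hx⟩]
  have hball : ∀ z ∈ hV.toFinset.image D.pos, z ∈ Metric.ball (0 : ℂ) 1 := by
    intro z hz
    obtain ⟨v, hv, rfl⟩ := Finset.mem_image.1 hz
    exact D.pos_mem v (hV.mem_toFinset.1 hv)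
  have hexi : ∀ e ∈ es, ∀ i ≤ D.crossings e, i ≠ D.crossings e →
      (e, i) ∈ passages D.crossings es := fun e he i hi hne =>
    mem_passages.2 ⟨he, lt_of_le_of_ne hi hne⟩
  have hent : ∀ e ∈ es, ∀ i ≤ D.crossings e, i ≠ 0 → (e, i - 1) ∈ passages D.crossings es :=
    fun e he i hi hne => mem_passages.2 ⟨he, by dsimp only; omega⟩
  constructor
  · exact nodup_sortedLabels hcl sym τ
  · intro s t l hs ht
    rw [mem_sortedLabels] at hs ht
    exact hs.2.symm.trans ht.2
  · exact map_snd_portList _ _ _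
  · exact pairwise_portList (fun s l hl => K.mem_Ioo l (mem_sortedLabels.1 hl).1)
      (pairwise_sortedLabels hcl K.inj_param)
  · intro p hp
    obtain ⟨j, hj, h⟩ := mem_portList.1 hp
    rw [h]
    exact sideCoord_mem (K.mem_Ioo _ (mem_sortedLabels.1 hj).1)
  · intro p hp
    obtain ⟨j, hj, h⟩ := mem_portList.1 hp
    rw [h]
    rfl
  · exact hball
  · intro d hd
    obtain ⟨e, he, i, hi, rfl⟩ := D.mem_pieces.1 hd
    simp only [PlaneModel.piece]
    constructor
    · split_ifs with h
      · exact Or.inl (Finset.mem_image_of_mem _ (hends e he).1)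
      · exact Or.inr ⟨(b (e, i - 1), (e, i - 1)), K.mem_ports.2 ⟨hent e he i hi h, Or.inr rfl⟩, rfl⟩
    · split_ifs with h
      · exact Or.inl (Finset.mem_image_of_mem _ (hends e he).2)
      · exact Or.inr ⟨(a (e, i), (e, i)), K.mem_ports.2 ⟨hexi e he i hi h, Or.inl rfl⟩, rfl⟩
  · intro d hd
    obtain ⟨e, he, i, hi, rfl⟩ := D.mem_pieces.1 hd
    exact D.arc_continuousOn e ((hmem e).1 he) i hi
  · intro d hd
    obtain ⟨e, he, i, hi, rfl⟩ := D.mem_pieces.1 hd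
    simp only [PlaneModel.piece]
    constructor
    · split_ifs with h
      · rw [chartPoint_discCoord (hball _ (hends e he).1), h]
      · have := hentr _ (hent e he i hi h)
        rwa [Nat.sub_add_cancel (Nat.one_le_iff_ne_zero.2 h)] at this
    · split_ifs with h
      · rw [chartPoint_discCoord (hball _ (hends e he).2), h]
      · exact hexit _ (hexi e he i hi h)
  · intro d hd
    obtain ⟨e, he, i, hi, rfl⟩ := D.mem_pieces.1 hd
    exact D.arc_mem e ((hmem e).1 he) i hi
  · intro d hd z hz t ht
    obtain ⟨e, he, i, hi, rfl⟩ := D.mem_pieces.1 hd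
    obtain ⟨v, hv, rfl⟩ := Finset.mem_image.1 hz
    exact D.arc_ne_pos e ((hmem e).1 he) i hi v (hV.mem_toFinset.1 hv) t ht
  · intro d hd t ht t' ht' h
    obtain ⟨e, he, i, hi, rfl⟩ := D.mem_pieces.1 hd
    exact (D.arc_inj e ((hmem e).1 he) i hi e ((hmem e).1 he) i hi t ht t' ht' h).2.2
  · refine D.pairwise_pieces hes fun e he i hi e' he' i' hi' hne t ht t' ht' h => ?_
    obtain ⟨h1, h2, -⟩ := D.arc_inj e ((hmem e).1 he) i hi e' ((hmem e').1 he') i' hi' t ht t' ht' h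
    rcases hne with hne | hne
    exacts [hne h1, hne.ne h2]
  · intro d hd
    obtain ⟨e, he, i, hi, rfl⟩ := D.mem_pieces.1 hd
    rfl
  -- Only the first piece of an edge carries its weight, so each edge of `G` labels a single piece.
  · refine D.pairwise_pieces hes fun e he i hi e' he' i' hi' hne h => ?_
    simp only [PlaneModel.piece] at h ⊢
    split_ifs at h ⊢ with h1 h2
    · rcases hne with hne | hne
      exacts [absurd (Option.some.inj h) hne, absurd hne (by omega)]
    · rfl

/-- The sum over `Z` without any signs restores the connections, and contracting the resulting paths
restores `G`. -/
lemma IsPassage.sum_pm {k c : ℕ} {D : PlaneModel (sideWord k c) G} (hV : G.vertexSet.Finite)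
    {es : List β} (hes : es.Nodup) (hmem : ∀ e, e ∈ es ↔ e ∈ G.edgeSet) {a b : β × ℕ → ℝ × ℝ}
    {sym : β × ℕ → ℕ} {τ : β × ℕ → ℝ}
    (K : IsPassage (sideWord k c) (passages D.crossings es) a b sym τ) (w : β → ℂ) :
    ∑ Z ∈ (portLabels (portList (sideWord k c) (sortedLabels (passages D.crossings es) sym τ)
        τ)).powerset, pm ((D.pieces a b es).map (DrawnEdge.eval w))
          ((hV.toFinset.image D.pos).image discCoord ∪ portPts (portList (sideWord k c)
            (sortedLabels (passages D.crossings es) sym τ) τ) Z) = PerfMatch G w := by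
  set S := (hV.toFinset.image D.pos).image discCoord with hSdef
  have hcl := nodup_passages D.crossings hes
  have hinj : Function.Injective discCoord := fun z z' h =>
    Complex.ext (congrArg Prod.fst h) (congrArg Prod.snd h)
  have hlow : ∀ v ∈ S, v.2 < 1 := by
    intro v hv
    obtain ⟨z, hz, rfl⟩ := Finset.mem_image.1 hv
    obtain ⟨x, hx, rfl⟩ := Finset.mem_image.1 hz
    exact (Complex.im_le_norm _).trans_lt (by simpa using D.pos_mem x (hV.mem_toFinset.1 hx))
  have hS : ∀ l ∈ passages D.crossings es, a l ∉ S ∧ b l ∉ S := by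
    intro l hl
    have := K.height l hl
    exact ⟨fun h => (hlow _ h).ne this.1, fun h => (hlow _ h).ne this.2⟩
  have hends : ∀ e ∈ es, discCoord (D.arc e 0 0) ∈ S ∧
      discCoord (D.arc e (D.crossings e) 1) ∈ S := by
    intro e he
    obtain ⟨x, y, hxy⟩ := G.exists_isLink_of_mem_edgeSet ((hmem e).1 he)
    have hx := Finset.mem_image_of_mem discCoord
      (Finset.mem_image_of_mem D.pos (hV.mem_toFinset.2 hxy.left_mem))
    have hy := Finset.mem_image_of_mem discCoord
      (Finset.mem_image_of_mem D.pos (hV.mem_toFinset.2 hxy.right_mem))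
    rcases D.arc_ends e x y hxy with ⟨h, h'⟩ | ⟨h, h'⟩ <;> rw [h, h']
    exacts [⟨hx, hy⟩, ⟨hy, hx⟩]
  have hpts : connPts a b (passages D.crossings es).toFinset = es.toFinset.biUnion fun e =>
      connPts (fun i => a (e, i)) (fun i => b (e, i)) (Finset.range (D.crossings e)) := by
    ext v
    simp only [mem_connPts, Finset.mem_biUnion, List.mem_toFinset, mem_passages, Finset.mem_range]
    constructor
    · rintro ⟨⟨e, i⟩, ⟨he, hi⟩, h⟩
      exact ⟨e, he, i, hi, h⟩
    · rintro ⟨e, he, i, hi, h⟩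
      exact ⟨(e, i), ⟨he, hi⟩, h⟩
  have hne : ∀ v ∈ S, ∀ v', v' ∉ S → v' ≠ v := fun v hv v' hv' h => hv' (h ▸ hv)
  have hconn : (passages D.crossings es).map (fun l => (a l, b l, (1 : ℂ))) = es.flatMap fun e =>
      (List.range (D.crossings e)).map fun i => (a (e, i), b (e, i), (1 : ℂ)) := by
    rw [passages, List.map_flatMap]
    simp only [List.map_map, Function.comp_def]
  rw [K.portLabels_eq]
  calc _ = ∑ Z ∈ (passages D.crossings es).toFinset.powerset,
        pm ((D.pieces a b es).map (DrawnEdge.eval w)) (S ∪ connPts a b Z) :=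
        Finset.sum_congr rfl fun Z hZ => by rw [K.portPts_eq (Finset.mem_powerset.1 hZ)]
    _ = pm ((passages D.crossings es).map (fun l => (a l, b l, (1 : ℂ))) ++
          (D.pieces a b es).map (DrawnEdge.eval w))
          (S ∪ connPts a b (passages D.crossings es).toFinset) :=
        (pm_connections _ hcl K.ne K.inj K.inj_right hS).symm
    _ = pm (es.map fun e => (discCoord (D.arc e 0 0), discCoord (D.arc e (D.crossings e) 1), w e))
          S := by
        have h := pm_paths (x := fun e => discCoord (D.arc e 0 0))
          (y := fun e => discCoord (D.arc e (D.crossings e) 1)) (p := a) (q := b) (w := w)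
          (c := D.crossings) hes (L := []) (S := S) (Q := {l | l ∈ passages D.crossings es})
          (fun l => mem_passages) K.ne (fun l hl l' hl' => K.inj l hl l' hl')
          (fun l hl l' hl' => K.inj_right l hl l' hl') hS
          (fun l hl e he => ⟨hne _ (hends e he).1 _ (hS l hl).1, hne _ (hends e he).1 _ (hS l hl).2,
            hne _ (hends e he).2 _ (hS l hl).1, hne _ (hends e he).2 _ (hS l hl).2⟩)
          (fun l _ => by simp [Fresh])
        rw [List.append_nil, List.append_nil] at h
        rw [← h, hpts, hconn, D.map_eval_pieces]
        exact pm_perm (List.perm_append_comm.trans (List.flatMap_append_perm _ _ _)) _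
    _ = PerfMatch G w := by
        refine (PerfMatch_eq_pm G hes hmem (φ := fun v => discCoord (D.pos v)) ?_ ?_ ?_ w).symm
        · exact fun x hx y hy h => D.pos_injOn hx hy (hinj h)
        · simp [hSdef, Set.image_image]
        · intro e x y h
          rcases D.arc_ends e x y h with ⟨h1, h2⟩ | ⟨h1, h2⟩
          · exact Or.inl ⟨congrArg discCoord h1, congrArg discCoord h2⟩
          · exact Or.inr ⟨congrArg discCoord h1, congrArg discCoord h2⟩

lemma PlaneModel.exists_isPassage {W : SideWord} (D : PlaneModel W G) {es : List β}
    (hmem : ∀ e, e ∈ es ↔ e ∈ G.edgeSet) :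
    ∃ a b sym τ, IsPassage W (passages D.crossings es) a b sym τ ∧
      (∀ l ∈ passages D.crossings es, D.arc l.1 l.2 1 = chartPoint (a l)) ∧
      ∀ l ∈ passages D.crossings es, D.arc l.1 (l.2 + 1) 0 = chartPoint (b l) := by
  have h : ∀ l : β × ℕ, ∃ (a b : ℝ × ℝ) (s : ℕ) (t : ℝ), l ∈ passages D.crossings es →
      (∃ j j' : Fin W.length, j ≠ j' ∧ (W.get j).1 = s ∧ (W.get j').1 = s ∧
        t ∈ Set.Ioo (0 : ℝ) 1 ∧ a = sideCoord W j t ∧ b = sideCoord W j' t) ∧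
          D.arc l.1 l.2 1 = chartPoint a ∧ D.arc l.1 (l.2 + 1) 0 = chartPoint b := by
    intro l
    by_cases hl : l ∈ passages D.crossings es
    · obtain ⟨he, hi⟩ := mem_passages.1 hl
      obtain ⟨j, j', t, hj, hs, ht, h1, h2⟩ :=
        (D.arc_glued l.1 ((hmem _).1 he) l.2 hi).exists_param
      exact ⟨_, _, _, t, fun _ => ⟨⟨j, j', hj, rfl, hs.symm, ht, rfl, rfl⟩, h1, h2⟩⟩
    -- The values for pairs that are not passages are arbitrary.
    · exact ⟨0, 0, 0, 0, fun h => absurd h hl⟩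
  choose a b sym τ h using h
  refine ⟨a, b, sym, τ, ⟨fun l hl => (h l hl).1, fun l hl l' hl' e => ?_, fun l hl l' hl' e => ?_⟩,
    fun l hl => (h l hl).2.1, fun l hl => (h l hl).2.2⟩
  · obtain ⟨h1, h2⟩ := mem_passages.1 hl
    obtain ⟨h1', h2'⟩ := mem_passages.1 hl'
    have := D.exit_inj l.1 ((hmem _).1 h1) l.2 h2 l'.1 ((hmem _).1 h1') l'.2 h2'
      (by rw [(h l hl).2.1, (h l' hl').2.1, e])
    exact Prod.ext this.1 this.2
  · obtain ⟨h1, h2⟩ := mem_passages.1 hl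
    obtain ⟨h1', h2'⟩ := mem_passages.1 hl'
    exact D.exit_ne_entrance l.1 ((hmem _).1 h1) l.2 h2 l'.1 ((hmem _).1 h1') l'.2 h2'
      (by rw [(h l hl).2.1, (h l' hl').2.2, e])

lemma card_signChoice (k c : ℕ) : Fintype.card (SignChoice k c) = 2 ^ (2 * k + c) := by
  simp [pow_add, pow_mul]

lemma size_bound {s v e m : ℕ} (h : v + e + m = s) :
    v + (e + m) + 15 * m ^ 2 ≤ 16 * (s + 1) ^ 16 := by
  have h1 : m ^ 2 ≤ (s + 1) ^ 2 := Nat.pow_le_pow_left (by omega) 2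
  have h2 : (s + 1) ^ 2 ≤ (s + 1) ^ 16 := Nat.pow_le_pow_right (by omega) (by norm_num)
  have h3 : s + 1 ≤ (s + 1) ^ 16 := Nat.le_self_pow (by norm_num) _
  omega

end Model

theorem mainTheorem5 :
    -- a finite set of constants and a size bound that do not depend on anything
    ∃ (S : Finset ℂ) (C : ℕ), ∀ (k : ℕ) (B : BaseSurface),
    -- coefficients that depend only on the surface
    ∃ c : Fin (2 ^ (2 * k + B.crossCaps)) → ℂ,
    ∀ {α β : Type*} (G : Graph α β), G.vertexSet.Finite → G.edgeSet.Finite →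
    ∀ D : PlaneModel (sideWord k B.crossCaps) G,
    -- planar graphs with labelled edges that do not depend on the weights of `G`
    ∃ (H : Fin (2 ^ (2 * k + B.crossCaps)) → Graph ℕ ℕ)
      (u : Fin (2 ^ (2 * k + B.crossCaps)) → ℕ → ℂ)
      (o : Fin (2 ^ (2 * k + B.crossCaps)) → ℕ → Option β),
      (∀ θ, (H θ).vertexSet.Finite ∧ (H θ).edgeSet.Finite ∧ IsPlanarGraph (H θ) ∧
        (H θ).vertexSet.ncard + (H θ).edgeSet.ncard ≤ C * (D.size + 1) ^ C ∧
        (∀ f ∈ (H θ).edgeSet, u θ f ∈ S) ∧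
        (∀ f ∈ (H θ).edgeSet, ∀ e, o θ f = some e → e ∈ G.edgeSet) ∧
        (∀ e ∈ G.edgeSet, ∃! f, f ∈ (H θ).edgeSet ∧ o θ f = some e)) ∧
      ∀ w : β → ℂ,
        PerfMatch G w =
          ∑ θ, c θ * PerfMatch (H θ) (fun f => u θ f * (o θ f).elim 1 w) := by

  classical
  -- The outer graph has size at most `15 m^2` for `m` passages, and the vertices and pieces inside
  -- add a linear term. The same number 16 serves as factor and, generously, as exponent.
  refine ⟨unitConstants, 16, fun k B => ?_⟩
  have hcard := card_signChoice k B.crossCaps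
  let θ : Fin (2 ^ (2 * k + B.crossCaps)) ≃ SignChoice k B.crossCaps :=
    (Fintype.equivFinOfCardEq hcard).symm
  refine ⟨fun n => signCoeff (θ n), fun {α β} G hV hE D => ?_⟩
  obtain ⟨es, hes, hmem⟩ : ∃ es : List β, es.Nodup ∧ ∀ e, e ∈ es ↔ e ∈ G.edgeSet :=
    ⟨hE.toFinset.toList, Finset.nodup_toList _, by simp⟩
  obtain ⟨a, b, sym, τ, K, hexit, hentr⟩ := D.exists_isPassage hmem
  have hcut := K.polygonCut hV hes hmem hexit hentr
  have horig : ∀ e, (∃ d ∈ D.pieces a b es, d.orig = some e) ↔ e ∈ G.edgeSet := by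
    intro e
    constructor
    · rintro ⟨d, hd, he⟩
      obtain ⟨e', he', i, -, rfl⟩ := D.mem_pieces.1 hd
      simp only [PlaneModel.piece] at he
      split_ifs at he
      exact Option.some.inj he ▸ (hmem e').1 he'
    · intro he
      exact ⟨_, D.mem_pieces.2 ⟨e, (hmem e).2 he, 0, Nat.zero_le _, rfl⟩, by
        simp [PlaneModel.piece]⟩
  choose H u o h1 h2 h3 h4 h5 h6 h7 h8 using fun n =>
    hcut.exists_graph (strandWeight_mem (θ n))
  refine ⟨H, u, o, fun n => ⟨h1 n, h2 n, h3 n, (h4 n).trans ?_, h5 n,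
    fun f hf e he => (horig e).1 (h6 n f hf e he), fun e he => h7 n e ((horig e).2 he)⟩,
    fun w => ?_⟩
  · have hset : (es.toFinset : Set β) = G.edgeSet := by
      ext e
      simp [hmem]
    rw [sum_length_sortedLabels τ K.sym_lt, D.length_pieces, length_passages]
    apply size_bound
    rw [PlaneModel.size, Finset.card_image_of_injOn (by simpa using D.pos_injOn),
      ← Set.ncard_eq_toFinset_card G.vertexSet hV, ← hset, finsum_mem_coe_finset,
      Set.ncard_coe_finset, List.toFinset_card_of_nodup hes, List.sum_toFinset _ hes]
  -- After exchanging the sums over the choices and over `Z`, the coefficient of each `Z` is 1 by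
  -- `sum_signCoeff`, and `sum_pm` applies.
  · simp only [h8, Finset.mul_sum]
    rw [Finset.sum_comm, ← K.sum_pm hV hes hmem w]
    refine Finset.sum_congr rfl fun Z _ => ?_
    have h := sum_signCoeff k B.crossCaps (sortedLabels (passages D.crossings es) sym τ) Z
    rw [← θ.sum_comp] at h
    simp only [← mul_assoc] at h ⊢
    rw [← Finset.sum_mul, h, one_mul]
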